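/- Let $E$ be a non-archimedean local field of characteristic zero, with quadratic Hilbert symbol $(\cdot,\cdot)$. Let $\widetilde{\mathrm{GL}_2(E)}$ be the two-fold metaplectic cover of $\mathrm{GL}_2(E)$ defined by the Kubota cocycle: as a set it is $\mathrm{GL}_2(E)\times\{\pm1\}$, with group law $(g_1,\epsilon_1)(g_2,\epsilon_2)=(g_1g_2,\epsilon_1\epsilon_2\beta(g_1,g_2))$. Here, writing $(c,d)$ for the lower row of $g$, we put $x(g)=c$ if $c\neq0$ and $x(g)=d$ if $c=0$; for $g_1,g_2\in\mathrm{SL}_2(E)$ $$\beta(g_1,g_2)=(x(g_1),x(g_2))\,(-x(g_1)^{-1}x(g_2),\,x(g_1g_2)),$$ and for $g_1,g_2\in\mathrm{GL}_2(E)$ $$\beta(g_1,g_2)=\beta\big(p(g_1)^{\det g_2},p(g_2)\big)\,v(\det g_2,p(g_1)),$$ where $p(g)=\mathrm{diag}(1,\det g)^{-1}g$, $g^y=\mathrm{diag}(1,y)^{-1}\,g\,\mathrm{diag}(1,y)$, and $v(y,g)=1$ if $c\ne0$, $v(y,g)=(y,d)$ if $c=0$. Its topology is the one generated by the left translates of the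 images of splittings of the cover over open subgroups of $\mathrm{GL}_2(E)$. For a subgroup $X$ of $\mathrm{GL}_2(E)$ let $\tilde X$ be its inverse image. Let $A$ be the group of diagonal matrices, $Z$ the center of $\mathrm{GL}_2(E)$, $Z^2$ the group of squares of elements of $Z$, $N\cong E$ the group of upper triangular unipotent matrices, embedded by $n\mapsto(n,1)$, and $B=AN$. Let $(\tilde\tau,V)$ be a smooth irreducible complex representation of $\tilde A$ that is genuine (i.e. $(1,\epsilon)$ acts by the scalar $\epsilon$), extended to $\tilde B$ trivially on $N$, and let $\pi$ be (isomorphic to) the principal series representation obtained from it by normalised induction: the space of locally constant functions $f:\widetilde{\mathrm{GL}_2(E)}\to V$ with $f(n\tilde a g)=\delta^{1/2}(\tilde a)\,\tilde\tau(\tilde a)f(g)$ for $n\in N$, $\tilde a\in\tilde A$, on which the group acts by right translation; here $\delta(\mathrm{diag}(a,d),\epsilon)=|a/d|$. (It is not assumed that $\pi$ is irreducible.) Let $\omega_\pi:\widetilde{Z^2}\to\mathbb C^\times$ be the central character of $\pi$, and let $\psi$ be a nontrivial continuous additive character of $E$. Let $\pi_{N,\psi}$ be the quotient of $\pi$ by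 the span of all $\pi(n)v-\psi(n)v$ with $n\in N$, $v\in\pi$, with its induced action of $\tilde Z$, and let $\Omega(\omega_\pi)$ be the set of all characters $\mu:\tilde Z\to\mathbb C^\times$ with $\mu|_{\widetilde{Z^2}}=\omega_\pi$, regarded also as the $\tilde Z$-module $\bigoplus_{\mu}\mu$. Then every $\mu\in\Omega(\omega_\pi)$ occurs in $\pi_{N,\psi}$, i.e. $\mathrm{Hom}_{\tilde Z}(\pi_{N,\psi},\mu)\neq0$. Moreover $$\pi_{N,\psi}\;\cong\;\Omega(\omega_\pi)$$ as $\tilde Z$-modules, and $\pi_{N,\psi}$ is finite dimensional, of dimension $[E^\times:E^{\times2}]$. -/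

import Mathlib

open Matrix
open scoped NNReal

noncomputable section

namespace Metaplectic

/-! ### The quadratic Hilbert symbol and the Kubota cocycle -/

section Cocycle

variable {E : Type*} [Field E]

open Classical in
/-- The quadratic Hilbert symbol: for `a, b ≠ 0` it is `1` if `z² = a x² + b y²` has a nontrivial
solution in `E`, and `-1` otherwise. -/
def hilbertSymbol (a b : E) : ℤˣ :=
  if ∃ x y z : E, (x ≠ 0 ∨ y ≠ 0 ∨ z ≠ 0) ∧ z ^ 2 = a * x ^ 2 + b * y ^ 2 then 1 else -1

open Classical in
/-- `x(g) = c` if `c ≠ 0` and `x(g) = d` if `c = 0`, where `(c, d)` is the lower row of `g`. -/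
def kubotaX (g : Matrix (Fin 2) (Fin 2) E) : E :=
  if g 1 0 ≠ 0 then g 1 0 else g 1 1

/-- The Kubota cocycle on `SL₂(E)`. -/
def cocycleSL (g₁ g₂ : Matrix (Fin 2) (Fin 2) E) : ℤˣ :=
  hilbertSymbol (kubotaX g₁) (kubotaX g₂) *
    hilbertSymbol (-(kubotaX g₁)⁻¹ * kubotaX g₂) (kubotaX (g₁ * g₂))

/-- The matrix `p(g)` of determinant one with `g = diag(1, det g) p(g)`. -/
def slPart (g : Matrix (Fin 2) (Fin 2) E) : Matrix (Fin 2) (Fin 2) E :=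
  !![1, 0; 0, (g.det)⁻¹] * g

/-- `g^y = diag(1, y⁻¹) g diag(1, y)`. -/
def conjBy (y : E) (g : Matrix (Fin 2) (Fin 2) E) : Matrix (Fin 2) (Fin 2) E :=
  !![1, 0; 0, y⁻¹] * g * !![1, 0; 0, y]

open Classical in
/-- `v(y, g) = 1` if `c ≠ 0` and `v(y, g) = (y, d)` if `c = 0`. -/
def kubotaV (y : E) (g : Matrix (Fin 2) (Fin 2) E) : ℤˣ :=
  if g 1 0 ≠ 0 then 1 else hilbertSymbol y (g 1 1)

/-- The Kubota cocycle on `GL₂(E)`: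
`β(g₁, g₂) = β(p(g₁)^{det g₂}, p(g₂)) v(det g₂, p(g₁))`. -/
def cocycle (g₁ g₂ : GL (Fin 2) E) : ℤˣ :=
  cocycleSL (conjBy (g₂ : Matrix (Fin 2) (Fin 2) E).det (slPart (g₁ : Matrix (Fin 2) (Fin 2) E)))
      (slPart (g₂ : Matrix (Fin 2) (Fin 2) E)) *
    kubotaV (g₂ : Matrix (Fin 2) (Fin 2) E).det (slPart (g₁ : Matrix (Fin 2) (Fin 2) E))

theorem hilbertSymbol_one_left (b : E) : hilbertSymbol 1 b = 1 :=
  if_pos ⟨1, 0, 1, by simp, by ring⟩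

theorem hilbertSymbol_one_right (a : E) : hilbertSymbol a 1 = 1 :=
  if_pos ⟨0, 1, 1, by simp, by ring⟩

theorem hilbertSymbol_neg_self (a : E) : hilbertSymbol (-a) a = 1 :=
  if_pos ⟨1, 1, 0, by simp, by ring⟩

theorem hilbertSymbol_neg_self_inv (a : E) : hilbertSymbol (-a) a⁻¹ = 1 := by
  rcases eq_or_ne a 0 with rfl | ha
  · simpa using hilbertSymbol_neg_self (0 : E)
  · exact if_pos ⟨1, a, 0, by simp, by field_simp; ring⟩

theorem hilbertSymbol_neg_inv_self (a : E) : hilbertSymbol (-a⁻¹) a = 1 := by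
  simpa using hilbertSymbol_neg_self_inv a⁻¹

theorem cocycle_one_left (g : GL (Fin 2) E) : cocycle 1 g = 1 := by
  have h : (g : Matrix (Fin 2) (Fin 2) E).det ≠ 0 := g.det_ne_zero
  have h1 : slPart (1 : Matrix (Fin 2) (Fin 2) E) = 1 := by
    simp [slPart, Matrix.one_fin_two]
  have h2 : conjBy (g : Matrix (Fin 2) (Fin 2) E).det 1 = 1 := by
    simp [conjBy, Matrix.one_fin_two, h]
  have h3 : kubotaX (1 : Matrix (Fin 2) (Fin 2) E) = 1 := by simp [kubotaX]
  have h4 (y : E) : kubotaV y 1 = 1 := by simp [kubotaV, hilbertSymbol_one_right]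
  simp [cocycle, h1, h2, h3, h4, cocycleSL, hilbertSymbol_one_left, hilbertSymbol_neg_self]

theorem cocycle_one_right (g : GL (Fin 2) E) : cocycle g 1 = 1 := by
  have h1 : slPart (1 : Matrix (Fin 2) (Fin 2) E) = 1 := by
    simp [slPart, Matrix.one_fin_two]
  have h2 (m : Matrix (Fin 2) (Fin 2) E) : conjBy 1 m = m := by
    simp [conjBy, ← Matrix.one_fin_two]
  have h3 : kubotaX (1 : Matrix (Fin 2) (Fin 2) E) = 1 := by simp [kubotaX]
  have h4 (m : Matrix (Fin 2) (Fin 2) E) : kubotaV 1 m = 1 := by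
    simp [kubotaV, hilbertSymbol_one_left]
  simp [cocycle, h1, h2, h3, h4, cocycleSL, hilbertSymbol_one_right, hilbertSymbol_neg_inv_self]

end Cocycle

/-! ### The metaplectic cover -/

/-- The underlying set `GL₂(E) × {±1}` of the metaplectic double cover of `GL₂(E)`. -/
@[ext]
structure Mp (E : Type*) [Field E] where
  gl : GL (Fin 2) E
  sign : ℤˣ

section Cover

variable {E : Type*} [Field E]

/-- The group law `(g₁, ε₁)(g₂, ε₂) = (g₁ g₂, ε₁ ε₂ β(g₁, g₂))` of the metaplectic cover. Only
multiplication and unit are used below (homomorphisms, inverse images of subgroups, translations);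
that they make `Mp E` a group for a local field `E` is the fact that `β` is a `2`-cocycle. -/
instance : MulOneClass (Mp E) where
  mul x y := ⟨x.gl * y.gl, x.sign * y.sign * cocycle x.gl y.gl⟩
  one := ⟨1, 1⟩
  one_mul x := by
    change (⟨1 * x.gl, 1 * x.sign * cocycle 1 x.gl⟩ : Mp E) = x
    simp [cocycle_one_left]
  mul_one x := by
    change (⟨x.gl * 1, x.sign * 1 * cocycle x.gl 1⟩ : Mp E) = x
    simp [cocycle_one_right]

theorem mul_def (x y : Mp E) :
    x * y = ⟨x.gl * y.gl, x.sign * y.sign * cocycle x.gl y.gl⟩ := rfl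

variable (E) in
/-- The covering map `Mp E → GL₂(E)`. -/
def proj : Mp E →* GL (Fin 2) E where
  toFun := Mp.gl
  map_one' := rfl
  map_mul' _ _ := rfl

/-- The inverse image in the metaplectic cover of a subgroup of `GL₂(E)`. -/
def cover (H : Subgroup (GL (Fin 2) E)) : Submonoid (Mp E) :=
  H.toSubmonoid.comap (proj E)

variable (E) in
/-- The group `A` of diagonal matrices in `GL₂(E)`. -/
def torus : Subgroup (GL (Fin 2) E) :=
  (Units.map (Matrix.diagonalRingHom (Fin 2) E : (Fin 2 → E) →* Matrix (Fin 2) (Fin 2) E)).range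

variable (E) in
/-- The center `Z` of `GL₂(E)`, the group of scalar matrices. -/
def scalars : Subgroup (GL (Fin 2) E) :=
  (Matrix.GeneralLinearGroup.scalar (Fin 2) : Eˣ →* GL (Fin 2) E).range

variable (E) in
/-- The group `Z²` of squares of elements of `Z`. -/
def scalarsSq : Subgroup (GL (Fin 2) E) :=
  ((Matrix.GeneralLinearGroup.scalar (Fin 2) : Eˣ →* GL (Fin 2) E).comp (powMonoidHom 2)).range

theorem cover_scalarsSq_le : cover (scalarsSq E) ≤ cover (scalars E) := by
  rintro x ⟨t, ht⟩
  exact ⟨t ^ 2, ht⟩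

/-- The element `(1, ε)` of `μ₂ ⊆ Mp E`. -/
def muElt (ε : ℤˣ) : Mp E := ⟨1, ε⟩

theorem muElt_mem_cover (H : Subgroup (GL (Fin 2) E)) (ε : ℤˣ) : muElt ε ∈ cover H :=
  H.one_mem

/-- The unipotent element `([[1, n], [0, 1]], 1)` of `N ⊆ Mp E`. -/
def unip (n : E) : Mp E := ⟨Matrix.GeneralLinearGroup.upperRightHom n, 1⟩

/-- The cover of the center commutes with `N`. -/
theorem cover_scalars_comm {z : Mp E} (hz : z ∈ cover (scalars E)) (n : E) :
    z * unip n = unip n * z := by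
  obtain ⟨t, ht⟩ := hz
  have ht' : z.gl = Matrix.GeneralLinearGroup.scalar (Fin 2) t := ht.symm
  have hzm : (z.gl : Matrix (Fin 2) (Fin 2) E) = !![(t : E), 0; 0, (t : E)] := by
    rw [ht']
    ext i j
    fin_cases i <;> fin_cases j <;> simp
  have hn : ((unip n : Mp E).gl : Matrix (Fin 2) (Fin 2) E) = !![1, n; 0, 1] := by
    simp [unip]
  have h0 : (t : E) ≠ 0 := t.ne_zero
  have hp : slPart (!![(t : E), 0; 0, (t : E)]) = !![(t : E), 0; 0, (t : E)⁻¹] := by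
    simp [slPart, Matrix.det_fin_two, h0]
  have hq : slPart (!![1, n; 0, 1]) = !![1, n; 0, 1] := by
    simp [slPart, Matrix.det_fin_two]
  have c1 : cocycle z.gl (unip n : Mp E).gl = 1 := by
    simp [cocycle, hzm, hn, hp, hq, conjBy, cocycleSL, kubotaX, kubotaV, Matrix.det_fin_two,
      hilbertSymbol_one_left, hilbertSymbol_one_right, hilbertSymbol_neg_self_inv]
  have c2 : cocycle (unip n : Mp E).gl z.gl = 1 := by
    have h5 : (t : E)⁻¹ * (t : E)⁻¹ * ((t : E) * (t : E)) = 1 := by field_simp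
    simp [cocycle, hzm, hn, hp, hq, conjBy, cocycleSL, kubotaX, kubotaV, Matrix.det_fin_two, h5,
      hilbertSymbol_one_left, hilbertSymbol_one_right, hilbertSymbol_neg_self]
  ext1
  · change z.gl * (unip n : Mp E).gl = (unip n : Mp E).gl * z.gl
    apply Units.ext
    simp only [Units.val_mul, hzm, hn]
    ext i j
    fin_cases i <;> fin_cases j <;> simp [mul_comm]
  · simp only [mul_def, c1, c2, mul_comm]

end Cover

section Topology

variable {E : Type*} [Field E] [TopologicalSpace E]

/-- `s` is a splitting of the cover over the subgroup `U` of `GL₂(E)`. -/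
def IsSplitting (U : Subgroup (GL (Fin 2) E)) (s : U →* Mp E) : Prop :=
  ∀ u : U, proj E (s u) = u

/-- The topology of the metaplectic cover: generated by the translates `x · s(U)` of the images of
splittings `s` of the cover over open subgroups `U` of `GL₂(E)`. -/
instance : TopologicalSpace (Mp E) :=
  TopologicalSpace.generateFrom
    {S | ∃ (U : Subgroup (GL (Fin 2) E)) (s : U →* Mp E) (x : Mp E),
      IsOpen (U : Set (GL (Fin 2) E)) ∧ IsSplitting U s ∧ S = Set.range fun u : U ↦ x * s u}

end Topology

/-! ### Representations -/

section Representations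

variable {E : Type*} [Field E] {V : Type*} [AddCommGroup V] [Module ℂ V]

/-- Irreducibility of a representation. -/
def IsIrred {G : Type*} [MulOneClass G] (τ : G →* Module.End ℂ V) : Prop :=
  Nontrivial V ∧ ∀ S : Submodule ℂ V, (∀ g, ∀ v ∈ S, τ g v ∈ S) → S = ⊥ ∨ S = ⊤

/-- Smoothness of a representation: the stabilizer of every vector is open. -/
def IsSmoothRep {G : Type*} [MulOneClass G] [TopologicalSpace G] (τ : G →* Module.End ℂ V) :
    Prop :=
  ∀ v : V, IsOpen {g : G | τ g v = v}

/-- A representation of the inverse image of a subgroup of `GL₂(E)` is genuine if `μ₂ = {±1}` acts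
by scalar multiplication. -/
def IsGenuine {H : Subgroup (GL (Fin 2) E)} (τ : cover H →* Module.End ℂ V) : Prop :=
  ∀ (ε : ℤˣ) (v : V), τ ⟨muElt ε, muElt_mem_cover H ε⟩ v = ((ε : ℤ) : ℂ) • v

end Representations

section Induction

variable {E : Type*} [Field E] [TopologicalSpace E] [IsTopologicalRing E] [LocallyCompactSpace E]
  {V : Type*} [AddCommGroup V] [Module ℂ V]

open Classical in
/-- The normalised absolute value of `E`: the factor by which multiplication by `x` scales the
additive Haar measure. -/
def normAbs (x : E) : ℝ≥0 :=
  if h : x = 0 then 0 else MeasureTheory.distribHaarChar E (Units.mk0 x h)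

/-- `δ^{1/2}(diag(a, d)) = |a / d|^{1/2}`, the square root of the modulus character of the group
of upper triangular matrices. -/
def deltaHalf (g : GL (Fin 2) E) : ℝ≥0 :=
  NNReal.sqrt (normAbs ((g : Matrix (Fin 2) (Fin 2) E) 0 0 / (g : Matrix (Fin 2) (Fin 2) E) 1 1))

/-- The space of the normalised induction from `B̃ = N Ã` to `Mp E` of a representation `τ` of `Ã`
extended trivially to `N`: the locally constant functions `f : Mp E → V` such that
`f (n a g) = δ^{1/2}(a) τ(a) f(g)` for `n ∈ N`, `a ∈ Ã`, `g ∈ Mp E`. -/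
def inducedSpace (τ : cover (torus E) →* Module.End ℂ V) : Submodule ℂ (Mp E → V) where
  carrier := {f | IsLocallyConstant f ∧ ∀ (n : E) (a : cover (torus E)) (g : Mp E),
    f (unip n * a * g) = ((deltaHalf (a : Mp E).gl : ℝ) : ℂ) • τ a (f g)}
  zero_mem' := ⟨IsLocallyConstant.const 0, by simp⟩
  add_mem' := by
    rintro f f' ⟨hf, hf2⟩ ⟨hf', hf2'⟩
    refine ⟨?_, fun n a g ↦ ?_⟩
    · exact hf.comp₂ hf' (· + ·)
    · simp [hf2, hf2']
  smul_mem' := by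
    rintro c f ⟨hf, hf2⟩
    refine ⟨?_, fun n a g ↦ ?_⟩
    · exact hf.comp (c • ·)
    · simp [hf2, smul_comm c]

/-- The representation `π` of `Mp E` is isomorphic to the normalised induction of `τ`, on which
`Mp E` acts by right translations. -/
def IsInducedFrom {W : Type*} [AddCommGroup W] [Module ℂ W] (π : Mp E →* Module.End ℂ W)
    (τ : cover (torus E) →* Module.End ℂ V) : Prop :=
  ∃ e : W ≃ₗ[ℂ] inducedSpace τ, ∀ (g : Mp E) (w : W) (x : Mp E),
    (e (π g w) : Mp E → V) x = (e w : Mp E → V) (x * g)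

end Induction

section Jacquet

variable {E : Type*} [Field E] {W : Type*} [AddCommGroup W] [Module ℂ W]

/-- `ω` is the central character of `π`: the inverse image of `Z²`, which is the center of `Mp E`,
acts on `W` through `ω`. -/
def IsCentralChar (π : Mp E →* Module.End ℂ W) (ω : cover (scalarsSq E) →* ℂˣ) : Prop :=
  ∀ (z : cover (scalarsSq E)) (w : W), π z w = (ω z : ℂ) • w

/-- The subspace `π(N, ψ)` spanned by the vectors `π(n)w - ψ(n)w`. -/
def jacquetKer (π : Mp E →* Module.End ℂ W) (ψ : AddChar E Circle) : Submodule ℂ W :=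
  Submodule.span ℂ {v | ∃ (n : E) (w : W), v = π (unip n) w - (ψ n : ℂ) • w}

/-- The `ψ`-twisted Jacquet module `π_{N,ψ}`. -/
abbrev JacquetModule (π : Mp E →* Module.End ℂ W) (ψ : AddChar E Circle) : Type _ :=
  W ⧸ jacquetKer π ψ

theorem jacquetKer_le_comap (π : Mp E →* Module.End ℂ W) (ψ : AddChar E Circle)
    (z : cover (scalars E)) : jacquetKer π ψ ≤ (jacquetKer π ψ).comap (π z) := by
  refine Submodule.span_le.2 ?_
  rintro _ ⟨n, w, rfl⟩
  refine Submodule.subset_span ⟨n, π z w, ?_⟩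
  rw [map_sub, map_smul, ← Module.End.mul_apply, ← map_mul, cover_scalars_comm z.2, map_mul,
    Module.End.mul_apply]

/-- The action of `Z̃` on the twisted Jacquet module `π_{N,ψ}`. -/
def jacquetRep (π : Mp E →* Module.End ℂ W) (ψ : AddChar E Circle) :
    cover (scalars E) →* Module.End ℂ (JacquetModule π ψ) where
  toFun z := (jacquetKer π ψ).mapQ (jacquetKer π ψ) (π z) (jacquetKer_le_comap π ψ z)
  map_one' := by
    ext w
    simp
  map_mul' z z' := by
    ext w
    simp

/-- The set `Ω(ω)` of characters of `Z̃` whose restriction to the inverse image of `Z²` is `ω`. -/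
abbrev Omega (ω : cover (scalarsSq E) →* ℂˣ) : Type _ :=
  {μ : cover (scalars E) →* ℂˣ // μ.comp (Submonoid.inclusion cover_scalarsSq_le) = ω}

/-- The `Z̃`-module `Ω(ω) = ⨁ μ`, the sum over all characters `μ` in the set `Ω(ω)`. -/
def omegaRep (ω : cover (scalarsSq E) →* ℂˣ) :
    cover (scalars E) →* Module.End ℂ (DirectSum (Omega ω) fun _ ↦ ℂ) where
  toFun z := DirectSum.lmap fun μ : Omega ω ↦ ((μ.1 z : ℂˣ) : ℂ) • (LinearMap.id : ℂ →ₗ[ℂ] ℂ)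
  map_one' := by
    refine LinearMap.ext fun f ↦ DFinsupp.ext fun μ ↦ ?_
    simp
  map_mul' z z' := by
    refine LinearMap.ext fun f ↦ DFinsupp.ext fun μ ↦ ?_
    simp [DirectSum.lmap_apply, mul_assoc]

end Jacquet

end Metaplectic

end

/-! Restrict a function `f` of the induced space to the big Bruhat cell. If `f(1) = 0`, then `f`
vanishes on the inverse image of the Borel subgroup and is determined by `n ↦ f(wn)`, which is
locally constant with compact support (`eq_bigCell`, `isLocallyConstant_restrict`,
`hasCompactSupport_restrict`). Conversely every such `V`-valued function on `E` occurs
(`bigCell_mem`). The value at `1` does not contribute to `π_{N,ψ}`: `N` acts trivially on it while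
`ψ` is nontrivial, so in the quotient every vector can be replaced by one with `f(1) = 0`. On
compactly supported locally constant functions the twisted coinvariants are computed by the Fourier
coefficient `∫ ψ(-n) f(wn) dn` in `V` (`exists_whittaker`, `exists_mkQ_eq`). Since `Z̃` commutes
with `N` and with `w` (`weyl_mul_comm`), the outcome is `π_{N,ψ} ≅ τ` as a `Z̃`-module.

It remains to decompose `τ` under `Z̃`. On the torus the cocycle is the Hilbert symbol `(a, d')`, so
`τ` is an irreducible projective representation of `Eˣ × Eˣ`, and elements with square entries act
by scalars. From a common eigenvector of `Z̃`, the operators of `diag(a, 1)` produce eigenvectors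
whose characters are twisted by `(a, ·)`. Nondegeneracy of the symbol makes these twists distinct
for distinct square classes `a`, so they form a basis indexed by `Eˣ/Eˣ²`
(`TwistedRep.Irred.exists_basis`). Counting characters shows that exactly the elements of `Ω(ω)`
occur, each once (`exists_basis_omega`).

Two foundations are needed. Bimultiplicativity and nondegeneracy of the symbol follow from the norm
index `2` of quadratic extensions (`exists_index_two_hilbertSymbol`), which is obtained by counting
square classes in `E` and in the extension. The cocycle identity (`cocycle_mul_cocycle`) makes the
cover a group. Its topology is controlled by two facts: the square of a lift does not depend on the
lift, and elements of `GL₂(E)` near `1` have square roots near `1` (`mul_self_eq_of_gl_eq`,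
`eventually_exists_sq`). -/

section

/-! ### Counting square classes by means of the units congruent to `1` modulo `2p`. -/

section IndexOfSquares

/-- The index of the squares, computed from a subgroup without elements of order two. -/
theorem index_sq_range_of_inf_ker_eq_bot {M : Type*} [CommGroup M] (M' : Subgroup M)
    (hfin : M'.index ≠ 0) (hk : Nat.card (powMonoidHom 2 : M →* M).ker = 2)
    (hbot : M' ⊓ (powMonoidHom 2 : M →* M).ker = ⊥) :
    (powMonoidHom 2 : M →* M).range.index =
      2 * (M'.map (powMonoidHom 2)).relIndex M' := by
  set f : M →* M := powMonoidHom 2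
  have hle : M'.map f ≤ M' := by
    rintro _ ⟨x, hx, rfl⟩
    exact M'.pow_mem hx 2
  -- The index of `M'.map f` is computed twice: through `M'`, and through the kernel and range of
  -- `f`. Since `M'` meets the kernel trivially, `M'` has index `2` in `M' ⊔ f.ker`.
  have h1 := Subgroup.relIndex_mul_index hle
  have h2 := M'.index_map f
  have h3 : M'.relIndex (M' ⊔ f.ker) * (M' ⊔ f.ker).index = M'.index :=
    Subgroup.relIndex_mul_index le_sup_left
  have h4 : M'.relIndex (M' ⊔ f.ker) = 2 := by
    rw [Subgroup.relIndex_sup_left, ← Subgroup.inf_relIndex_right, hbot, Subgroup.relIndex_bot_left, hk]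
  rw [h2, ← h3, h4] at h1
  have h5 : (M' ⊔ f.ker).index ≠ 0 := fun h ↦ hfin (by rw [← h3, h, mul_zero])
  apply Nat.eq_of_mul_eq_mul_left (Nat.pos_of_ne_zero h5)
  rw [← h1]
  ring

/-- The unit `1 + x` for `x` in the Jacobson radical. -/
theorem HenselianRing.isUnit_one_add {R : Type*} [CommRing R] {I : Ideal R} [HenselianRing R I]
    {x : R} (hx : x ∈ I) : IsUnit (1 + x) := by
  have := HenselianRing.jac (R := R) (I := I) hx
  rw [Ideal.mem_jacobson_bot] at this
  simpa [add_comm] using this 1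

/-- After the substitution `y = 1 + 2t` the equation `y² = 1 + 4x` becomes `t² + t = x`, whose
derivative at `0` is `1`. Hensel's lemma therefore applies in every residue characteristic,
including `2`. -/
theorem HenselianRing.exists_sq_eq {R : Type*} [CommRing R] {I : Ideal R} [HenselianRing R I]
    {x : R} (hx : x ∈ I) : ∃ t ∈ I, (1 + 2 * t) ^ 2 = 1 + 4 * x := by
  open Polynomial in
  obtain ⟨t, ht, ht'⟩ := HenselianRing.is_henselian (I := I) (X ^ 2 + X - C x : R[X])
    (by nontriviality R; monicity!) 0 (by simpa using hx) (by simp)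
  refine ⟨t, by simpa using ht', ?_⟩
  have : t ^ 2 + t - x = 0 := by simpa using ht
  linear_combination 4 * this

variable (R : Type*) [CommRing R] (p : R)

/-- The group of units congruent to `1` modulo `2p`. -/
def unitsOneModTwoMul : Subgroup Rˣ :=
  (Units.map (Ideal.Quotient.mk (Ideal.span {2 * p}) : R →* R ⧸ Ideal.span {2 * p})).ker

variable {R p}

theorem mem_unitsOneModTwoMul {u : Rˣ} :
    u ∈ unitsOneModTwoMul R p ↔ ∃ x, (u : R) = 1 + 2 * p * x := by
  rw [unitsOneModTwoMul, MonoidHom.mem_ker, Units.ext_iff]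
  simp only [Units.coe_map, MonoidHom.coe_coe, Units.val_one]
  rw [← map_one (Ideal.Quotient.mk _), Ideal.Quotient.mk_eq_mk_iff_sub_mem,
    Ideal.mem_span_singleton]
  constructor
  · rintro ⟨x, hx⟩
    exact ⟨x, by linear_combination hx⟩
  · rintro ⟨x, hx⟩
    exact ⟨x, by linear_combination hx⟩

variable [IsDomain R] [CharZero R]

/-- The coordinate `x` of `1 + 2px` is additive modulo `2`. A square `(1 + 2pt)²` has the even
coordinate `2(t + pt²)`, and Hensel's lemma shows that an even coordinate gives a square. So the
squares are the kernel of a surjection onto `R/2`. -/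
theorem index_sq_unitsOneModTwoMul (hp : p ≠ 0) [HenselianRing R (Ideal.span {p})] :
    (powMonoidHom 2 : unitsOneModTwoMul R p →* unitsOneModTwoMul R p).range.index =
      Nat.card (R ⧸ Ideal.span {(2 : R)}) := by
  have hp2 : 2 * p ≠ 0 := mul_ne_zero two_ne_zero hp
  choose x hx using fun u : unitsOneModTwoMul R p ↦ mem_unitsOneModTwoMul.1 u.2
  let f : unitsOneModTwoMul R p →* Multiplicative (R ⧸ Ideal.span {(2 : R)}) :=
    { toFun u := .ofAdd (Ideal.Quotient.mk _ (x u))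
      map_one' := by
        have h : 2 * p * x 1 = 0 := by linear_combination -(hx 1) + (Units.val_one : ((1 : Rˣ) : R) = 1)
        rw [(mul_eq_zero.1 h).resolve_left hp2, map_zero, ofAdd_zero]
      map_mul' u v := by
        rw [← ofAdd_add, ← map_add]
        congr 1
        rw [Ideal.Quotient.mk_eq_mk_iff_sub_mem, Ideal.mem_span_singleton]
        refine ⟨p * x u * x v, mul_left_cancel₀ hp2 ?_⟩
        have h1 := hx (u * v)
        simp only [Subgroup.coe_mul, Units.val_mul, hx u, hx v] at h1
        linear_combination -h1 }
  have hf : Function.Surjective f := by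
    intro y
    obtain ⟨y, rfl⟩ := Ideal.Quotient.mk_surjective (Multiplicative.toAdd y)
    have hu : IsUnit (1 + 2 * p * y) := HenselianRing.isUnit_one_add (I := Ideal.span {p})
      (Ideal.mem_span_singleton.2 ⟨2 * y, by ring⟩)
    refine ⟨⟨hu.unit, mem_unitsOneModTwoMul.2 ⟨y, rfl⟩⟩, ?_⟩
    have := hx ⟨hu.unit, mem_unitsOneModTwoMul.2 ⟨y, rfl⟩⟩
    simp only [IsUnit.unit_spec] at this
    have h3 := mul_left_cancel₀ hp2 (add_left_cancel this)
    change Multiplicative.ofAdd (Ideal.Quotient.mk _ (x _)) = _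
    rw [← h3]
    rfl
  have hk : f.ker = (powMonoidHom 2 : unitsOneModTwoMul R p →* _).range := by
    ext u
    rw [MonoidHom.mem_ker]
    change Ideal.Quotient.mk _ (x u) = 0 ↔ _
    rw [Ideal.Quotient.eq_zero_iff_mem, Ideal.mem_span_singleton]
    constructor
    · rintro ⟨y, hy⟩
      obtain ⟨t, ht, h⟩ := HenselianRing.exists_sq_eq (I := Ideal.span {p})
        (Ideal.mem_span_singleton.2 ⟨y, rfl⟩ : p * y ∈ Ideal.span {p})
      obtain ⟨t, rfl⟩ := Ideal.mem_span_singleton.1 ht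
      have hu : IsUnit (1 + 2 * p * t) := HenselianRing.isUnit_one_add (I := Ideal.span {p})
        (Ideal.mem_span_singleton.2 ⟨2 * t, by ring⟩)
      refine ⟨⟨hu.unit, mem_unitsOneModTwoMul.2 ⟨t, rfl⟩⟩, ?_⟩
      ext
      simp only [powMonoidHom_apply, SubmonoidClass.mk_pow, Units.val_pow_eq_pow_val,
        IsUnit.unit_spec, hx u, hy]
      linear_combination h
    · rintro ⟨v, rfl⟩
      have h1 := hx v
      have h2 := hx (v ^ 2)
      rw [Subgroup.coe_pow, Units.val_pow_eq_pow_val, h1] at h2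
      refine ⟨x v + p * x v ^ 2, mul_left_cancel₀ hp2 ?_⟩
      simp only [powMonoidHom_apply]
      linear_combination -h2
  rw [← hk, Subgroup.index_ker, MonoidHom.range_eq_top.2 hf, Subgroup.card_top]
  rfl

variable {K : Type*} [Field K] (j : R →+* K)

theorem card_ker_sq_units (K : Type*) [Field K] [CharZero K] :
    Nat.card (powMonoidHom 2 : Kˣ →* Kˣ).ker = 2 := by
  have : ((powMonoidHom 2 : Kˣ →* Kˣ).ker : Set Kˣ) = {1, -1} := by
    ext u
    simp only [SetLike.mem_coe, MonoidHom.mem_ker, powMonoidHom_apply, Set.mem_insert_iff,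
      Set.mem_singleton_iff, Units.ext_iff, Units.val_pow_eq_pow_val, Units.val_one, Units.val_neg]
    rw [pow_two, mul_self_eq_one_iff]
  change Nat.card ((powMonoidHom 2 : Kˣ →* Kˣ).ker : Set Kˣ) = 2
  rw [this, Nat.card_coe_set_eq, Set.ncard_pair]
  rw [ne_eq, Units.ext_iff]
  simpa using (self_ne_neg (G := K)).2 one_ne_zero

/-- The number of square classes of a field with a suitable "ring of integers" `R`. -/
theorem index_sq_units_eq (hj : Function.Injective j) (hp : p ≠ 0) (hpu : ¬ IsUnit p)
    [HenselianRing R (Ideal.span {p})] (c : R)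
    (hfin : Finite (R ⧸ Ideal.span {2 * p * c}))
    (hK : ∀ x : K, x ≠ 0 → ∃ (n : ℤ) (y z : R), y * z = c ∧ x = j p ^ n * j y) :
    (powMonoidHom 2 : Kˣ →* Kˣ).range.index = 4 * Nat.card (R ⧸ Ideal.span {(2 : R)}) := by
  have : CharZero K := j.charZero_iff hj |>.1 inferInstance
  have hp' : j p ≠ 0 := (map_ne_zero_iff j hj).2 hp
  let U := unitsOneModTwoMul R p
  -- The subgroup `p^ℤ × U` of `Kˣ` has finite index and no element of order two, and its squares
  -- are known factor by factor.
  let g : Multiplicative ℤ × U →* Kˣ := MonoidHom.coprod (zpowersHom Kˣ (Units.mk0 (j p) hp'))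
    ((Units.map (j : R →* K)).comp U.subtype)
  have hg (n : ℤ) (u : U) : (g (.ofAdd n, u) : K) = j p ^ n * j (u : Rˣ) := by
    simp [g]
  have key (n : ℤ) (u : U) (h : j p ^ n * j (u : Rˣ) = 1) : n = 0 ∧ u = 1 := by
    have hn : n = 0 := by
      rcases lt_trichotomy n 0 with hn | hn | hn
      · exfalso
        obtain ⟨k, rfl⟩ : ∃ k : ℕ, n = -(k + 1 : ℕ) := ⟨(-n - 1).toNat, by push_cast; omega⟩
        rw [_root_.zpow_neg, zpow_natCast, inv_mul_eq_one₀ (pow_ne_zero _ hp'), ← map_pow] at h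
        apply hpu
        have h2 : p ^ (k + 1) = (u : Rˣ) := hj h
        exact isUnit_of_dvd_unit (dvd_pow_self p k.succ_ne_zero) (h2 ▸ Units.isUnit _)
      · exact hn
      · exfalso
        obtain ⟨k, rfl⟩ : ∃ k : ℕ, n = (k + 1 : ℕ) := ⟨(n - 1).toNat, by push_cast; omega⟩
        rw [zpow_natCast, ← map_pow, ← map_mul, ← map_one j] at h
        exact hpu (IsUnit.of_mul_eq_one (p ^ k * (u : Rˣ)) (by rw [← hj h]; ring))
    subst hn
    refine ⟨rfl, ?_⟩
    ext
    apply hj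
    simpa using h
  have hg_inj : Function.Injective g := by
    rw [injective_iff_map_eq_one]
    rintro ⟨n, u⟩ h
    obtain ⟨rfl, rfl⟩ := key n.toAdd u (by rw [← hg, ofAdd_toAdd, h, Units.val_one])
    rfl
  have hbot : g.range ⊓ (powMonoidHom 2 : Kˣ →* Kˣ).ker = ⊥ := by
    rw [eq_bot_iff]
    rintro _ ⟨⟨⟨n, u⟩, rfl⟩, h⟩
    have h1 : g ((n, u) ^ 2) = 1 := by rw [map_pow]; exact h
    obtain ⟨h2, h3⟩ := key (2 * n.toAdd) (u ^ 2) (by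
      rw [← hg, ← Units.val_one (α := K), ← h1]
      congr 2)
    obtain rfl : n = 1 := by
      change n.toAdd = 0
      omega
    suffices hu : u = 1 by rw [hu]; exact map_one g
    obtain ⟨x, hx⟩ := mem_unitsOneModTwoMul.1 u.2
    have h4 : (((u : Rˣ) : R)) ^ 2 = 1 := by
      rw [← Units.val_pow_eq_pow_val, ← Subgroup.coe_pow, h3]; rfl
    rw [pow_two, mul_self_eq_one_iff] at h4
    rcases h4 with h5 | h5
    · ext; exact h5
    -- If `-1 = 1 + 2px`, then `px = -1` and `p` would be a unit; so `-1` is not in `U`.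
    · exfalso
      apply hpu
      refine IsUnit.of_mul_eq_one (-x) (mul_left_cancel₀ (two_ne_zero (α := R)) ?_)
      linear_combination -h5 + hx
  -- Each class of `Kˣ` modulo `g.range` contains a divisor `y` of `c`. If two divisors satisfy `y ≡
  -- y'` modulo `2pc`, then `y/y' ∈ 1 + 2pR`, because `y'` divides `c`; so the finite ring `R/2pc`
  -- bounds the number of classes.
  have hind : g.range.index ≠ 0 := by
    rw [Subgroup.index_ne_zero_iff_finite]
    classical
    let S := {y : Kˣ // ∃ y' z : R, y' * z = c ∧ (y : K) = j y'}
    choose r s hrs hr using fun y : S ↦ y.2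
    have h1 : ∀ y y' : S, Ideal.Quotient.mk (Ideal.span {2 * p * c}) (r y) =
        Ideal.Quotient.mk (Ideal.span {2 * p * c}) (r y') →
        (QuotientGroup.mk y.1 : Kˣ ⧸ g.range) = QuotientGroup.mk y'.1 := by
      intro y y' h
      rw [Ideal.Quotient.mk_eq_mk_iff_sub_mem, Ideal.mem_span_singleton] at h
      obtain ⟨t, ht⟩ := h
      rw [eq_comm, QuotientGroup.eq]
      have hu : IsUnit (1 + 2 * p * (s y' * t)) :=
        HenselianRing.isUnit_one_add (I := Ideal.span {p})
        (Ideal.mem_span_singleton.2 ⟨2 * (s y' * t), by ring⟩)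
      refine ⟨(.ofAdd 0, ⟨hu.unit, mem_unitsOneModTwoMul.2 ⟨_, rfl⟩⟩), ?_⟩
      ext
      rw [hg, zpow_zero, one_mul, Units.val_mul, eq_comm, Units.val_inv_eq_inv_val,
        inv_mul_eq_iff_eq_mul₀ y'.1.ne_zero, hr, hr, IsUnit.unit_spec, ← map_mul]
      congr 1
      linear_combination ht - 2 * p * t * hrs y'
    have h2 : Function.Surjective fun y : S ↦ (QuotientGroup.mk y.1 : Kˣ ⧸ g.range) := by
      intro q
      obtain ⟨x, rfl⟩ := QuotientGroup.mk_surjective q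
      obtain ⟨n, y, z, hyz, hx⟩ := hK x x.ne_zero
      have hy : j y ≠ 0 := by
        rintro h
        rw [h, mul_zero] at hx
        exact x.ne_zero hx
      refine ⟨⟨Units.mk0 (j y) hy, y, z, hyz, rfl⟩, ?_⟩
      simp only
      rw [QuotientGroup.eq]
      refine ⟨(.ofAdd n, 1), ?_⟩
      ext
      rw [hg, Units.val_mul, hx, Units.val_inv_eq_inv_val]
      simp
      field_simp
    have h3 : Finite (Set.range fun y : S ↦ Ideal.Quotient.mk (Ideal.span {2 * p * c}) (r y)) :=
      inferInstance
    refine Finite.of_surjective (fun q : Set.range fun y : S ↦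
      Ideal.Quotient.mk (Ideal.span {2 * p * c}) (r y) ↦
        (QuotientGroup.mk q.2.choose.1 : Kˣ ⧸ g.range)) fun q ↦ ?_
    obtain ⟨y, rfl⟩ := h2 q
    refine ⟨⟨_, y, rfl⟩, h1 _ _ ?_⟩
    exact Exists.choose_spec (p := fun y' : S ↦ Ideal.Quotient.mk (Ideal.span {2 * p * c}) (r y') =
      Ideal.Quotient.mk (Ideal.span {2 * p * c}) (r y)) ⟨y, rfl⟩
  have hmap : g.range.map (powMonoidHom 2) =
      ((powMonoidHom 2 : Multiplicative ℤ × U →* _).range).map g := by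
    rw [MonoidHom.range_eq_map, MonoidHom.range_eq_map, Subgroup.map_map, Subgroup.map_map]
    congr 1
    ext x : 1
    simp
  have hprod : (powMonoidHom 2 : Multiplicative ℤ × U →* _).range =
      (powMonoidHom 2 : Multiplicative ℤ →* _).range.prod (powMonoidHom 2 : U →* U).range := by
    ext ⟨n, u⟩
    simp [Subgroup.mem_prod, Prod.ext_iff]
  have hZ : (powMonoidHom 2 : Multiplicative ℤ →* _).range.index = 2 := by
    rw [Subgroup.index_eq_two_iff]
    refine ⟨.ofAdd 1, fun n ↦ ?_⟩
    have (m : Multiplicative ℤ) : m ∈ (powMonoidHom 2 : Multiplicative ℤ →* _).range ↔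
        Even m.toAdd := by
      rw [even_iff_exists_two_mul]
      constructor
      · rintro ⟨x, rfl⟩; exact ⟨x.toAdd, by simp⟩
      · rintro ⟨x, hx⟩; exact ⟨.ofAdd x, by rw [← ofAdd_toAdd m, hx, two_mul, ofAdd_add, powMonoidHom_apply, pow_two]⟩
    rw [this, this, toAdd_mul, toAdd_ofAdd, Int.even_add_one, xor_def]
    tauto
  rw [index_sq_range_of_inf_ker_eq_bot g.range hind (card_ker_sq_units K) hbot, hmap]
  nth_rw 2 [MonoidHom.range_eq_map]
  rw [Subgroup.relIndex_map_map_of_injective _ _ hg_inj, Subgroup.relIndex_top_right, hprod,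
    Subgroup.index_prod, hZ, index_sq_unitsOneModTwoMul hp]
  ring

end IndexOfSquares

end

/-! ### Orders `R[√a]` over a complete discrete valuation ring, and the square classes of `E(√a)`.
-/

section

open ValuativeRel

section LocalFieldRing

variable {R : Type*} [CommRing R] {p : R}

/-- Divisibility by an element of `R` is tested on coordinates, so completeness is inherited from
`R` coordinate by coordinate. -/
theorem isAdicComplete_span_quadraticAlgebra (a : R) [IsAdicComplete (Ideal.span {p}) R] :
    IsAdicComplete (Ideal.span {algebraMap R (QuadraticAlgebra R a 0) p})
      (QuadraticAlgebra R a 0) := by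
  have key (n : ℕ) (x y : QuadraticAlgebra R a 0) :
      x ≡ y [SMOD (Ideal.span {algebraMap R (QuadraticAlgebra R a 0) p} ^ n • ⊤ :
        Ideal (QuadraticAlgebra R a 0))] ↔
      x.re ≡ y.re [SMOD (Ideal.span {p} ^ n • ⊤ : Ideal R)] ∧
      x.im ≡ y.im [SMOD (Ideal.span {p} ^ n • ⊤ : Ideal R)] := by
    simp only [SModEq.sub_mem, smul_eq_mul, Ideal.mul_top, Ideal.span_singleton_pow,
      Ideal.mem_span_singleton, ← map_pow, QuadraticAlgebra.algebraMap_dvd_iff]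
    simp
  refine { haus' := fun x hx ↦ ?_, prec' := fun f hf ↦ ?_ }
  · simp only [key] at hx
    ext
    · exact IsHausdorff.haus' (I := Ideal.span {p}) _ fun n ↦ (hx n).1
    · exact IsHausdorff.haus' (I := Ideal.span {p}) _ fun n ↦ (hx n).2
  · simp only [key] at hf
    obtain ⟨r, hr⟩ := IsPrecomplete.prec' (I := Ideal.span {p}) (fun n ↦ (f n).re)
      fun h ↦ (hf h).1
    obtain ⟨s, hs⟩ := IsPrecomplete.prec' (I := Ideal.span {p}) (fun n ↦ (f n).im)
      fun h ↦ (hf h).2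
    exact ⟨⟨r, s⟩, fun n ↦ (key _ _ _).2 ⟨hr n, hs n⟩⟩

theorem natCard_quadraticAlgebra_quotient (a r : R) :
    Nat.card (QuadraticAlgebra R a 0 ⧸ Ideal.span {algebraMap R (QuadraticAlgebra R a 0) r}) =
      Nat.card (R ⧸ Ideal.span {r}) ^ 2 := by
  let f : QuadraticAlgebra R a 0 →+ (R ⧸ Ideal.span {r}) × (R ⧸ Ideal.span {r}) :=
    { toFun x := (Ideal.Quotient.mk _ x.re, Ideal.Quotient.mk _ x.im)
      map_zero' := by simp
      map_add' x y := by simp }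
  have hf : Function.Surjective f := by
    rintro ⟨x, y⟩
    obtain ⟨x, rfl⟩ := Ideal.Quotient.mk_surjective x
    obtain ⟨y, rfl⟩ := Ideal.Quotient.mk_surjective y
    exact ⟨⟨x, y⟩, rfl⟩
  have hk : f.ker =
      (Ideal.span {algebraMap R (QuadraticAlgebra R a 0) r}).toAddSubgroup := by
    ext x
    rw [AddMonoidHom.mem_ker]
    simp [f, Ideal.mem_span_singleton, QuadraticAlgebra.algebraMap_dvd_iff,
      Ideal.Quotient.eq_zero_iff_dvd]
  rw [pow_two, ← Nat.card_prod]
  refine Nat.card_congr ((QuotientAddGroup.quotientAddEquivOfEq hk.symm).toEquiv.trans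
    (QuotientAddGroup.quotientKerEquivOfSurjective f hf).toEquiv)

theorem IsDiscreteValuationRing.hasFiniteQuotients [IsDomain R] [IsDiscreteValuationRing R]
    [Finite (IsLocalRing.ResidueField R)] : Ring.HasFiniteQuotients R where
  finiteQuotient {I} hI := by
    obtain ⟨ϖ, hϖ⟩ := IsDiscreteValuationRing.exists_irreducible R
    obtain ⟨n, rfl⟩ := IsDiscreteValuationRing.ideal_eq_span_pow_irreducible hI hϖ
    rw [IsLocalRing.finite_quotient_iff]
    exact ⟨n, by rw [hϖ.maximalIdeal_eq, Ideal.span_singleton_pow]⟩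

end LocalFieldRing

section SquareClasses

variable {R : Type*} [CommRing R] [IsDomain R] [IsDiscreteValuationRing R]
  {E : Type*} [Field E] [Algebra R E]

theorem IsDiscreteValuationRing.isUnit_iff_not_dvd {p : R} (hp : Irreducible p) {x : R} :
    IsUnit x ↔ ¬ p ∣ x := by
  rw [← not_iff_not, not_not, ← mem_nonunits_iff, ← IsLocalRing.mem_maximalIdeal,
    hp.maximalIdeal_eq, Ideal.mem_span_singleton]

variable (E) in
/-- The extension of the map `R → E` to quadratic algebras. -/
def quadraticAlgebraMap (a : R) :
    QuadraticAlgebra R a 0 →+* QuadraticAlgebra E (algebraMap R E a) 0 where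
  toFun x := ⟨algebraMap R E x.re, algebraMap R E x.im⟩
  map_zero' := by ext <;> simp
  map_one' := by ext <;> simp [QuadraticAlgebra.re_one, QuadraticAlgebra.im_one]
  map_add' x y := by ext <;> simp
  map_mul' x y := by ext <;> simp

variable [IsFractionRing R E]

theorem IsDiscreteValuationRing.exists_zpow_mul_isUnit {p : R} (hp : Irreducible p) {x : E}
    (hx : x ≠ 0) : ∃ (n : ℤ) (u : Rˣ), x = algebraMap R E p ^ n * algebraMap R E u := by
  obtain ⟨a, b, hb, rfl⟩ := IsFractionRing.div_surjective (A := R) x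
  have hp0 : algebraMap R E p ≠ 0 := by simpa using hp.ne_zero
  have ha : a ≠ 0 := by rintro rfl; simp at hx
  obtain ⟨m, u, rfl⟩ := IsDiscreteValuationRing.eq_unit_mul_pow_irreducible ha hp
  obtain ⟨n, v, rfl⟩ :=
    IsDiscreteValuationRing.eq_unit_mul_pow_irreducible (nonZeroDivisors.ne_zero hb) hp
  refine ⟨m - n, u * v⁻¹, ?_⟩
  have hv : algebraMap R E (v : R) ≠ 0 := by simp
  have hv' : algebraMap R E ((v⁻¹ : Rˣ) : R) = (algebraMap R E v)⁻¹ := by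
    rw [eq_comm, inv_eq_iff_eq_inv, ← mul_eq_one_iff_eq_inv₀ (by simp), ← map_mul, ← Units.val_mul]
    simp
  rw [zpow_sub₀ hp0, Units.val_mul, map_mul, map_mul, map_mul, hv', zpow_natCast, zpow_natCast,
    map_pow, map_pow]
  field_simp

omit [IsDomain R] [IsDiscreteValuationRing R] in
theorem quadraticAlgebraMap_injective (a : R) : Function.Injective (quadraticAlgebraMap E a) := by
  intro x y h
  exact QuadraticAlgebra.ext (IsFractionRing.injective R E (congrArg QuadraticAlgebra.re h))
    (IsFractionRing.injective R E (congrArg QuadraticAlgebra.im h))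

/-- Every vector is a multiple of a primitive one. -/
theorem exists_zpow_mul_primitive {p : R} (hp : Irreducible p) {x y : E} (h : x ≠ 0 ∨ y ≠ 0) :
    ∃ (n : ℤ) (u v : R), ¬ (p ∣ u ∧ p ∣ v) ∧ x = algebraMap R E p ^ n * algebraMap R E u ∧
      y = algebraMap R E p ^ n * algebraMap R E v := by
  have hp0 : algebraMap R E p ≠ 0 := by simpa using hp.ne_zero
  have hu (u : Rˣ) : ¬ p ∣ u :=
    (IsDiscreteValuationRing.isUnit_iff_not_dvd hp).1 u.isUnit
  by_cases hx : x = 0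
  · obtain ⟨n, u, hy⟩ := IsDiscreteValuationRing.exists_zpow_mul_isUnit hp (h.resolve_left (· hx))
    exact ⟨n, 0, u, fun h ↦ hu u h.2, by simp [hx], hy⟩
  by_cases hy : y = 0
  · obtain ⟨n, u, hx⟩ := IsDiscreteValuationRing.exists_zpow_mul_isUnit hp hx
    exact ⟨n, u, 0, fun h ↦ hu u h.1, hx, by simp [hy]⟩
  obtain ⟨n, u, rfl⟩ := IsDiscreteValuationRing.exists_zpow_mul_isUnit hp hx
  obtain ⟨m, v, rfl⟩ := IsDiscreteValuationRing.exists_zpow_mul_isUnit hp hy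
  rcases le_total n m with hnm | hnm
  · obtain ⟨k, rfl⟩ := Int.le.dest hnm
    refine ⟨n, u, p ^ k * v, fun h ↦ hu u h.1, rfl, ?_⟩
    rw [zpow_add₀ hp0, map_mul, map_pow, mul_assoc, zpow_natCast]
  · obtain ⟨k, rfl⟩ := Int.le.dest hnm
    refine ⟨m, p ^ k * u, v, fun h ↦ hu v h.2, ?_, rfl⟩
    rw [zpow_add₀ hp0, map_mul, map_pow, mul_assoc, zpow_natCast]

variable [IsAdicComplete (IsLocalRing.maximalIdeal R) R]

/-- Norms of primitive vectors have bounded valuation. If `p ∣ x`, then `y` is a unit and the norm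
has the valuation of `a`, at most `1`. If `x` is a unit and `4p` divided the norm, then `ay²` would
be `x²` times an element of `1 + 4pR`, hence a square by Hensel's lemma, and `a` would be a square
in `E`. -/
theorem norm_primitive_dvd {a : R} (ha : ∀ x : E, x ^ 2 ≠ algebraMap R E a)
    {p : R} (hp : Irreducible p) (hap : ¬ p ^ 2 ∣ a) {x y : R} (hxy : ¬ (p ∣ x ∧ p ∣ y)) :
    x ^ 2 - a * y ^ 2 ∣ 4 * p := by
  have hu {z : R} := IsDiscreteValuationRing.isUnit_iff_not_dvd (x := z) hp
  by_cases hx : p ∣ x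
  · have hy : ¬ p ∣ y := fun h ↦ hxy ⟨hx, h⟩
    obtain ⟨x, rfl⟩ := hx
    by_cases hpa : p ∣ a
    · obtain ⟨a, rfl⟩ := hpa
      have ha' : ¬ p ∣ a := fun ⟨b, hb⟩ ↦ hap ⟨b, by rw [hb]; ring⟩
      have : IsUnit (p * x ^ 2 - a * y ^ 2) := by
        rw [hu, dvd_sub_right (Dvd.intro _ rfl), hp.prime.dvd_mul, not_or]
        exact ⟨ha', fun h ↦ hy (hp.prime.dvd_of_dvd_pow h)⟩
      obtain ⟨z, hz⟩ := this.exists_right_inv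
      exact ⟨4 * z, by linear_combination -4 * p * hz⟩
    · refine (hu.2 ?_).dvd
      rw [dvd_sub_right ⟨p * x ^ 2, by ring⟩, hp.prime.dvd_mul, not_or]
      exact ⟨hpa, fun h ↦ hy (hp.prime.dvd_of_dvd_pow h)⟩
  · refine (ValuationRing.dvd_total _ _).resolve_right fun ⟨z, hz⟩ ↦ ?_
    have hc : IsAdicComplete (Ideal.span {p}) R := by rw [← hp.maximalIdeal_eq]; infer_instance
    obtain ⟨w, hw⟩ := (hu.2 hx).exists_right_inv
    obtain ⟨t, ht, h⟩ := HenselianRing.exists_sq_eq (I := Ideal.span {p})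
      (Ideal.mem_span_singleton.2 ⟨-(w ^ 2 * z), rfl⟩ : p * -(w ^ 2 * z) ∈ Ideal.span {p})
    have h1 : a * y ^ 2 = (x * (1 + 2 * t)) ^ 2 := by
      rw [mul_pow, h]
      linear_combination -hz + 4 * p * z * (x * w + 1) * hw
    have hy : y ≠ 0 := by
      rintro rfl
      have h2 : IsUnit (x * (1 + 2 * t)) := (hu.2 hx).mul
        (HenselianRing.isUnit_one_add (I := Ideal.span {p}) (Ideal.mul_mem_left _ _ ht))
      exact (h2.pow 2).ne_zero (by rw [← h1]; ring)
    have hy' : algebraMap R E y ≠ 0 := by simpa using hy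
    apply ha (algebraMap R E (x * (1 + 2 * t)) / algebraMap R E y)
    rw [div_pow, ← map_pow, ← h1, map_mul, map_pow]
    field_simp

variable [CharZero R] [Finite (IsLocalRing.ResidueField R)]

theorem index_sq_units_fractionRing :
    (powMonoidHom 2 : Eˣ →* Eˣ).range.index = 4 * Nat.card (R ⧸ Ideal.span {(2 : R)}) := by
  obtain ⟨p, hp⟩ := IsDiscreteValuationRing.exists_irreducible R
  have := IsDiscreteValuationRing.hasFiniteQuotients (R := R)
  have hc : IsAdicComplete (Ideal.span {p}) R := by rw [← hp.maximalIdeal_eq]; infer_instance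
  refine index_sq_units_eq (algebraMap R E) (IsFractionRing.injective R E) hp.ne_zero hp.not_isUnit
    1 (Ring.HasFiniteQuotients.finiteQuotient ?_) fun x hx ↦ ?_
  · simpa [Ideal.span_singleton_eq_bot] using hp.ne_zero
  · obtain ⟨n, u, rfl⟩ := IsDiscreteValuationRing.exists_zpow_mul_isUnit hp hx
    exact ⟨n, u, (u⁻¹ : Rˣ), by simp, rfl⟩

/-- The order `R[√a]` need not be integrally closed, so a nonzero element is not a power of `p`
times a unit in general. It is a power of `p` times a primitive element, and the latter divides
`4p`, because its norm does and the norm is the product with the conjugate. -/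
theorem index_sq_units_quadraticAlgebra {a : R} (ha : ∀ x : E, x ^ 2 ≠ algebraMap R E a)
    {p : R} (hp : Irreducible p) (hap : ¬ p ^ 2 ∣ a)
    [Fact (∀ r : E, r ^ 2 ≠ algebraMap R E a + 0 * r)] :
    (powMonoidHom 2 : (QuadraticAlgebra E (algebraMap R E a) 0)ˣ →* _).range.index =
      4 * Nat.card (R ⧸ Ideal.span {(2 : R)}) ^ 2 := by
  have := IsDiscreteValuationRing.hasFiniteQuotients (R := R)
  have hc : IsAdicComplete (Ideal.span {p}) R := by rw [← hp.maximalIdeal_eq]; infer_instance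
  have hc' := isAdicComplete_span_quadraticAlgebra (p := p) a
  have hj := quadraticAlgebraMap_injective (E := E) a
  have : IsDomain (QuadraticAlgebra R a 0) := hj.isDomain _
  have hfq : Ring.HasFiniteQuotients (QuadraticAlgebra R a 0) := .of_module_finite R _
  have hp0 : algebraMap R (QuadraticAlgebra R a 0) p ≠ 0 := by
    rw [ne_eq, map_eq_zero_iff _ QuadraticAlgebra.algebraMap_injective]; exact hp.ne_zero
  have h40 : (4 : QuadraticAlgebra R a 0) ≠ 0 := by exact_mod_cast (by norm_num : (4 : ℕ) ≠ 0)
  have h4p : algebraMap R (QuadraticAlgebra R a 0) (4 * p) = 4 * algebraMap R _ p := by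
    rw [map_mul, map_ofNat]
  rw [← natCard_quadraticAlgebra_quotient a, map_ofNat]
  refine index_sq_units_eq (p := algebraMap R _ p) (quadraticAlgebraMap E a) hj hp0 ?_
    (4 * algebraMap R _ p)
    (Ring.HasFiniteQuotients.finiteQuotient ?_) fun x hx ↦ ?_
  · intro h
    obtain ⟨y, hy⟩ := h.exists_right_inv
    have h1 := congrArg QuadraticAlgebra.re hy
    simp [QuadraticAlgebra.re_one] at h1
    exact hp.not_isUnit (IsUnit.of_mul_eq_one _ h1)
  · rw [ne_eq, Ideal.span_singleton_eq_bot]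
    exact mul_ne_zero (mul_ne_zero two_ne_zero hp0) (mul_ne_zero h40 hp0)
  · have hx' : x.re ≠ 0 ∨ x.im ≠ 0 := by
      by_contra! h
      exact hx (QuadraticAlgebra.ext h.1 h.2)
    obtain ⟨n, u, v, huv, h1, h2⟩ := exists_zpow_mul_primitive hp hx'
    obtain ⟨z, hz⟩ := norm_primitive_dvd ha hp hap huv
    refine ⟨n, ⟨u, v⟩, ⟨u, -v⟩ * algebraMap R _ z, ?_, ?_⟩
    · rw [← h4p, hz, map_mul, ← mul_assoc]
      congr 1
      ext
      · simp [pow_two]; ring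
      · simp [pow_two]; ring
    · have h3 : quadraticAlgebraMap E a (algebraMap R _ p) =
          algebraMap E _ (algebraMap R E p) := by
        ext <;> simp [quadraticAlgebraMap]
      rw [h3, ← map_zpow₀, ← Algebra.smul_def]
      ext
      · simpa [quadraticAlgebraMap] using h1
      · simpa [quadraticAlgebraMap] using h2

end SquareClasses

/-! ### The norm group of a quadratic extension has index two. -/

section NormIndex

variable {E : Type*} [Field E] {b : E} [Fact (∀ r : E, r ^ 2 ≠ b + 0 * r)]

theorem QuadraticAlgebra.mem_range_norm_units {x : Eˣ} :
    x ∈ (Units.map (QuadraticAlgebra.norm (a := b) (b := (0 : E)))).range ↔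
      ∃ r s : E, (x : E) = r ^ 2 - b * s ^ 2 := by
  constructor
  · rintro ⟨u, rfl⟩
    refine ⟨(u : QuadraticAlgebra E b 0).re, (u : QuadraticAlgebra E b 0).im, ?_⟩
    simp [QuadraticAlgebra.norm_def]
    ring
  · rintro ⟨r, s, h⟩
    have h1 : (⟨r, s⟩ : QuadraticAlgebra E b 0).norm = x := by
      rw [h, QuadraticAlgebra.norm_def]
      ring
    have h0 : (⟨r, s⟩ : QuadraticAlgebra E b 0) ≠ 0 := by
      intro h0
      rw [h0, QuadraticAlgebra.norm_zero] at h1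
      exact x.ne_zero h1.symm
    exact ⟨Units.mk0 _ h0, Units.ext h1⟩

/-- The norm index of a quadratic extension with known numbers of square classes. -/
theorem index_norm_range [CharZero E] {c : ℕ} (hc : c ≠ 0)
    (hE : (powMonoidHom 2 : Eˣ →* Eˣ).range.index = 4 * c)
    (hK : (powMonoidHom 2 : (QuadraticAlgebra E b 0)ˣ →* _).range.index = 4 * c ^ 2) :
    (Units.map (QuadraticAlgebra.norm (a := b) (b := (0 : E)))).range.index = 2 := by
  have hb : ∀ r : E, r ^ 2 ≠ b := fun r h ↦
    (Fact.out : ∀ r : E, r ^ 2 ≠ b + 0 * r) r (by rw [h]; ring)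
  have hb0 : b ≠ 0 := fun h ↦ hb 0 (by rw [h]; ring)
  set N : (QuadraticAlgebra E b 0)ˣ →* Eˣ :=
    Units.map (QuadraticAlgebra.norm (a := b) (b := (0 : E)))
  set SE := (powMonoidHom 2 : Eˣ →* Eˣ).range
  set SK := (powMonoidHom 2 : (QuadraticAlgebra E b 0)ˣ →* _).range
  let j : Eˣ →* (QuadraticAlgebra E b 0)ˣ := Units.map (algebraMap E (QuadraticAlgebra E b 0))
  have hNj (e : Eˣ) : N (j e) = e ^ 2 := by
    ext
    simp [N, j]
  -- With `K = E(√b)`: since `N⁻¹(Eˣ²) = EˣKˣ²`, the norm index is `[Eˣ : Eˣ²]` divided by `[Kˣ :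
  -- EˣKˣ²]`. The divisor equals `[Kˣ : Kˣ²]` divided by `[Eˣ : Eˣ ∩ Kˣ²]`, that is `4c²/2c = 2c`.
  have h1 : SE ≤ N.range := by
    rintro _ ⟨e, rfl⟩
    exact ⟨j e, hNj e⟩
  have h2 : (SE.comap N).index * N.range.index = SE.index := by
    rw [Subgroup.index_comap, Subgroup.relIndex_mul_index h1]
  have h3 : SE.comap N = j.range ⊔ SK := by
    apply le_antisymm
    · -- if `N z = e ^ 2`, then `(z + e) ^ 2 = 2 (re z + e) z`
      rintro z ⟨e, he⟩
      have hz : (e : E) ^ 2 = (z : QuadraticAlgebra E b 0).norm := congrArg Units.val he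
      rw [QuadraticAlgebra.norm_def] at hz
      rw [Subgroup.mem_sup]
      by_cases h0 : (z : QuadraticAlgebra E b 0).re + e = 0
      · have him : (z : QuadraticAlgebra E b 0).im = 0 := by
          have : b * (z : QuadraticAlgebra E b 0).im ^ 2 = 0 := by
            linear_combination hz + (z.1.re - e) * h0
          simpa [hb0] using this
        refine ⟨z, ⟨-e, ?_⟩, 1, one_mem _, mul_one z⟩
        ext
        · simp [j]
          linear_combination -h0
        · simp [j, him]
      · have hw : (z : QuadraticAlgebra E b 0) + algebraMap E _ (e : E) ≠ 0 := fun h ↦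
          h0 (by simpa using congrArg QuadraticAlgebra.re h)
        have h2 : (2 * ((z : QuadraticAlgebra E b 0).re + e))⁻¹ ≠ 0 :=
          inv_ne_zero (mul_ne_zero two_ne_zero h0)
        refine ⟨j (Units.mk0 _ h2), ⟨_, rfl⟩, Units.mk0 _ hw ^ 2, ⟨_, rfl⟩, ?_⟩
        rw [Units.ext_iff, Units.val_mul, Units.val_pow_eq_pow_val]
        change algebraMap E (QuadraticAlgebra E b 0) (2 * (z.1.re + e))⁻¹ *
          (z.1 + algebraMap E _ (e : E)) ^ 2 = z.1
        rw [← Algebra.smul_def, inv_smul_eq_iff₀ (mul_ne_zero two_ne_zero h0)]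
        ext
        · simp [pow_two]
          linear_combination hz
        · simp [pow_two]
          ring
    · rw [sup_le_iff]
      constructor
      · rintro _ ⟨e, rfl⟩
        exact ⟨e, (hNj e).symm⟩
      · rintro _ ⟨z, rfl⟩
        exact ⟨N z, by simp⟩
  have h4 : SK.relIndex (j.range ⊔ SK) * (j.range ⊔ SK).index = SK.index :=
    Subgroup.relIndex_mul_index le_sup_right
  have h5 : SK.relIndex (j.range ⊔ SK) = (SK.comap j).index := by
    rw [Subgroup.relIndex_sup_right, Subgroup.index_comap]
  have h6 : SE ≤ SK.comap j := by
    rintro _ ⟨e, rfl⟩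
    exact ⟨j e, by simp [map_pow]⟩
  -- The square of `x + y√b` lies in `E` only if `xy = 0`. Hence `Eˣ ∩ Kˣ²` is the union of the two
  -- distinct cosets `Eˣ²` and `bEˣ²`.
  have h7 : SE.relIndex (SK.comap j) = 2 := by
    rw [Subgroup.relIndex_eq_two_iff]
    have hbSE : ∀ e : Eˣ, (e : E) ^ 2 ≠ b := fun e ↦ hb e
    refine ⟨Units.mk0 b hb0, ⟨Units.mk0 QuadraticAlgebra.omega ?_, ?_⟩, ?_⟩
    · intro h
      simpa using congrArg QuadraticAlgebra.im h
    · ext <;> simp [j, pow_two]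
    · rintro e ⟨w, hw⟩
      have hw' : (w : QuadraticAlgebra E b 0) ^ 2 = algebraMap E _ (e : E) := congrArg Units.val hw
      have hre := congrArg QuadraticAlgebra.re hw'
      have him := congrArg QuadraticAlgebra.im hw'
      simp only [pow_two, QuadraticAlgebra.re_mul, QuadraticAlgebra.im_mul,
        QuadraticAlgebra.algebraMap_re, QuadraticAlgebra.algebraMap_im] at hre him
      have h0 : w.1.re = 0 ∨ w.1.im = 0 := by
        have : 2 * (w.1.re * w.1.im) = 0 := by linear_combination him
        simpa using this
      have hnot : ¬ (e * Units.mk0 b hb0 ∈ SE ∧ e ∈ SE) := by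
        rintro ⟨⟨x, hx⟩, ⟨y, hy⟩⟩
        have hx' : (x : E) ^ 2 = e * b := congrArg Units.val hx
        have hy' : (y : E) ^ 2 = e := congrArg Units.val hy
        apply hb (x / y)
        rw [div_pow, hx', hy', mul_div_cancel_left₀ _ e.ne_zero]
      have hor : e * Units.mk0 b hb0 ∈ SE ∨ e ∈ SE := by
        rcases h0 with h0 | h0
        · left
          have h1 : w.1.im ≠ 0 := fun h1 ↦ e.ne_zero (by rw [← hre, h0, h1]; ring)
          refine ⟨Units.mk0 _ (mul_ne_zero hb0 h1), ?_⟩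
          ext
          simp only [powMonoidHom_apply, Units.val_pow_eq_pow_val, Units.val_mk0, Units.val_mul]
          rw [← hre, h0]
          ring
        · right
          have h1 : w.1.re ≠ 0 := fun h1 ↦ e.ne_zero (by rw [← hre, h0, h1]; ring)
          refine ⟨Units.mk0 _ h1, ?_⟩
          ext
          simp only [powMonoidHom_apply, Units.val_pow_eq_pow_val, Units.val_mk0]
          rw [← hre, h0]
          ring
      rw [xor_def]
      tauto
  have h8 := Subgroup.relIndex_mul_index h6
  rw [h7] at h8
  rw [h3] at h2
  rw [h5] at h4
  have h9 : 4 * c ^ 2 * 2 * N.range.index = (4 * c) * (4 * c) := by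
    calc 4 * c ^ 2 * 2 * N.range.index
        = (2 * (SK.comap j).index) * ((j.range ⊔ SK).index * N.range.index) := by
          rw [← hK, ← h4]; ring
      _ = (4 * c) * (4 * c) := by rw [h8, h2, hE]
  apply Nat.eq_of_mul_eq_mul_left (by positivity : 0 < 8 * c ^ 2)
  linarith

end NormIndex

/-! ### Bimultiplicativity and nondegeneracy of the Hilbert symbol. -/

namespace Metaplectic

section HilbertSymbol

variable {E : Type*} [Field E]

theorem hilbertSymbol_comm (a b : E) : hilbertSymbol a b = hilbertSymbol b a := by
  unfold hilbertSymbol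
  congr 1
  rw [eq_iff_iff]
  constructor <;>
  · rintro ⟨x, y, z, h, h'⟩
    exact ⟨y, x, z, by tauto, by rw [h']; ring⟩

theorem hilbertSymbol_eq_one_of_add_eq_one {a b : E} (h : a + b = 1) : hilbertSymbol a b = 1 :=
  if_pos ⟨1, 1, 1, by simp, by linear_combination -h⟩

theorem hilbertSymbol_mul_sq_left (a b : E) {c : E} (hc : c ≠ 0) :
    hilbertSymbol (a * c ^ 2) b = hilbertSymbol a b := by
  unfold hilbertSymbol
  congr 1
  rw [eq_iff_iff]
  constructor
  · rintro ⟨x, y, z, h, h'⟩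
    refine ⟨c * x, y, z, ?_, by rw [h']; ring⟩
    simpa [hc] using h
  · rintro ⟨x, y, z, h, h'⟩
    refine ⟨c⁻¹ * x, y, z, ?_, by rw [h']; field_simp⟩
    simpa [hc] using h

theorem hilbertSymbol_sq_left (b : E) {c : E} (hc : c ≠ 0) : hilbertSymbol (c ^ 2) b = 1 := by
  rw [← one_mul (c ^ 2), hilbertSymbol_mul_sq_left _ _ hc, hilbertSymbol_one_left]

/-- For a non-square `a`, the symbol `(a, b)` detects whether `b` is a norm from `E(√a)`. -/
theorem hilbertSymbol_eq_one_iff {a b : E} (ha : ∀ x : E, x ^ 2 ≠ a) :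
    hilbertSymbol a b = 1 ↔ ∃ r s : E, b = r ^ 2 - a * s ^ 2 := by
  have ha0 : a ≠ 0 := fun h ↦ ha 0 (by rw [h]; ring)
  unfold hilbertSymbol
  constructor
  · intro h
    have h1 : ∃ x y z : E, (x ≠ 0 ∨ y ≠ 0 ∨ z ≠ 0) ∧ z ^ 2 = a * x ^ 2 + b * y ^ 2 := by
      by_contra h1
      rw [if_neg h1] at h
      exact absurd h (by decide)
    obtain ⟨x, y, z, h1, h2⟩ := h1
    by_cases hy : y = 0
    · exfalso
      subst hy
      by_cases hx : x = 0
      · subst hx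
        have : z = 0 := by simpa using h2
        simp [this] at h1
      · apply ha (z / x)
        rw [div_pow, h2]
        field_simp
        ring
    · refine ⟨z / y, x / y, ?_⟩
      field_simp
      linear_combination -h2
  · rintro ⟨r, s, h⟩
    exact if_pos ⟨s, 1, r, by simp, by rw [h]; ring⟩

end HilbertSymbol

section LocalField

open ValuativeRel

variable (E : Type*) [Field E] [CharZero E] [ValuativeRel E] [TopologicalSpace E]
  [IsNonarchimedeanLocalField E]

omit [CharZero E] in
theorem isAdicComplete_integer : IsAdicComplete 𝓂[E] 𝒪[E] := by
  let := IsTopologicalAddGroup.rightUniformSpace E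
  have := isUniformAddGroup_of_addCommGroup (G := E)
  infer_instance

theorem index_sq_units_ne_zero : (powMonoidHom 2 : Eˣ →* Eˣ).range.index ≠ 0 := by
  have := isAdicComplete_integer E
  have := IsDiscreteValuationRing.hasFiniteQuotients (R := 𝒪[E])
  have : Finite (𝒪[E] ⧸ Ideal.span {(2 : 𝒪[E])}) :=
    Ring.HasFiniteQuotients.finiteQuotient (by simp)
  rw [index_sq_units_fractionRing (R := 𝒪[E])]
  exact mul_ne_zero four_ne_zero Nat.card_pos.ne'

variable {E}

/-- The norm group of a quadratic extension of `E`. -/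
theorem exists_index_two_hilbertSymbol {a : E} (ha : ∀ x : E, x ^ 2 ≠ a) :
    ∃ H : Subgroup Eˣ, H.index = 2 ∧ ∀ x : Eˣ, x ∈ H ↔ hilbertSymbol a x = 1 := by
  have := isAdicComplete_integer E
  have := IsDiscreteValuationRing.hasFiniteQuotients (R := 𝒪[E])
  have : Finite (𝒪[E] ⧸ Ideal.span {(2 : 𝒪[E])}) :=
    Ring.HasFiniteQuotients.finiteQuotient (by simp)
  obtain ⟨p, hp⟩ := IsDiscreteValuationRing.exists_irreducible 𝒪[E]
  have ha0 : a ≠ 0 := fun h ↦ ha 0 (by rw [h]; ring)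
  have hp0 : algebraMap 𝒪[E] E p ≠ 0 := by simpa using hp.ne_zero
  -- reduce to the case that `a` is integral and not divisible by `p ^ 2`
  obtain ⟨b, c, hc, rfl, hb⟩ : ∃ (b : 𝒪[E]) (c : E), c ≠ 0 ∧ a = algebraMap 𝒪[E] E b * c ^ 2 ∧
      ¬ p ^ 2 ∣ b := by
    obtain ⟨n, u, rfl⟩ := IsDiscreteValuationRing.exists_zpow_mul_isUnit hp ha0
    obtain ⟨k, rfl | rfl⟩ := Int.even_or_odd' n
    · refine ⟨u, algebraMap 𝒪[E] E p ^ k, zpow_ne_zero _ hp0, ?_, fun h ↦ ?_⟩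
      · rw [← zpow_natCast, ← _root_.zpow_mul, mul_comm (2 : ℤ), mul_comm]
        rfl
      · exact (IsDiscreteValuationRing.isUnit_iff_not_dvd hp).1 u.isUnit
          ((dvd_pow_self p two_ne_zero).trans h)
    · refine ⟨p * u, algebraMap 𝒪[E] E p ^ k, zpow_ne_zero _ hp0, ?_, fun h ↦ ?_⟩
      · rw [← zpow_natCast, ← _root_.zpow_mul, zpow_add₀ hp0, mul_comm (2 : ℤ), map_mul, zpow_one]
        push_cast
        ring
      · rw [pow_two, mul_dvd_mul_iff_left hp.ne_zero] at h
        exact (IsDiscreteValuationRing.isUnit_iff_not_dvd hp).1 u.isUnit h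
  have hb' : ∀ x : E, x ^ 2 ≠ algebraMap 𝒪[E] E b := fun x h ↦ ha (x * c) (by rw [← h]; ring)
  have hF : Fact (∀ r : E, r ^ 2 ≠ algebraMap 𝒪[E] E b + 0 * r) := ⟨fun r ↦ by
    rw [zero_mul, add_zero]; exact hb' r⟩
  refine ⟨_, index_norm_range (b := algebraMap 𝒪[E] E b) (Nat.card_pos.ne')
    (index_sq_units_fractionRing (R := 𝒪[E])) (index_sq_units_quadraticAlgebra hb' hp hb),
    fun x ↦ ?_⟩
  rw [hilbertSymbol_mul_sq_left _ _ hc, hilbertSymbol_eq_one_iff hb',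
    QuadraticAlgebra.mem_range_norm_units]

/-- For a non-square `a` the symbol `(a, ·)` is the sign character of a subgroup of index two; for a
square `a` it is constantly `1`. -/
theorem hilbertSymbol_mul_right (a : E) {b c : E} (hb : b ≠ 0) (hc : c ≠ 0) :
    hilbertSymbol a (b * c) = hilbertSymbol a b * hilbertSymbol a c := by
  by_cases ha : ∃ x : E, x ^ 2 = a
  · obtain ⟨x, rfl⟩ := ha
    by_cases hx : x = 0
    · subst hx
      have h (y : E) : hilbertSymbol (0 : E) y = 1 := if_pos ⟨1, 0, 0, by simp, by ring⟩
      simp [h]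
    · simp [hilbertSymbol_sq_left _ hx]
  · obtain ⟨H, hH, h⟩ := exists_index_two_hilbertSymbol (not_exists.1 ha)
    have h1 := Subgroup.mul_mem_iff_of_index_two hH (a := Units.mk0 b hb) (b := Units.mk0 c hc)
    rw [h, h, h] at h1
    simp only [Units.val_mul, Units.val_mk0] at h1
    rcases Int.units_eq_one_or (hilbertSymbol a b) with h2 | h2 <;>
    rcases Int.units_eq_one_or (hilbertSymbol a c) with h3 | h3 <;>
    rcases Int.units_eq_one_or (hilbertSymbol a (b * c)) with h4 | h4 <;>
    simp_all

theorem hilbertSymbol_mul_left {a b : E} (c : E) (ha : a ≠ 0) (hb : b ≠ 0) :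
    hilbertSymbol (a * b) c = hilbertSymbol a c * hilbertSymbol b c := by
  rw [hilbertSymbol_comm, hilbertSymbol_mul_right c ha hb, hilbertSymbol_comm c, hilbertSymbol_comm c]

/-- The Hilbert symbol is nondegenerate. -/
theorem exists_hilbertSymbol_eq_neg_one {a : E} (ha : ∀ x : E, x ^ 2 ≠ a) :
    ∃ b : E, b ≠ 0 ∧ hilbertSymbol a b = -1 := by
  obtain ⟨H, hH, h⟩ := exists_index_two_hilbertSymbol ha
  have h1 : H ≠ ⊤ := by
    rintro rfl
    simp at hH
  obtain ⟨b, -, hb⟩ := SetLike.exists_of_lt (lt_top_iff_ne_top.2 h1)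
  rw [h] at hb
  exact ⟨b, b.ne_zero, (Int.units_eq_one_or _).resolve_left hb⟩

end LocalField

end Metaplectic

end

/-! ### The cocycle identity and the group structure of the cover. -/

noncomputable section

namespace Metaplectic

section Symbol

/-- The isomorphism from `{±1}` to the additive group of two elements. -/
def signToZMod (u : ℤˣ) : ZMod 2 := if u = 1 then 0 else 1

theorem signToZMod_mul : ∀ u v : ℤˣ, signToZMod (u * v) = signToZMod u + signToZMod v := by decide

theorem signToZMod_injective : ∀ u v : ℤˣ, signToZMod u = signToZMod v → u = v := by decide

variable {E : Type*} [Field E]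

/-- The Hilbert symbol, written additively. -/
def addSymbol (a b : Eˣ) : ZMod 2 := signToZMod (hilbertSymbol (a : E) b)

theorem addSymbol_comm (a b : Eˣ) : addSymbol a b = addSymbol b a := by
  rw [addSymbol, hilbertSymbol_comm, addSymbol]

theorem addSymbol_neg_self (a : Eˣ) : addSymbol (-a) a = 0 := by
  rw [addSymbol, Units.val_neg, hilbertSymbol_neg_self]; rfl

theorem addSymbol_of_add_eq_one (a b : Eˣ) (h : (a : E) + b = 1) : addSymbol a b = 0 := by
  rw [addSymbol, hilbertSymbol_eq_one_of_add_eq_one h]; rfl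

variable [CharZero E] [ValuativeRel E] [TopologicalSpace E] [IsNonarchimedeanLocalField E]

theorem addSymbol_mul_left (a b c : Eˣ) :
    addSymbol (a * b) c = addSymbol a c + addSymbol b c := by
  rw [addSymbol, Units.val_mul, hilbertSymbol_mul_left _ a.ne_zero b.ne_zero, signToZMod_mul]; rfl

theorem addSymbol_mul_right (a b c : Eˣ) :
    addSymbol a (b * c) = addSymbol a b + addSymbol a c := by
  rw [addSymbol_comm, addSymbol_mul_left, addSymbol_comm b, addSymbol_comm c]

theorem addSymbol_one_left (a : Eˣ) : addSymbol 1 a = 0 := by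
  simpa using addSymbol_mul_left 1 1 a

theorem addSymbol_inv_left (a b : Eˣ) : addSymbol a⁻¹ b = addSymbol a b := by
  have h := addSymbol_mul_left a⁻¹ a b
  rw [inv_mul_cancel, addSymbol_one_left] at h
  grind

theorem addSymbol_inv_right (a b : Eˣ) : addSymbol a b⁻¹ = addSymbol a b := by
  rw [addSymbol_comm, addSymbol_inv_left, addSymbol_comm]

theorem addSymbol_neg_left (a b : Eˣ) : addSymbol (-a) b = addSymbol (-1) b + addSymbol a b := by
  rw [← addSymbol_mul_left, neg_one_mul]

theorem addSymbol_neg_right (a b : Eˣ) : addSymbol a (-b) = addSymbol (-1) a + addSymbol a b := by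
  rw [addSymbol_comm, addSymbol_neg_left, addSymbol_comm b]

theorem addSymbol_self (a : Eˣ) : addSymbol a a = addSymbol (-1) a := by
  have := addSymbol_neg_self a
  rw [addSymbol_neg_left] at this
  grind

/-- The value of Kubota's cocycle in terms of the invariants of `g₁`, `g₂` and `g₁ g₂`. -/
def addCocycle (x y z : Eˣ) : ZMod 2 := addSymbol x y + addSymbol (-x⁻¹ * y) z

omit [CharZero E] [ValuativeRel E] [TopologicalSpace E] [IsNonarchimedeanLocalField E] in
theorem signToZMod_cocycleSL {g₁ g₂ : Matrix (Fin 2) (Fin 2) E} {x y z : Eˣ}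
    (hx : kubotaX g₁ = x) (hy : kubotaX g₂ = y) (hz : kubotaX (g₁ * g₂) = z) :
    signToZMod (cocycleSL g₁ g₂) = addCocycle x y z := by
  rw [cocycleSL, signToZMod_mul, hx, hy, hz, addCocycle, addSymbol, addSymbol]
  simp

theorem addCocycle_eq (x y z : Eˣ) :
    addCocycle x y z = addSymbol x y + addSymbol (-1) z + addSymbol x z + addSymbol y z := by
  rw [addCocycle, addSymbol_mul_left, addSymbol_neg_left, addSymbol_inv_left]
  ring

/-- The cocycle identity, for the invariants of `g₁, g₂, g₃, g₁ g₂, g₂ g₃, g₁ g₂ g₃`. -/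
def AddCocycleIdentity (x₁ x₂ x₃ x₁₂ x₂₃ x₁₂₃ : Eˣ) : Prop :=
  addCocycle x₁ x₂ x₁₂ + addCocycle x₁₂ x₃ x₁₂₃ =
    addCocycle x₁ x₂₃ x₁₂₃ + addCocycle x₂ x₃ x₂₃

/-- This and the next five identities treat the configurations in which one of `g₁`, `g₃`, `g₂`,
`g₁g₂`, `g₂g₃`, `g₁g₂g₃` is upper triangular. The invariants then satisfy monomial relations, and
bilinearity with `(x, x) = (-1, x)` suffices. -/
theorem addCocycleIdentity_left (x₁ x₂ x₃ x₂₃ : Eˣ) :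
    AddCocycleIdentity x₁ x₂ x₃ (x₁ * x₂) x₂₃ (x₁ * x₂₃) := by
  simp only [AddCocycleIdentity, addCocycle_eq, addSymbol_mul_left, addSymbol_mul_right,
    addSymbol_self]
  grind [addSymbol_comm]

theorem addCocycleIdentity_right (x₁ x₂ x₃ x₁₂ : Eˣ) :
    AddCocycleIdentity x₁ x₂ x₃ x₁₂ (x₂ * x₃⁻¹) (x₁₂ * x₃⁻¹) := by
  simp only [AddCocycleIdentity, addCocycle_eq, addSymbol_mul_left, addSymbol_mul_right,
    addSymbol_self, addSymbol_inv_left, addSymbol_inv_right]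
  grind [addSymbol_comm]

theorem addCocycleIdentity_middle (x₁ x₂ x₃ x₁₂₃ : Eˣ) :
    AddCocycleIdentity x₁ x₂ x₃ (x₁ * x₂⁻¹) (x₂ * x₃) x₁₂₃ := by
  simp only [AddCocycleIdentity, addCocycle_eq, addSymbol_mul_left, addSymbol_mul_right,
    addSymbol_self, addSymbol_inv_left, addSymbol_inv_right]
  grind [addSymbol_comm]

theorem addCocycleIdentity_degenerate₁₂ (x₂ x₃ x₁₂ x₂₃ : Eˣ) :
    AddCocycleIdentity (-(x₂ * x₁₂)) x₂ x₃ x₁₂ x₂₃ (x₁₂ * x₃) := by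
  simp only [AddCocycleIdentity, addCocycle_eq, addSymbol_mul_left, addSymbol_mul_right,
    addSymbol_neg_left (_ * _), addSymbol_self]
  grind [addSymbol_comm]

theorem addCocycleIdentity_degenerate₂₃ (x₁ x₂ x₁₂ x₂₃ : Eˣ) :
    AddCocycleIdentity x₁ x₂ (-(x₂ * x₂₃⁻¹)) x₁₂ x₂₃ (x₁ * x₂₃⁻¹) := by
  simp only [AddCocycleIdentity, addCocycle_eq, addSymbol_mul_left, addSymbol_mul_right,
    addSymbol_neg_left (_ * _), addSymbol_neg_right _ (_ * _), addSymbol_self,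
    addSymbol_inv_left, addSymbol_inv_right]
  grind [addSymbol_comm]

theorem addCocycleIdentity_degenerate₁₂₃ (x₂ x₃ x₂₃ x₁₂₃ : Eˣ) :
    AddCocycleIdentity (-(x₁₂₃ * x₂₃)) x₂ x₃ (-(x₁₂₃ * x₃)) x₂₃ x₁₂₃ := by
  simp only [AddCocycleIdentity, addCocycle_eq, addSymbol_mul_left, addSymbol_mul_right,
    addSymbol_neg_left (_ * _), addSymbol_neg_right _ (_ * _), addSymbol_self]
  grind [addSymbol_comm]

/-- Divided by `x₁₂x₂₃`, the hypothesis exhibits two units with sum `1`. The Steinberg relation `(u,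
1 - u) = 1` for them expands to the cocycle identity. -/
theorem addCocycleIdentity_generic (x₁ x₂ x₃ x₁₂ x₂₃ x₁₂₃ : Eˣ)
    (h : (x₁ * x₃ : E) = x₁₂ * x₂₃ - x₁₂₃ * x₂) :
    AddCocycleIdentity x₁ x₂ x₃ x₁₂ x₂₃ x₁₂₃ := by
  have h1 : addSymbol (x₁ * x₃ * (x₁₂ * x₂₃)⁻¹) (x₁₂₃ * x₂ * (x₁₂ * x₂₃)⁻¹) = 0 := by
    apply addSymbol_of_add_eq_one
    simp only [Units.val_mul, Units.val_inv_eq_inv_val]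
    have h1 := x₁₂.ne_zero
    have h2 := x₂₃.ne_zero
    field_simp
    linear_combination h
  simp only [AddCocycleIdentity, addCocycle_eq, addSymbol_mul_left, addSymbol_mul_right,
    addSymbol_self, addSymbol_inv_left, addSymbol_inv_right] at h1 ⊢
  grind [addSymbol_comm]

end Symbol

section CocycleSL

variable {E : Type*} [Field E]

theorem conjBy_eq (y : E) (g : Matrix (Fin 2) (Fin 2) E) :
    conjBy y g = !![g 0 0, g 0 1 * y; y⁻¹ * g 1 0, y⁻¹ * g 1 1 * y] := by
  rw [Matrix.eta_fin_two g]
  simp [conjBy]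

theorem slPart_eq (g : Matrix (Fin 2) (Fin 2) E) :
    slPart g = !![g 0 0, g 0 1; g.det⁻¹ * g 1 0, g.det⁻¹ * g 1 1] := by
  ext i j
  fin_cases i <;> fin_cases j <;> simp [slPart, Matrix.mul_apply]

theorem conjBy_apply_one_zero (y : E) (g : Matrix (Fin 2) (Fin 2) E) :
    (conjBy y g) 1 0 = y⁻¹ * g 1 0 := by
  rw [conjBy_eq]; rfl

theorem conjBy_apply_one_one {y : E} (hy : y ≠ 0) (g : Matrix (Fin 2) (Fin 2) E) :
    (conjBy y g) 1 1 = g 1 1 := by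
  rw [conjBy_eq]
  simp
  field_simp

theorem det_conjBy {y : E} (hy : y ≠ 0) (g : Matrix (Fin 2) (Fin 2) E) :
    (conjBy y g).det = g.det := by
  rw [conjBy_eq, Matrix.det_fin_two_of, Matrix.det_fin_two]
  field_simp

theorem conjBy_mul {y : E} (hy : y ≠ 0) (g h : Matrix (Fin 2) (Fin 2) E) :
    conjBy y (g * h) = conjBy y g * conjBy y h := by
  simp only [conjBy_eq]
  ext i j
  fin_cases i <;> fin_cases j <;> simp [Matrix.mul_apply] <;> field_simp

theorem conjBy_conjBy (y z : E) (g : Matrix (Fin 2) (Fin 2) E) :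
    conjBy z (conjBy y g) = conjBy (y * z) g := by
  simp only [conjBy_eq]
  ext i j
  fin_cases i <;> fin_cases j <;> simp <;> ring

theorem slPart_mul (g : Matrix (Fin 2) (Fin 2) E) {h : Matrix (Fin 2) (Fin 2) E}
    (hh : h.det ≠ 0) : slPart (g * h) = conjBy h.det (slPart g) * slPart h := by
  simp only [conjBy_eq, slPart_eq, Matrix.det_mul]
  ext i j
  fin_cases i <;> fin_cases j <;> simp [Matrix.mul_apply] <;> field_simp

theorem det_slPart {g : Matrix (Fin 2) (Fin 2) E} (hg : g.det ≠ 0) : (slPart g).det = 1 := by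
  rw [slPart, Matrix.det_mul, Matrix.det_fin_two_of]
  field_simp
  ring

theorem kubotaX_of_ne {g : Matrix (Fin 2) (Fin 2) E} (h : g 1 0 ≠ 0) : kubotaX g = g 1 0 :=
  if_pos h

theorem kubotaX_of_eq {g : Matrix (Fin 2) (Fin 2) E} (h : g 1 0 = 0) : kubotaX g = g 1 1 :=
  if_neg (not_not.2 h)

theorem kubotaV_of_ne (y : E) {g : Matrix (Fin 2) (Fin 2) E} (h : g 1 0 ≠ 0) : kubotaV y g = 1 :=
  if_pos h

theorem kubotaV_of_eq (y : E) {g : Matrix (Fin 2) (Fin 2) E} (h : g 1 0 = 0) :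
    kubotaV y g = hilbertSymbol y (g 1 1) :=
  if_neg (not_not.2 h)

theorem kubotaX_ne_zero {g : Matrix (Fin 2) (Fin 2) E} (hg : g.det ≠ 0) : kubotaX g ≠ 0 := by
  by_cases h : g 1 0 = 0
  · rw [kubotaX_of_eq h]
    intro h'
    simp [Matrix.det_fin_two, h, h'] at hg
  · rwa [kubotaX_of_ne h]

/-- The invariant `x(g)` as a unit. -/
def kubotaXUnit (g : Matrix (Fin 2) (Fin 2) E) (hg : g.det = 1) : Eˣ :=
  Units.mk0 (kubotaX g) (kubotaX_ne_zero (by simp [hg]))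

theorem det_mul_eq_one {g h : Matrix (Fin 2) (Fin 2) E} (hg : g.det = 1) (hh : h.det = 1) :
    (g * h).det = 1 := by
  rw [Matrix.det_mul, hg, hh, one_mul]

theorem kubotaXUnit_mul_of_left {g h : Matrix (Fin 2) (Fin 2) E} (hg : g.det = 1) (hh : h.det = 1)
    (h0 : g 1 0 = 0) :
    kubotaXUnit (g * h) (det_mul_eq_one hg hh) = kubotaXUnit g hg * kubotaXUnit h hh := by
  have h1 : g 1 1 ≠ 0 := fun h1 ↦ by simp [Matrix.det_fin_two, h0, h1] at hg
  ext
  simp only [kubotaXUnit, Units.val_mk0, Units.val_mul, kubotaX_of_eq h0]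
  by_cases h2 : h 1 0 = 0
  · rw [kubotaX_of_eq h2, kubotaX_of_eq (by simp [Matrix.mul_apply, h0, h2])]
    simp [Matrix.mul_apply, h0]
  · rw [kubotaX_of_ne h2, kubotaX_of_ne (by simp [Matrix.mul_apply, h0, h1, h2])]
    simp [Matrix.mul_apply, h0]

theorem kubotaXUnit_mul_of_right {g h : Matrix (Fin 2) (Fin 2) E} (hg : g.det = 1) (hh : h.det = 1)
    (h0 : h 1 0 = 0) (hg0 : g 1 0 ≠ 0) :
    kubotaXUnit (g * h) (det_mul_eq_one hg hh) = kubotaXUnit g hg * (kubotaXUnit h hh)⁻¹ := by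
  have h2 : h 0 0 * h 1 1 = 1 := by simpa [Matrix.det_fin_two, h0] using hh
  have h3 : h 0 0 ≠ 0 := left_ne_zero_of_mul_eq_one h2
  have h4 : h 1 1 ≠ 0 := right_ne_zero_of_mul_eq_one h2
  ext
  simp only [kubotaXUnit, Units.val_mk0, Units.val_mul, Units.val_inv_eq_inv_val,
    kubotaX_of_eq h0, kubotaX_of_ne hg0]
  rw [kubotaX_of_ne (by simp [Matrix.mul_apply, h0, hg0, h3])]
  simp only [Matrix.mul_apply, Fin.sum_univ_two, h0]
  field_simp
  linear_combination g 1 0 * h2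

variable [CharZero E] [ValuativeRel E] [TopologicalSpace E] [IsNonarchimedeanLocalField E]

/-- Only the bottom-row invariants enter. If one of the six matrices involved is upper triangular, a
degenerate identity applies. Otherwise `det g₂ = 1` yields the relation `c₁c₃ = c₁₂c₂₃ - c₁₂₃c₂`
between the lower left entries. -/
theorem cocycleSL_cocycle {g₁ g₂ g₃ : Matrix (Fin 2) (Fin 2) E} (h₁ : g₁.det = 1)
    (h₂ : g₂.det = 1) (h₃ : g₃.det = 1) :
    cocycleSL g₁ g₂ * cocycleSL (g₁ * g₂) g₃ = cocycleSL g₁ (g₂ * g₃) * cocycleSL g₂ g₃ := by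
  apply signToZMod_injective
  have h₁₂ := det_mul_eq_one h₁ h₂
  have h₂₃ := det_mul_eq_one h₂ h₃
  have h₁₂₃ := det_mul_eq_one h₁ h₂₃
  rw [signToZMod_mul, signToZMod_mul,
    signToZMod_cocycleSL (x := kubotaXUnit g₁ h₁) (y := kubotaXUnit g₂ h₂)
      (z := kubotaXUnit _ h₁₂) rfl rfl rfl,
    signToZMod_cocycleSL (x := kubotaXUnit _ h₁₂) (y := kubotaXUnit g₃ h₃)
      (z := kubotaXUnit _ h₁₂₃) rfl rfl (by rw [Matrix.mul_assoc]; rfl),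
    signToZMod_cocycleSL (x := kubotaXUnit g₁ h₁) (y := kubotaXUnit _ h₂₃)
      (z := kubotaXUnit _ h₁₂₃) rfl rfl rfl,
    signToZMod_cocycleSL (x := kubotaXUnit g₂ h₂) (y := kubotaXUnit g₃ h₃)
      (z := kubotaXUnit _ h₂₃) rfl rfl rfl]
  change AddCocycleIdentity _ _ _ _ _ _
  by_cases c₁ : g₁ 1 0 = 0
  · rw [kubotaXUnit_mul_of_left h₁ h₂ c₁, kubotaXUnit_mul_of_left h₁ h₂₃ c₁]
    apply addCocycleIdentity_left
  by_cases c₂ : g₂ 1 0 = 0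
  · rw [kubotaXUnit_mul_of_right h₁ h₂ c₂ c₁, kubotaXUnit_mul_of_left h₂ h₃ c₂]
    apply addCocycleIdentity_middle
  have hm (g h : Matrix (Fin 2) (Fin 2) E) (i j : Fin 2) :
    (g * h) i j = g i 0 * h 0 j + g i 1 * h 1 j := by simp [Matrix.mul_apply]
  have d₂ := h₂
  have d₃ := h₃
  have d₂₃ := h₂₃
  rw [Matrix.det_fin_two] at d₂ d₃ d₂₃
  by_cases c₁₂ : (g₁ * g₂) 1 0 = 0
  · have e1 : kubotaXUnit g₁ h₁ = -(kubotaXUnit g₂ h₂ * kubotaXUnit _ h₁₂) := by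
      ext
      simp only [kubotaXUnit, Units.val_mk0, Units.val_mul, Units.val_neg, kubotaX_of_ne c₁,
        kubotaX_of_ne c₂, kubotaX_of_eq c₁₂]
      simp only [hm] at c₁₂ ⊢
      linear_combination g₂ 1 1 * c₁₂ - g₁ 1 0 * d₂
    have e2 : kubotaXUnit _ h₁₂₃ = kubotaXUnit _ h₁₂ * kubotaXUnit g₃ h₃ := by
      rw [← kubotaXUnit_mul_of_left h₁₂ h₃ c₁₂]
      simp only [Matrix.mul_assoc]
    rw [e1, e2]
    apply addCocycleIdentity_degenerate₁₂
  by_cases c₃ : g₃ 1 0 = 0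
  · have e2 : kubotaXUnit _ h₁₂₃ = kubotaXUnit _ h₁₂ * (kubotaXUnit g₃ h₃)⁻¹ := by
      rw [← kubotaXUnit_mul_of_right h₁₂ h₃ c₃ c₁₂]
      simp only [Matrix.mul_assoc]
    rw [kubotaXUnit_mul_of_right h₂ h₃ c₃ c₂, e2]
    apply addCocycleIdentity_right
  by_cases c₂₃ : (g₂ * g₃) 1 0 = 0
  · rw [kubotaXUnit_mul_of_right h₁ h₂₃ c₂₃ c₁]
    have e : kubotaXUnit g₃ h₃ = -(kubotaXUnit g₂ h₂ * (kubotaXUnit _ h₂₃)⁻¹) := by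
      rw [← neg_mul, eq_mul_inv_iff_mul_eq]
      ext
      simp only [kubotaXUnit, Units.val_mk0, Units.val_mul, Units.val_neg, kubotaX_of_ne c₃,
        kubotaX_of_ne c₂, kubotaX_of_eq c₂₃]
      simp only [hm] at c₂₃ ⊢
      linear_combination g₃ 1 1 * c₂₃ - g₂ 1 0 * d₃
    rw [e]
    apply addCocycleIdentity_degenerate₂₃
  by_cases c₁₂₃ : (g₁ * (g₂ * g₃)) 1 0 = 0
  · have e1 : kubotaXUnit g₁ h₁ = -(kubotaXUnit _ h₁₂₃ * kubotaXUnit _ h₂₃) := by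
      ext
      simp only [kubotaXUnit, Units.val_mk0, Units.val_mul, Units.val_neg, kubotaX_of_ne c₁,
        kubotaX_of_ne c₂₃, kubotaX_of_eq c₁₂₃]
      rw [hm g₁] at c₁₂₃ ⊢
      linear_combination (g₂ * g₃) 1 1 * c₁₂₃ - g₁ 1 0 * d₂₃
    have e2 : kubotaXUnit _ h₁₂ = -(kubotaXUnit _ h₁₂₃ * kubotaXUnit _ h₃) := by
      ext
      simp only [kubotaXUnit, Units.val_mk0, Units.val_mul, Units.val_neg, kubotaX_of_ne c₃,
        kubotaX_of_ne c₁₂, kubotaX_of_eq c₁₂₃]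
      rw [← Matrix.mul_assoc] at c₁₂₃ ⊢
      rw [hm (g₁ * g₂)] at c₁₂₃ ⊢
      linear_combination g₃ 1 1 * c₁₂₃ - (g₁ * g₂) 1 0 * d₃
    rw [e1, e2]
    apply addCocycleIdentity_degenerate₁₂₃
  apply addCocycleIdentity_generic
  simp only [kubotaXUnit, Units.val_mk0, kubotaX_of_ne c₁, kubotaX_of_ne c₃,
    kubotaX_of_ne c₁₂, kubotaX_of_ne c₂₃, kubotaX_of_ne c₁₂₃, kubotaX_of_ne c₂]
  simp only [hm]
  linear_combination -g₁ 1 0 * g₃ 1 0 * d₂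

/-- The action of `diag(1, y)` on the cover of `SL₂(E)`. -/
theorem cocycleSL_conjBy {y : E} (hy : y ≠ 0) {g₁ g₂ : Matrix (Fin 2) (Fin 2) E} (h₁ : g₁.det = 1)
    (h₂ : g₂.det = 1) :
    cocycleSL (conjBy y g₁) (conjBy y g₂) * kubotaV y g₁ * kubotaV y g₂ =
      cocycleSL g₁ g₂ * kubotaV y (g₁ * g₂) := by
  have hc := conjBy_apply_one_zero y
  have hd := conjBy_apply_one_one hy
  have hmul : conjBy y g₁ * conjBy y g₂ = conjBy y (g₁ * g₂) := (conjBy_mul hy g₁ g₂).symm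
  have hx₀ {g : Matrix (Fin 2) (Fin 2) E} (hg : g.det = 1) (h : g 1 0 = 0) :
      kubotaX (conjBy y g) = kubotaXUnit g hg := by
    rw [kubotaX_of_eq (by simp [hc, h]), hd, kubotaXUnit, Units.val_mk0, kubotaX_of_eq h]
  have hx {g : Matrix (Fin 2) (Fin 2) E} (hg : g.det = 1) (h : g 1 0 ≠ 0) :
      kubotaX (conjBy y g) = ((Units.mk0 y hy)⁻¹ * kubotaXUnit g hg : Eˣ) := by
    rw [kubotaX_of_ne (by simp [hc, h, hy]), hc]
    simp [kubotaXUnit, kubotaX_of_ne h]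
  have hv₀ {g : Matrix (Fin 2) (Fin 2) E} (hg : g.det = 1) (h : g 1 0 = 0) :
      signToZMod (kubotaV y g) = addSymbol (Units.mk0 y hy) (kubotaXUnit g hg) := by
    rw [kubotaV_of_eq y h, addSymbol, kubotaXUnit, Units.val_mk0, Units.val_mk0, kubotaX_of_eq h]
  have hv {g : Matrix (Fin 2) (Fin 2) E} (h : g 1 0 ≠ 0) : signToZMod (kubotaV y g) = 0 := by
    rw [kubotaV_of_ne y h]; rfl
  have h₁₂ := det_mul_eq_one h₁ h₂
  apply signToZMod_injective
  simp only [signToZMod_mul]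
  rw [signToZMod_cocycleSL (x := kubotaXUnit g₁ h₁) (y := kubotaXUnit g₂ h₂)
      (z := kubotaXUnit _ h₁₂) rfl rfl rfl]
  by_cases c₁ : g₁ 1 0 = 0
  · have h1 : g₁ 1 1 ≠ 0 := fun h1 ↦ by simp [Matrix.det_fin_two, c₁, h1] at h₁
    have e := kubotaXUnit_mul_of_left h₁ h₂ c₁
    by_cases c₂ : g₂ 1 0 = 0
    · have c₁₂ : (g₁ * g₂) 1 0 = 0 := by simp [Matrix.mul_apply, c₁, c₂]
      rw [hv₀ h₁ c₁, hv₀ h₂ c₂, hv₀ h₁₂ c₁₂,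
        signToZMod_cocycleSL (hx₀ h₁ c₁) (hx₀ h₂ c₂) (hmul ▸ hx₀ h₁₂ c₁₂), e]
      simp only [addSymbol_mul_right]
      ring
    · have c₁₂ : (g₁ * g₂) 1 0 ≠ 0 := by simp [Matrix.mul_apply, c₁, c₂, h1]
      rw [hv₀ h₁ c₁, hv c₂, hv c₁₂,
        signToZMod_cocycleSL (hx₀ h₁ c₁) (hx h₂ c₂) (hmul ▸ hx h₁₂ c₁₂), e]
      simp only [addCocycle_eq, addSymbol_mul_left, addSymbol_mul_right,
        addSymbol_self, addSymbol_inv_left, addSymbol_inv_right]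
      grind [addSymbol_comm]
  by_cases c₂ : g₂ 1 0 = 0
  · have h1 : g₂ 0 0 ≠ 0 := fun h1 ↦ by simp [Matrix.det_fin_two, c₂, h1] at h₂
    have c₁₂ : (g₁ * g₂) 1 0 ≠ 0 := by simp [Matrix.mul_apply, c₁, c₂, h1]
    rw [hv c₁, hv₀ h₂ c₂, hv c₁₂,
      signToZMod_cocycleSL (hx h₁ c₁) (hx₀ h₂ c₂) (hmul ▸ hx h₁₂ c₁₂),
      kubotaXUnit_mul_of_right h₁ h₂ c₂ c₁]
    simp only [addCocycle_eq, addSymbol_mul_left, addSymbol_mul_right,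
      addSymbol_self, addSymbol_inv_left, addSymbol_inv_right]
    grind [addSymbol_comm]
  by_cases c₁₂ : (g₁ * g₂) 1 0 = 0
  · have e1 : kubotaXUnit g₁ h₁ = -(kubotaXUnit g₂ h₂ * kubotaXUnit _ h₁₂) := by
      have d₂ := h₂
      rw [Matrix.det_fin_two] at d₂
      ext
      simp only [kubotaXUnit, Units.val_mk0, Units.val_mul, Units.val_neg, kubotaX_of_ne c₁,
        kubotaX_of_ne c₂, kubotaX_of_eq c₁₂]
      simp only [Matrix.mul_apply, Fin.sum_univ_two] at c₁₂ ⊢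
      linear_combination g₂ 1 1 * c₁₂ - g₁ 1 0 * d₂
    rw [hv c₁, hv c₂, hv₀ h₁₂ c₁₂,
      signToZMod_cocycleSL (hx h₁ c₁) (hx h₂ c₂) (hmul ▸ hx₀ h₁₂ c₁₂), e1]
    simp only [addCocycle_eq, addSymbol_mul_left, addSymbol_mul_right,
      addSymbol_neg_left (_ * _), addSymbol_self, addSymbol_inv_left, addSymbol_inv_right]
    grind [addSymbol_comm]
  · rw [hv c₁, hv c₂, hv c₁₂,
      signToZMod_cocycleSL (hx h₁ c₁) (hx h₂ c₂) (hmul ▸ hx h₁₂ c₁₂)]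
    simp only [addCocycle_eq, addSymbol_mul_left, addSymbol_mul_right,
      addSymbol_self, addSymbol_inv_left, addSymbol_inv_right]
    grind [addSymbol_comm]

theorem kubotaV_mul {y z : E} (hy : y ≠ 0) (hz : z ≠ 0) (g : Matrix (Fin 2) (Fin 2) E) :
    kubotaV (y * z) g = kubotaV y g * kubotaV z (conjBy y g) := by
  have hc := conjBy_apply_one_zero y g
  have hd := conjBy_apply_one_one hy g
  by_cases h : g 1 0 = 0
  · rw [kubotaV_of_eq _ h, kubotaV_of_eq _ h, kubotaV_of_eq _ (by simp [hc, h]), hd,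
      hilbertSymbol_mul_left _ hy hz]
  · rw [kubotaV_of_ne _ h, kubotaV_of_ne _ h, kubotaV_of_ne _ (by simp [hc, h, hy]), one_mul]

/-- Kubota's cocycle satisfies the cocycle identity. -/
theorem cocycle_mul_cocycle (g₁ g₂ g₃ : GL (Fin 2) E) :
    cocycle g₁ g₂ * cocycle (g₁ * g₂) g₃ = cocycle g₁ (g₂ * g₃) * cocycle g₂ g₃ := by
  have d₁ : (g₁ : Matrix (Fin 2) (Fin 2) E).det ≠ 0 := g₁.det_ne_zero
  have d₂ : (g₂ : Matrix (Fin 2) (Fin 2) E).det ≠ 0 := g₂.det_ne_zero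
  have d₃ : (g₃ : Matrix (Fin 2) (Fin 2) E).det ≠ 0 := g₃.det_ne_zero
  have s₁ := det_slPart d₁
  have s₂ := det_slPart d₂
  have s₃ := det_slPart d₃
  simp only [cocycle, Units.val_mul]
  rw [slPart_mul _ d₂, slPart_mul _ d₃, Matrix.det_mul, conjBy_mul d₃, conjBy_conjBy]
  generalize slPart (g₁ : Matrix (Fin 2) (Fin 2) E) = p₁ at *
  generalize slPart (g₂ : Matrix (Fin 2) (Fin 2) E) = p₂ at *
  generalize slPart (g₃ : Matrix (Fin 2) (Fin 2) E) = p₃ at *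
  generalize (g₂ : Matrix (Fin 2) (Fin 2) E).det = y at *
  generalize (g₃ : Matrix (Fin 2) (Fin 2) E).det = z at *
  -- `GL₂` is treated as the semidirect product of `SL₂` with the matrices `diag(1, y)`: `h1` is the
  -- identity for the conjugated `SL₂` parts, and `h2` compares the cocycle before and after
  -- conjugation by `det g₃`.
  have h1 := cocycleSL_cocycle (g₁ := conjBy (y * z) p₁) (g₂ := conjBy z p₂) (g₃ := p₃)
    (by rw [det_conjBy (mul_ne_zero d₂ d₃), s₁]) (by rw [det_conjBy d₃, s₂]) s₃
  have h2 := cocycleSL_conjBy d₃ (g₁ := conjBy y p₁) (g₂ := p₂) (by rw [det_conjBy d₂, s₁]) s₂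
  rw [conjBy_conjBy] at h2
  rw [kubotaV_mul d₂ d₃]
  have hsq : ∀ u : ℤˣ, u * u = 1 := by decide
  calc _ = (cocycleSL (conjBy y p₁) p₂ * kubotaV z (conjBy y p₁ * p₂)) * kubotaV y p₁ *
        cocycleSL (conjBy (y * z) p₁ * conjBy z p₂) p₃ := by ac_rfl
    _ = (cocycleSL (conjBy (y * z) p₁) (conjBy z p₂) *
        cocycleSL (conjBy (y * z) p₁ * conjBy z p₂) p₃) * kubotaV z (conjBy y p₁) * kubotaV z p₂ *
        kubotaV y p₁ := by rw [← h2]; ac_rfl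
    _ = _ := by rw [h1]; ac_rfl

end CocycleSL

section Group

variable {E : Type*} [Field E] [CharZero E] [ValuativeRel E] [TopologicalSpace E]
  [IsNonarchimedeanLocalField E]

theorem mul_assoc_mp (x y z : Mp E) : x * y * z = x * (y * z) := by
  simp only [mul_def, Mp.mk.injEq]
  refine ⟨mul_assoc _ _ _, ?_⟩
  have := cocycle_mul_cocycle x.gl y.gl z.gl
  calc _ = x.sign * y.sign * z.sign * (cocycle x.gl y.gl * cocycle (x.gl * y.gl) z.gl) := by ac_rfl
    _ = _ := by rw [this]; ac_rfl

instance : Group (Mp E) where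
  mul_assoc := mul_assoc_mp
  one_mul := one_mul
  mul_one := mul_one
  inv x := ⟨x.gl⁻¹, x.sign * cocycle x.gl⁻¹ x.gl⟩
  inv_mul_cancel x := by
    have hsq : ∀ u v : ℤˣ, u * v * u * v = 1 := by decide
    change (⟨x.gl⁻¹ * x.gl, x.sign * cocycle x.gl⁻¹ x.gl * x.sign * cocycle x.gl⁻¹ x.gl⟩ : Mp E) = 1
    rw [hsq, inv_mul_cancel]
    rfl

end Group

end Metaplectic

end

/-! ### Small subgroups and square roots near `1`, in `E` and in `GL₂(E)`. -/

section

open ValuativeRel Filter Topology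

namespace Metaplectic

section FieldTopology

variable {E : Type*} [Field E] [ValuativeRel E] [TopologicalSpace E] [IsNonarchimedeanLocalField E]

/-- Small open compact multiplicatively closed subgroups of `E`. -/
theorem exists_openAddSubgroup_subset {s : Set E} (hs : s ∈ 𝓝 (0 : E)) :
    ∃ I : AddSubgroup E, IsOpen (I : Set E) ∧ IsCompact (I : Set E) ∧
      (∀ x ∈ I, ∀ y ∈ I, x * y ∈ I) ∧ (I : Set E) ⊆ s := by
  obtain ⟨γ, hγ, h⟩ := (IsValuativeTopology.hasBasis_nhds_zero' E).mem_iff.1 hs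
  -- The bound by `1` keeps the ball inside the compact ring of integers and makes it closed under
  -- multiplication.
  let I : AddSubgroup E := (valuation E).ltAddSubgroup (min (Units.mk0 γ hγ) 1)
  have hmem (x : E) : x ∈ I ↔ valuation E x < γ ∧ valuation E x < 1 := by
    change valuation E x < ((min (Units.mk0 γ hγ) 1 : (ValueGroupWithZero E)ˣ) :
      ValueGroupWithZero E) ↔ _
    rcases le_total (Units.mk0 γ hγ) 1 with h | h
    · rw [min_eq_left h, Units.val_mk0]
      exact ⟨fun hx ↦ ⟨hx, hx.trans_le h⟩, fun hx ↦ hx.1⟩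
    · rw [min_eq_right h, Units.val_one]
      exact ⟨fun hx ↦ ⟨hx.trans_le h, hx⟩, fun hx ↦ hx.2⟩
  have hopen : IsOpen (I : Set E) := by
    refine AddSubgroup.isOpen_of_mem_nhds I (g := 0) ?_
    refine (IsValuativeTopology.hasBasis_nhds_zero' E).mem_iff.2
      ⟨_, (min (Units.mk0 γ hγ) 1).ne_zero, fun x hx ↦ hx⟩
  refine ⟨I, hopen, ?_, ?_, fun x hx ↦ h ((hmem x).1 hx).1⟩
  · refine (IsNonarchimedeanLocalField.isCompact_closedBall E 1).of_isClosed_subset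
      (I.isClosed_of_isOpen hopen) fun x hx ↦ ((hmem x).1 hx).2.le
  · intro x hx y hy
    rw [hmem] at *
    rw [map_mul]
    constructor
    · exact (mul_le_of_le_one_right' hy.2.le).trans_lt hx.1
    · exact (mul_le_of_le_one_right' hy.2.le).trans_lt hx.2

/-- The root is `1 + 2t` with `t` in the maximal ideal and `t² + t = (x - 1)/4`. As `1 + t` is a
unit, `2t` and `2t(1 + t) = (x - 1)/2` have the same valuation; this gives continuity of the root at
`1`. -/
theorem exists_sq_eq_of_valuation_lt [CharZero E] {x : E} (hx : valuation E (x - 1) < valuation E 4) :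
    ∃ y : E, y ^ 2 = x ∧ valuation E (y - 1) = valuation E ((x - 1) / 2) := by
  have := isAdicComplete_integer E
  have h4 : valuation E 4 ≠ 0 := by simp
  have hw : valuation E ((x - 1) / 4) < 1 := by
    rwa [map_div₀, div_lt_one₀ (zero_lt_iff.2 h4)]
  have hmem : (⟨(x - 1) / 4, hw.le⟩ : 𝒪[E]) ∈ 𝓂[E] := by
    rw [IsLocalRing.mem_maximalIdeal, mem_nonunits_iff,
      Valuation.Integers.isUnit_iff_valuation_eq_one (Valuation.integer.integers (valuation E))]
    exact hw.ne
  obtain ⟨t, ht, h⟩ := HenselianRing.exists_sq_eq (I := 𝓂[E]) hmem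
  have ht1 : valuation E (t : E) < 1 := by
    rw [IsLocalRing.mem_maximalIdeal, mem_nonunits_iff,
      Valuation.Integers.isUnit_iff_valuation_eq_one (Valuation.integer.integers (valuation E))] at ht
    exact lt_of_le_of_ne t.2 ht
  have h' : (1 + 2 * (t : E)) ^ 2 = x := by
    have := congrArg (algebraMap 𝒪[E] E) h
    simp only [map_pow, map_add, map_mul, map_one, map_ofNat] at this
    change (1 + 2 * (t : E)) ^ 2 = 1 + 4 * ((x - 1) / 4) at this
    rw [this]
    ring
  refine ⟨1 + 2 * t, h', ?_⟩
  have h1 : (x - 1) / 2 = 2 * t * (1 + t) := by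
    rw [← h']
    ring
  rw [h1, map_mul _ (2 * (t : E)), Valuation.map_one_add_of_lt _ ht1, mul_one, add_sub_cancel_left]

/-- A continuous square root near `1`. -/
theorem exists_tendsto_sqrt [CharZero E] :
    ∃ s : E → E, Tendsto s (𝓝 1) (𝓝 1) ∧ ∀ᶠ x in 𝓝 1, s x ^ 2 = x := by
  classical
  have hev : ∀ᶠ x in 𝓝 (1 : E), valuation E (x - 1) < valuation E 4 :=
    (IsValuativeTopology.hasBasis_nhds' (1 : E)).mem_of_mem (by simp)
  choose! s hs using fun (x : E) (hx : valuation E (x - 1) < valuation E 4) ↦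
    exists_sq_eq_of_valuation_lt hx
  refine ⟨s, ?_, hev.mono fun x hx ↦ (hs x hx).1⟩
  rw [(IsValuativeTopology.hasBasis_nhds' (1 : E)).tendsto_right_iff]
  intro γ hγ
  have h2 : valuation E (2 : E) ≠ 0 := by simp
  filter_upwards [hev, (IsValuativeTopology.hasBasis_nhds' (1 : E)).mem_of_mem
    (mul_ne_zero hγ h2)] with x hx hx'
  rw [(hs x hx).2, map_div₀, div_lt_iff₀ (zero_lt_iff.2 h2)]
  exact hx'

instance : T2Space E := by
  refine IsTopologicalAddGroup.t2Space_of_zero_sep fun x hx ↦ ?_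
  exact ⟨_, (IsValuativeTopology.hasBasis_nhds_zero' E).mem_of_mem
    ((map_ne_zero (valuation E)).2 hx), fun h ↦ (lt_irrefl (valuation E x) h).elim⟩

end FieldTopology

section GroupTopology

variable {E : Type*} [Field E] [ValuativeRel E] [TopologicalSpace E] [IsNonarchimedeanLocalField E]

theorem exists_nhds_of_mem_nhds_one_units {R : Type*} [Monoid R] [TopologicalSpace R]
    {U : Set Rˣ} (hU : U ∈ 𝓝 1) : ∃ A ∈ 𝓝 (1 : R), ∃ B ∈ 𝓝 (1 : R),
      ∀ u : Rˣ, (u : R) ∈ A → ((u⁻¹ : Rˣ) : R) ∈ B → u ∈ U := by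
  rw [Units.isInducing_embedProduct.nhds_eq_comap, mem_comap] at hU
  obtain ⟨t, ht, htU⟩ := hU
  rw [map_one, Prod.one_eq_mk, mem_nhds_prod_iff] at ht
  obtain ⟨A, hA, B, hB, hAB⟩ := ht
  refine ⟨A, hA, MulOpposite.op ⁻¹' B,
    MulOpposite.continuous_op.continuousAt.preimage_mem_nhds (by simpa using hB),
    fun u h1 h2 ↦ htU (hAB ⟨h1, h2⟩)⟩

/-- Congruence subgroups: the entries of `g - 1` and `g⁻¹ - 1` lie in a small open subgroup of `E`
closed under multiplication. -/
theorem exists_openSubgroup_subset {U : Set (GL (Fin 2) E)} (hU : U ∈ 𝓝 1) :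
    ∃ H : Subgroup (GL (Fin 2) E), IsOpen (H : Set (GL (Fin 2) E)) ∧ (H : Set _) ⊆ U := by
  obtain ⟨A, hA, B, hB, hAB⟩ := exists_nhds_of_mem_nhds_one_units hU
  -- matrices with entries near those of the identity
  obtain ⟨s, hs, hsAB⟩ : ∃ s ∈ 𝓝 (0 : E), ∀ m : Matrix (Fin 2) (Fin 2) E,
      (∀ i j, (m - 1) i j ∈ s) → m ∈ A ∩ B := by
    let F : (Fin 2 → Fin 2 → E) → Matrix (Fin 2) (Fin 2) E := fun p ↦ 1 + Matrix.of p
    have hF : Continuous F := continuous_const.add continuous_id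
    have hF0 : F 0 = 1 := add_zero _
    have hAB' : F ⁻¹' (A ∩ B) ∈ 𝓝 0 :=
      hF.continuousAt.preimage_mem_nhds (by rw [hF0]; exact Filter.inter_mem hA hB)
    rw [nhds_pi, Filter.mem_pi'] at hAB'
    obtain ⟨J, t, ht, hJt⟩ := hAB'
    have ht' (i) : ∃ v ∈ 𝓝 (0 : E), ∀ q : Fin 2 → E, (∀ j, q j ∈ v) → q ∈ t i := by
      have h := ht i
      rw [nhds_pi, Filter.mem_pi'] at h
      obtain ⟨K, u, hu, hKu⟩ := h
      exact ⟨⋂ j, u j, Filter.iInter_mem.2 hu, fun q hq ↦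
        hKu fun j _ ↦ Set.mem_iInter.1 (hq j) j⟩
    choose v hv hvt using ht'
    refine ⟨⋂ i, v i, Filter.iInter_mem.2 hv, fun m hm ↦ ?_⟩
    have h := @hJt (fun i j ↦ (m - 1) i j) fun i _ ↦ hvt i _ fun j ↦ Set.mem_iInter.1 (hm i j) i
    have hFm : F (fun i j ↦ (m - 1) i j) = m := add_sub_cancel _ _
    rwa [Set.mem_preimage, hFm] at h
  obtain ⟨I, hI, -, hmul, hIs⟩ := exists_openAddSubgroup_subset hs
  let H : Subgroup (GL (Fin 2) E) :=
    { carrier := {g | (∀ i j, ((g : Matrix (Fin 2) (Fin 2) E) - 1) i j ∈ I) ∧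
        ∀ i j, (((g⁻¹ : GL (Fin 2) E) : Matrix (Fin 2) (Fin 2) E) - 1) i j ∈ I}
      one_mem' := by simp [I.zero_mem]
      mul_mem' := by
        have key (a b : Matrix (Fin 2) (Fin 2) E) (ha : ∀ i j, (a - 1) i j ∈ I)
            (hb : ∀ i j, (b - 1) i j ∈ I) (i j) : (a * b - 1) i j ∈ I := by
          have : a * b - 1 = (a - 1) * (b - 1) + (a - 1) + (b - 1) := by noncomm_ring
          rw [this, Matrix.add_apply, Matrix.add_apply, Matrix.mul_apply]
          exact I.add_mem (I.add_mem (I.sum_mem fun k _ ↦ hmul _ (ha i k) _ (hb k j)) (ha i j)) (hb i j)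
        rintro g h ⟨h1, h2⟩ ⟨h3, h4⟩
        refine ⟨fun i j ↦ ?_, fun i j ↦ ?_⟩
        · rw [Units.val_mul]
          exact key _ _ h1 h3 i j
        · rw [_root_.mul_inv_rev, Units.val_mul]
          exact key _ _ h4 h2 i j
      inv_mem' := by
        rintro g ⟨h1, h2⟩
        exact ⟨h2, by rwa [inv_inv]⟩ }
  refine ⟨H, ?_, fun g hg ↦ hAB g (hsAB _ fun i j ↦ hIs (hg.1 i j)).1
    (hsAB _ fun i j ↦ hIs (hg.2 i j)).2⟩
  have hc (i j) : Continuous fun g : GL (Fin 2) E ↦ ((g : Matrix (Fin 2) (Fin 2) E) - 1) i j :=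
    (Units.continuous_val.sub continuous_const).matrix_elem i j
  have : (H : Set (GL (Fin 2) E)) = ⋂ i, ⋂ j,
      ((fun g : GL (Fin 2) E ↦ ((g : Matrix (Fin 2) (Fin 2) E) - 1) i j) ⁻¹' I) ∩
      ((fun g : GL (Fin 2) E ↦ (((g⁻¹ : GL (Fin 2) E) : Matrix (Fin 2) (Fin 2) E) - 1) i j) ⁻¹' I) := by
    ext g
    simp only [Set.mem_iInter, Set.mem_inter_iff, forall_and]
    rfl
  rw [this]
  exact isOpen_iInter_of_finite fun i ↦ isOpen_iInter_of_finite fun j ↦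
    (hI.preimage (hc i j)).inter (hI.preimage ((hc i j).comp continuous_inv))

/-- Every element of `GL₂(E)` near `1` has a square root near `1`. -/
theorem eventually_exists_sq [CharZero E] {U : Set (GL (Fin 2) E)} (hU : U ∈ 𝓝 1) :
    ∀ᶠ g in 𝓝 (1 : GL (Fin 2) E), ∃ h ∈ U, h * h = g := by
  obtain ⟨A, hA, B, hB, hAB⟩ := exists_nhds_of_mem_nhds_one_units hU
  obtain ⟨s, hs, hs'⟩ := exists_tendsto_sqrt (E := E)
  have hval : Tendsto (fun g : GL (Fin 2) E ↦ (g : Matrix (Fin 2) (Fin 2) E)) (𝓝 1) (𝓝 1) :=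
    Units.continuous_val.tendsto' _ _ rfl
  have hinv : Tendsto (fun g : GL (Fin 2) E ↦ ((g⁻¹ : GL (Fin 2) E) : Matrix (Fin 2) (Fin 2) E))
      (𝓝 1) (𝓝 1) := (Units.continuous_val.comp continuous_inv).tendsto' _ _ (by simp)
  have hdet : Tendsto (fun g : GL (Fin 2) E ↦ (g : Matrix (Fin 2) (Fin 2) E).det) (𝓝 1) (𝓝 1) :=
    (Units.continuous_val.matrix_det).tendsto' _ _ (by simp)
  have htr : Tendsto (fun g : GL (Fin 2) E ↦ (g : Matrix (Fin 2) (Fin 2) E).trace) (𝓝 1) (𝓝 2) :=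
    (Units.continuous_val.matrix_trace).tendsto' _ _ (by simp [Matrix.trace_one])
  -- By Cayley–Hamilton, a square root `h` of `g` with determinant `δ` and trace `2r` satisfies `2r
  -- h = g + δ` and `4r² = tr g + 2δ`. Choosing the roots `δ`, `r` near `1` gives `h` near `1`.
  let δ : GL (Fin 2) E → E := fun g ↦ s (g : Matrix (Fin 2) (Fin 2) E).det
  have hδ : Tendsto δ (𝓝 1) (𝓝 1) := hs.comp hdet
  have ht : Tendsto (fun g : GL (Fin 2) E ↦ ((g : Matrix (Fin 2) (Fin 2) E).trace + 2 * δ g) / 4)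
      (𝓝 1) (𝓝 1) := by
    have := (htr.add (hδ.const_mul 2)).div_const 4
    convert this using 2
    norm_num
  let r : GL (Fin 2) E → E := fun g ↦ s (((g : Matrix (Fin 2) (Fin 2) E).trace + 2 * δ g) / 4)
  have hr : Tendsto r (𝓝 1) (𝓝 1) := hs.comp ht
  let m : GL (Fin 2) E → Matrix (Fin 2) (Fin 2) E := fun g ↦
    (2 * r g)⁻¹ • ((g : Matrix (Fin 2) (Fin 2) E) + δ g • (1 : Matrix (Fin 2) (Fin 2) E))
  have hm : Tendsto m (𝓝 1) (𝓝 1) := by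
    have h1 : Tendsto (fun g ↦ (2 * r g)⁻¹) (𝓝 1) (𝓝 (2 * 1)⁻¹) :=
      (hr.const_mul 2).inv₀ (by simp)
    have := h1.smul (hval.add (hδ.smul_const (1 : Matrix (Fin 2) (Fin 2) E)))
    convert this using 2
    rw [one_smul, ← two_smul E (1 : Matrix (Fin 2) (Fin 2) E), smul_smul]
    norm_num
  have hm' : Tendsto (fun g ↦ m g * ((g⁻¹ : GL (Fin 2) E) : Matrix (Fin 2) (Fin 2) E)) (𝓝 1) (𝓝 1) := by
    simpa using hm.mul hinv
  filter_upwards [hm hA, hm' hB, hdet.eventually hs', ht.eventually hs',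
    hr.eventually_ne one_ne_zero] with g h1 h2 h3 h4 h5
  have hsq : m g * m g = g := by
    have hd : δ g ^ 2 = (g : Matrix (Fin 2) (Fin 2) E).det := h3
    have hrr : r g ^ 2 = ((g : Matrix (Fin 2) (Fin 2) E).trace + 2 * δ g) / 4 := h4
    rw [Matrix.det_fin_two] at hd
    rw [Matrix.trace_fin_two] at hrr
    have hrr' : 4 * r g ^ 2 = (g : Matrix (Fin 2) (Fin 2) E) 0 0 +
      (g : Matrix (Fin 2) (Fin 2) E) 1 1 + 2 * δ g := by rw [hrr]; ring
    simp only [m, smul_mul_smul_comm]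
    rw [← mul_inv, inv_smul_eq_iff₀ (by simp [h5])]
    ext i j
    fin_cases i <;> fin_cases j <;> simp [Matrix.mul_apply, Matrix.one_apply]
    · linear_combination hd - g.1 0 0 * hrr'
    · linear_combination - g.1 0 1 * hrr'
    · linear_combination - g.1 1 0 * hrr'
    · linear_combination hd - g.1 1 1 * hrr'
  have hone : m g * (m g * ((g⁻¹ : GL (Fin 2) E) : Matrix (Fin 2) (Fin 2) E)) = 1 := by
    rw [← mul_assoc, hsq, ← Units.val_mul, mul_inv_cancel, Units.val_one]
  refine ⟨⟨m g, _, hone, mul_eq_one_comm.1 hone⟩, hAB _ h1 h2, ?_⟩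
  ext1
  exact hsq

end GroupTopology

end Metaplectic

end

/-! ### Unipotent elements and local sections of the cover. -/

section

open ValuativeRel Filter Topology

namespace Metaplectic

section Unipotent

variable {E : Type*} [Field E]

open Matrix.GeneralLinearGroup (upperRightHom)

theorem coe_upperRightHom (n : E) :
    ((upperRightHom n : GL (Fin 2) E) : Matrix (Fin 2) (Fin 2) E) = !![1, n; 0, 1] := by
  simp

theorem cocycle_upperRightHom_left (m : E) (g : GL (Fin 2) E) :
    cocycle (upperRightHom m) g = 1 := by
  have hg : (g : Matrix (Fin 2) (Fin 2) E).det ≠ 0 := g.det_ne_zero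
  have hp : slPart (!![1, m; 0, 1]) = !![1, m; 0, 1] := by simp [slPart, Matrix.det_fin_two]
  have hx (y : E) (h : Matrix (Fin 2) (Fin 2) E) : kubotaX (!![1, y; 0, 1] * h) = kubotaX h := by
    have h2 (j : Fin 2) : (!![1, y; 0, 1] * h) 1 j = h 1 j := by
      simp [Matrix.mul_apply, Fin.sum_univ_two]
    rw [kubotaX, kubotaX, h2, h2]
  have h1 (y : E) : kubotaX !![1, y; 0, 1] = 1 := by simp [kubotaX]
  have hc : conjBy (g : Matrix (Fin 2) (Fin 2) E).det !![1, m; 0, 1] =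
      !![1, m * (g : Matrix (Fin 2) (Fin 2) E).det; 0, 1] := by simp [conjBy_eq, hg]
  rw [cocycle, coe_upperRightHom, hp, hc, cocycleSL, hx, h1, hilbertSymbol_one_left, one_mul,
    inv_one, neg_one_mul, hilbertSymbol_neg_self, one_mul, kubotaV_of_eq _ (by simp)]
  simp [hilbertSymbol_one_right]

theorem cocycle_upperRightHom_right (g : GL (Fin 2) E) (n : E) :
    cocycle g (upperRightHom n) = 1 := by
  have hp : slPart (!![1, n; 0, 1]) = !![1, n; 0, 1] := by simp [slPart, Matrix.det_fin_two]
  have hd : (!![1, n; 0, 1] : Matrix (Fin 2) (Fin 2) E).det = 1 := by simp [Matrix.det_fin_two]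
  have hx (h : Matrix (Fin 2) (Fin 2) E) : kubotaX (h * !![1, n; 0, 1]) = kubotaX h := by
    by_cases h0 : h 1 0 = 0
    · rw [kubotaX_of_eq (by simp [Matrix.mul_apply, h0]), kubotaX_of_eq h0]
      simp [Matrix.mul_apply, h0]
    · rw [kubotaX_of_ne (by simp [Matrix.mul_apply, h0]), kubotaX_of_ne h0]
      simp [Matrix.mul_apply]
  have h1 : kubotaX !![1, n; 0, 1] = 1 := by simp [kubotaX]
  have hc (h : Matrix (Fin 2) (Fin 2) E) : conjBy 1 h = h := by
    rw [conjBy_eq]; ext i j; fin_cases i <;> fin_cases j <;> simp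
  rw [cocycle, coe_upperRightHom, hp, hd, hc, cocycleSL, hx, h1, hilbertSymbol_one_right, one_mul,
    mul_one, hilbertSymbol_neg_inv_self, one_mul, kubotaV]
  simp [hilbertSymbol_one_left]

theorem unip_mul (m : E) (x : Mp E) : unip m * x = ⟨upperRightHom m * x.gl, x.sign⟩ := by
  rw [mul_def, unip, cocycle_upperRightHom_left, one_mul, mul_one]

theorem mul_unip (x : Mp E) (n : E) : x * unip n = ⟨x.gl * upperRightHom n, x.sign⟩ := by
  rw [mul_def, unip, cocycle_upperRightHom_right, mul_one, mul_one]

theorem gl_mul (x y : Mp E) : (x * y).gl = x.gl * y.gl := rfl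

theorem gl_unip (n : E) : (unip n : Mp E).gl = upperRightHom n := rfl

theorem unip_add (m n : E) : (unip (m + n) : Mp E) = unip m * unip n := by
  rw [unip_mul, unip]
  ext1
  · exact AddChar.map_add_eq_mul _ m n
  · rfl

@[simp]
theorem unip_zero : (unip 0 : Mp E) = 1 := by
  rw [unip]
  ext1
  · exact AddChar.map_zero_eq_one _
  · rfl

theorem mul_unip_eq_unip_mul {x : Mp E} {m n : E}
    (h : x.gl * upperRightHom n = upperRightHom m * x.gl) : x * unip n = unip m * x := by
  rw [unip_mul, mul_unip, h]

/-- Two lifts differ by a sign, which is lost on squaring. Together with square roots near `1`, this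
shows that any two local splittings agree near `1`. -/
theorem mul_self_eq_of_gl_eq {x y : Mp E} (h : x.gl = y.gl) : x * x = y * y := by
  have hsq : ∀ u : ℤˣ, u * u = 1 := by decide
  rw [mul_def, mul_def, h, hsq, hsq]

theorem mem_cover {H : Subgroup (GL (Fin 2) E)} {x : Mp E} : x ∈ cover H ↔ x.gl ∈ H := Iff.rfl

theorem mem_torus_iff {g : GL (Fin 2) E} : g ∈ torus E ↔
    (g : Matrix (Fin 2) (Fin 2) E) 0 1 = 0 ∧ (g : Matrix (Fin 2) (Fin 2) E) 1 0 = 0 := by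
  constructor
  · rintro ⟨d, rfl⟩
    simp
  · rintro ⟨h1, h2⟩
    have hd := g.det_ne_zero
    rw [Matrix.det_fin_two, h1, zero_mul, sub_zero] at hd
    refine ⟨MulEquiv.piUnits.symm ![Units.mk0 _ (left_ne_zero_of_mul hd),
      Units.mk0 _ (right_ne_zero_of_mul hd)], ?_⟩
    ext i j
    fin_cases i <;> fin_cases j <;> simp [h1, h2]

end Unipotent

section LocalSection

variable {E : Type*} [Field E] [CharZero E] [ValuativeRel E] [TopologicalSpace E]
  [IsNonarchimedeanLocalField E]

open Matrix.GeneralLinearGroup (upperRightHom)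

/-- A section of the cover which is multiplicative on some open subgroup. -/
structure IsLocalSection (σ : GL (Fin 2) E → Mp E) : Prop where
  gl (g) : (σ g).gl = g
  mul : ∃ U : Subgroup (GL (Fin 2) E), IsOpen (U : Set (GL (Fin 2) E)) ∧
    ∀ g ∈ U, ∀ h ∈ U, σ (g * h) = σ g * σ h

omit [CharZero E] [ValuativeRel E] [IsNonarchimedeanLocalField E] in
theorem IsSplitting.exists_isLocalSection {U : Subgroup (GL (Fin 2) E)} {s : U →* Mp E}
    (hU : IsOpen (U : Set (GL (Fin 2) E))) (hs : IsSplitting U s) :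
    ∃ σ : GL (Fin 2) E → Mp E, IsLocalSection σ := by
  classical
  refine ⟨fun g ↦ if h : g ∈ U then s ⟨g, h⟩ else ⟨g, 1⟩, fun g ↦ ?_, U, hU, fun g hg h hh ↦ ?_⟩
  · split_ifs with h
    · exact hs ⟨g, h⟩
    · rfl
  · rw [dif_pos hg, dif_pos hh, dif_pos (U.mul_mem hg hh), ← map_mul]
    rfl

omit [CharZero E] [ValuativeRel E] [IsNonarchimedeanLocalField E] in
/-- A smooth genuine representation can exist only if the cover splits over an open subgroup. -/
theorem exists_isLocalSection {V : Type*} [AddCommGroup V] [Module ℂ V] [Nontrivial V]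
    {H : Subgroup (GL (Fin 2) E)} {τ : cover H →* Module.End ℂ V} (hτ_smooth : IsSmoothRep τ)
    (hτ_gen : IsGenuine τ) : ∃ σ : GL (Fin 2) E → Mp E, IsLocalSection σ := by
  by_contra! hcon
  have hempty : {S : Set (Mp E) | ∃ (U : Subgroup (GL (Fin 2) E)) (s : U →* Mp E) (x : Mp E),
      IsOpen (U : Set (GL (Fin 2) E)) ∧ IsSplitting U s ∧
        S = Set.range fun u : U ↦ x * s u} = ∅ := by
    rw [Set.eq_empty_iff_forall_notMem]
    rintro S ⟨U, s, -, hU, hs, -⟩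
    obtain ⟨σ, hσ⟩ := hs.exists_isLocalSection hU
    exact hcon σ hσ
  -- Without splittings the generated topology is indiscrete. An open stabilizer would then contain
  -- `(1, -1)`, so that `v = -v`.
  have htriv (O : Set (Mp E)) (hO : IsOpen O) : O = ∅ ∨ O = Set.univ := by
    change TopologicalSpace.GenerateOpen _ O at hO
    rw [hempty] at hO
    induction hO with
    | basic s hs => exact hs.elim
    | univ => exact Or.inr rfl
    | inter s t _ _ h1 h2 => rcases h1 with rfl | rfl <;> simp [h2]
    | sUnion S _ h =>
      by_cases hS : Set.univ ∈ S
      · exact Or.inr (Set.eq_univ_of_univ_subset (Set.subset_sUnion_of_mem hS))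
      · refine Or.inl (Set.sUnion_eq_empty.2 fun s hs ↦ (h s hs).resolve_right ?_)
        rintro rfl
        exact hS hs
  obtain ⟨v, hv⟩ := exists_ne (0 : V)
  obtain ⟨O, hO, hOv⟩ := isOpen_induced_iff.1 (hτ_smooth v)
  have h1 : (1 : cover H) ∈ Subtype.val ⁻¹' O := by rw [hOv]; simp
  rcases htriv O hO with rfl | rfl
  · exact h1
  · have h2 : (⟨muElt (-1), muElt_mem_cover H (-1)⟩ : cover H) ∈ {g | τ g v = v} := by
      rw [← hOv]; trivial
    have h3 := hτ_gen (-1) v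
    rw [Set.mem_ofPred_eq, h3] at h2
    simp only [Units.val_neg, Units.val_one, Int.cast_neg, Int.cast_one, neg_smul, one_smul] at h2
    have h4 : (2 : ℂ) • v = 0 := by rw [two_smul]; nth_rewrite 1 [← h2]; exact neg_add_cancel v
    exact hv ((smul_eq_zero.1 h4).resolve_left two_ne_zero)

namespace IsLocalSection

variable {σ : GL (Fin 2) E → Mp E} (hσ : IsLocalSection σ)

include hσ in
theorem map_one : σ 1 = 1 := by
  obtain ⟨U, -, h⟩ := hσ.mul
  simpa using h 1 U.one_mem 1 U.one_mem

include hσ in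
-- The element with entry `m` is the square of the one with entry `m / 2`, where `σ` is
-- multiplicative, and squares do not depend on the lift. Characteristic zero is used to halve.
theorem eventually_map_unip : ∀ᶠ m in 𝓝 (0 : E), σ (upperRightHom m) = unip m := by
  obtain ⟨U, hU, h⟩ := hσ.mul
  have hc : Tendsto (fun m : E ↦ (upperRightHom (m / 2) : GL (Fin 2) E)) (𝓝 0) (𝓝 1) :=
    (Matrix.GeneralLinearGroup.continuous_upperRightHom.comp
      (continuous_id.div_const (2 : E))).tendsto' _ _ (by simp [AddChar.map_zero_eq_one])
  filter_upwards [hc (hU.mem_nhds U.one_mem)] with m hm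
  have h2 : (upperRightHom m : GL (Fin 2) E) = upperRightHom (m / 2) * upperRightHom (m / 2) := by
    have := congrArg Mp.gl (unip_add (m / 2) (m / 2))
    rwa [add_halves] at this
  have hm' : (upperRightHom (m / 2) : GL (Fin 2) E) ∈ U := hm
  rw [h2, h _ hm' _ hm', mul_self_eq_of_gl_eq (x := σ (upperRightHom (m / 2))) (y := unip (m / 2)) (hσ.gl _), ← unip_add, add_halves]

include hσ in
-- For `k = h²` with `h` near `1`, both sides are squares of lifts of the same element `y h y⁻¹`.
theorem eventually_conj (y : Mp E) :
    ∀ᶠ k in 𝓝 1, y * σ k * y⁻¹ = σ (y.gl * k * y.gl⁻¹) := by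
  obtain ⟨U, hU, h⟩ := hσ.mul
  have hc : Tendsto (fun k ↦ y.gl * k * y.gl⁻¹) (𝓝 1) (𝓝 1) :=
    Continuous.tendsto' (by fun_prop) _ _ (by simp)
  have hU1 := hU.mem_nhds U.one_mem
  filter_upwards [eventually_exists_sq (Filter.inter_mem hU1 (hc hU1))]
  rintro _ ⟨k, ⟨hk1, hk2⟩, rfl⟩
  have h2 : y.gl * (k * k) * y.gl⁻¹ = (y.gl * k * y.gl⁻¹) * (y.gl * k * y.gl⁻¹) := by group
  rw [h2, h _ hk1 _ hk1, h _ hk2 _ hk2,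
    ← mul_self_eq_of_gl_eq (x := y * σ k * y⁻¹) (y := σ (y.gl * k * y.gl⁻¹))]
  · group
  · rw [hσ.gl, gl_mul, gl_mul, hσ.gl]
    rfl

include hσ in
-- A single local section describes the topology generated by all splittings, because each splitting
-- agrees with it near `1`. Smoothness and local constancy become statements about `σ k` for `k`
-- near `1`.
theorem isOpen_iff {O : Set (Mp E)} : IsOpen O ↔ ∀ x ∈ O, ∀ᶠ k in 𝓝 1, x * σ k ∈ O := by
  obtain ⟨U, hU, h⟩ := hσ.mul
  have hU1 := hU.mem_nhds U.one_mem
  constructor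
  · intro hO
    change TopologicalSpace.GenerateOpen _ O at hO
    induction hO with
    | basic S hS =>
      obtain ⟨U', s', y, hU', hs', rfl⟩ := hS
      rintro _ ⟨u, rfl⟩
      filter_upwards [eventually_exists_sq (Filter.inter_mem hU1 (hU'.mem_nhds U'.one_mem))]
      rintro _ ⟨k, ⟨hk1, hk2⟩, rfl⟩
      refine ⟨u * (⟨k, hk2⟩ * ⟨k, hk2⟩), ?_⟩
      change y * s' (u * (⟨k, hk2⟩ * ⟨k, hk2⟩)) = y * s' u * σ (k * k)
      rw [h _ hk1 _ hk1, map_mul, map_mul, mul_assoc,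
        mul_self_eq_of_gl_eq (x := σ k) (y := s' ⟨k, hk2⟩)]
      rw [hσ.gl]
      exact (hs' ⟨k, hk2⟩).symm
    | univ => simp
    | inter s t _ _ h1 h2 => exact fun x hx ↦ (h1 x hx.1).and (h2 x hx.2)
    | sUnion S _ hS =>
      rintro x ⟨s, hs, hxs⟩
      exact (hS s hs x hxs).mono fun k hk ↦ ⟨s, hs, hk⟩
  · intro hO
    refine isOpen_iff_forall_mem_open.2 fun x hx ↦ ?_
    obtain ⟨H, hH, hHU⟩ := exists_openSubgroup_subset (Filter.inter_mem hU1 (hO x hx))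
    let s : H →* Mp E :=
      { toFun := fun u ↦ σ u
        map_one' := hσ.map_one
        map_mul' := fun u v ↦ h _ (hHU u.2).1 _ (hHU v.2).1 }
    refine ⟨Set.range fun u : H ↦ x * s u, ?_, ?_, 1, ?_⟩
    · rintro _ ⟨u, rfl⟩
      exact (hHU u.2).2
    · exact TopologicalSpace.isOpen_generateFrom_of_mem ⟨H, s, x, hH, fun u ↦ hσ.gl u, rfl⟩
    · simp

include hσ in
theorem isLocallyConstant_iff {X : Type*} {f : Mp E → X} :
    IsLocallyConstant f ↔ ∀ x, ∀ᶠ k in 𝓝 1, f (x * σ k) = f x := by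
  constructor
  · exact fun hf x ↦ hσ.isOpen_iff.1 (hf {f x}) x rfl
  · refine fun hf S ↦ hσ.isOpen_iff.2 fun x hx ↦ (hf x).mono fun k hk ↦ ?_
    rwa [Set.mem_preimage, hk]

include hσ in
theorem eventually_fixed {V : Type*} [AddCommGroup V] [Module ℂ V]
    {H : Subgroup (GL (Fin 2) E)} {τ : cover H →* Module.End ℂ V} (hτ : IsSmoothRep τ) (v : V) :
    ∀ᶠ k in 𝓝 1, ∀ h : k ∈ H, τ ⟨σ k, mem_cover.2 ((hσ.gl k).symm ▸ h)⟩ v = v := by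
  obtain ⟨O, hO, hOv⟩ := isOpen_induced_iff.1 (hτ v)
  have h1 : (1 : cover H) ∈ Subtype.val ⁻¹' O := by rw [hOv]; simp
  filter_upwards [hσ.isOpen_iff.1 hO 1 h1] with k hk h
  rw [one_mul] at hk
  have : (⟨σ k, mem_cover.2 ((hσ.gl k).symm ▸ h)⟩ : cover H) ∈ Subtype.val ⁻¹' O := hk
  rwa [hOv] at this

end IsLocalSection

end LocalSection

end Metaplectic

end

/-! ### The modulus character, and functions supported on the big cell. -/

noncomputable section

open ValuativeRel Filter Topology

namespace Metaplectic

section Modulus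

variable {E : Type*} [Field E] [ValuativeRel E] [TopologicalSpace E] [IsNonarchimedeanLocalField E]

theorem normAbs_mul (x y : E) : normAbs (x * y) = normAbs x * normAbs y := by
  by_cases hx : x = 0
  · simp [normAbs, hx]
  by_cases hy : y = 0
  · simp [normAbs, hy]
  rw [normAbs, normAbs, normAbs, dif_neg hx, dif_neg hy, dif_neg (mul_ne_zero hx hy), ← map_mul]
  congr 1
  ext
  rfl

theorem normAbs_one : normAbs (1 : E) = 1 := by
  have : Units.mk0 (1 : E) one_ne_zero = 1 := by ext; rfl
  rw [normAbs, dif_neg one_ne_zero, this, map_one]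

theorem normAbs_eq_one_of_valuation_eq_one {x : E} (hx : valuation E x = 1) : normAbs x = 1 := by
  have hx0 : x ≠ 0 := by rintro rfl; simp at hx
  rw [normAbs, dif_neg hx0]
  let : MeasurableSpace E := borel E
  have : BorelSpace E := ⟨rfl⟩
  have hO : IsOpen {y : E | valuation E y ≤ 1} := by
    have := (IsValuativeTopology.hasBasis_nhds_zero' E).mem_of_mem
      (one_ne_zero (α := ValueGroupWithZero E))
    refine (AddSubgroup.isOpen_of_mem_nhds ((valuation E).integer.toAddSubgroup) (g := 0) ?_)
    exact Filter.mem_of_superset this fun y hy ↦ (le_of_lt (show valuation E y < 1 from hy) : _)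
  have hc := IsNonarchimedeanLocalField.isCompact_closedBall E 1
  refine MeasureTheory.distribHaarChar_eq_of_measure_smul_eq_mul
    (μ := MeasureTheory.Measure.addHaar (G := E)) (s := {y : E | valuation E y ≤ 1})
    (hO.measure_pos _ ⟨0, by simp⟩).ne' hc.measure_ne_top ?_
  rw [ENNReal.coe_one, one_mul]
  congr 1
  ext y
  rw [Set.mem_smul_set_iff_inv_smul_mem]
  change valuation E (x⁻¹ * y) ≤ 1 ↔ valuation E y ≤ 1
  rw [map_mul, map_inv₀, hx, inv_one, one_mul]

theorem eventually_normAbs_eq_one : ∀ᶠ x in 𝓝 (1 : E), normAbs x = 1 := by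
  filter_upwards [(IsValuativeTopology.hasBasis_nhds' (1 : E)).mem_of_mem
    (one_ne_zero (α := ValueGroupWithZero E))] with x hx
  refine normAbs_eq_one_of_valuation_eq_one ?_
  have := Valuation.map_one_add_of_lt (valuation E) (x := x - 1) hx
  rwa [add_sub_cancel] at this

theorem deltaHalf_mul {g h : GL (Fin 2) E} (hg : g ∈ torus E) (hh : h ∈ torus E) :
    deltaHalf (g * h) = deltaHalf g * deltaHalf h := by
  obtain ⟨g1, g2⟩ := mem_torus_iff.1 hg
  obtain ⟨h1, h2⟩ := mem_torus_iff.1 hh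
  rw [deltaHalf, deltaHalf, deltaHalf, ← NNReal.sqrt_mul, ← normAbs_mul]
  simp [Matrix.mul_apply, g1, g2, h1, h2, mul_div_mul_comm]

theorem eventually_deltaHalf_eq_one : ∀ᶠ g in 𝓝 (1 : GL (Fin 2) E), deltaHalf g = 1 := by
  have h (i) : Tendsto (fun g : GL (Fin 2) E ↦ g.1 i i) (𝓝 1) (𝓝 1) :=
    (Units.continuous_val.matrix_elem i i).tendsto' _ _ (by simp)
  have h1 : Tendsto (fun g : GL (Fin 2) E ↦ g.1 0 0 / g.1 1 1) (𝓝 1) (𝓝 1) := by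
    have := (h 0).div (h 1) one_ne_zero
    rw [div_one] at this
    exact this
  filter_upwards [h1.eventually eventually_normAbs_eq_one] with g hg
  rw [deltaHalf, hg, NNReal.sqrt_one]

theorem deltaHalf_of_mem_scalars {g : GL (Fin 2) E} (hg : g ∈ scalars E) : deltaHalf g = 1 := by
  obtain ⟨t, rfl⟩ := hg
  simp [deltaHalf, normAbs_one]

end Modulus

section BigCell

variable {E : Type*} [Field E] [CharZero E] [ValuativeRel E] [TopologicalSpace E]
  [IsNonarchimedeanLocalField E]

open Matrix.GeneralLinearGroup (upperRightHom)

/-- The Weyl element of `GL₂`. -/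
def weylGL (E : Type*) [Field E] : GL (Fin 2) E :=
  ⟨!![0, 1; -1, 0], !![0, -1; 1, 0], by simp [Matrix.one_fin_two], by simp [Matrix.one_fin_two]⟩

/-- The standard lift of the Weyl element to the cover. -/
def weyl : Mp E := ⟨weylGL E, 1⟩

omit [CharZero E] [ValuativeRel E] [TopologicalSpace E] [IsNonarchimedeanLocalField E] in
theorem mul_unip_of_mem_torus {a : Mp E} (ha : a ∈ cover (torus E)) (r : E) :
    a * unip r = unip (a.gl.1 0 0 / a.gl.1 1 1 * r) * a := by
  obtain ⟨h1, h2⟩ := mem_torus_iff.1 (mem_cover.1 ha)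
  have hd := a.gl.det_ne_zero
  rw [Matrix.det_fin_two, h1, zero_mul, sub_zero] at hd
  have h3 := right_ne_zero_of_mul hd
  refine mul_unip_eq_unip_mul ?_
  ext i j
  fin_cases i <;> fin_cases j <;> simp [Matrix.mul_apply, h1, h2]
  field_simp

/-- The torus component of an element of the big Bruhat cell. -/
def levi (x : Mp E) : Mp E :=
  unip (-(x.gl.1 0 0 / x.gl.1 1 0)) * x * unip (-(x.gl.1 1 1 / x.gl.1 1 0)) * weyl⁻¹

theorem bruhat (x : Mp E) :
    unip (x.gl.1 0 0 / x.gl.1 1 0) * levi x * weyl * unip (x.gl.1 1 1 / x.gl.1 1 0) = x := by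
  have h (r : E) : (unip (-r) : Mp E) = (unip r)⁻¹ := by
    rw [eq_inv_iff_mul_eq_one, ← unip_add, neg_add_cancel, unip_zero]
  rw [levi, h, h]
  group

theorem levi_mem {x : Mp E} (hx : x.gl.1 1 0 ≠ 0) : levi x ∈ cover (torus E) := by
  rw [mem_cover, mem_torus_iff]
  have : ((weyl⁻¹ : Mp E).gl : Matrix (Fin 2) (Fin 2) E) = !![0, -1; 1, 0] := rfl
  simp only [levi, gl_mul, Units.val_mul, this, gl_unip, coe_upperRightHom, Matrix.mul_apply,
    Fin.sum_univ_two]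
  constructor
  · simp
    field_simp
    ring
  · simp
    field_simp
    ring

theorem bruhat_apply {a : Mp E} (ha : a ∈ cover (torus E)) (m n : E) :
    let x := unip m * a * weyl * unip n
    x.gl.1 1 0 ≠ 0 ∧ x.gl.1 1 1 / x.gl.1 1 0 = n ∧ levi x = a := by
  intro x
  obtain ⟨h1, h2⟩ := mem_torus_iff.1 (mem_cover.1 ha)
  have hd := a.gl.det_ne_zero
  rw [Matrix.det_fin_two, h1, zero_mul, sub_zero] at hd
  have h3 := right_ne_zero_of_mul hd
  have hw : ((weyl : Mp E).gl : Matrix (Fin 2) (Fin 2) E) = !![0, 1; -1, 0] := rfl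
  have x00 : x.gl.1 0 0 = -(m * a.gl.1 1 1) := by
    simp only [x, gl_mul, hw, gl_unip, Units.val_mul, coe_upperRightHom, Matrix.mul_apply,
      Fin.sum_univ_two]
    simp [h1, h2]
  have x10 : x.gl.1 1 0 = -a.gl.1 1 1 := by
    simp only [x, gl_mul, hw, gl_unip, Units.val_mul, coe_upperRightHom, Matrix.mul_apply,
      Fin.sum_univ_two]
    simp [h1, h2]
  have x11 : x.gl.1 1 1 = -(a.gl.1 1 1 * n) := by
    simp only [x, gl_mul, hw, gl_unip, Units.val_mul, coe_upperRightHom, Matrix.mul_apply,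
      Fin.sum_univ_two]
    simp [h1, h2]
  have e0 : x.gl.1 0 0 / x.gl.1 1 0 = m := by rw [x00, x10]; field_simp
  have e1 : x.gl.1 1 1 / x.gl.1 1 0 = n := by rw [x11, x10]; field_simp
  refine ⟨by simpa [x10], e1, ?_⟩
  have := bruhat x
  rw [e0, e1] at this
  simpa only [x, mul_left_inj, mul_right_inj] using this

/-- Elements of the inverse image of the Borel subgroup. -/
theorem exists_eq_unip_mul_of_eq {x : Mp E} (hx : x.gl.1 1 0 = 0) :
    ∃ m, ∃ a : cover (torus E), x = unip m * (a : Mp E) := by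
  have hd := x.gl.det_ne_zero
  rw [Matrix.det_fin_two, hx, mul_zero, sub_zero] at hd
  have h3 := right_ne_zero_of_mul hd
  refine ⟨x.gl.1 0 1 / x.gl.1 1 1, ⟨unip (-(x.gl.1 0 1 / x.gl.1 1 1)) * x, ?_⟩, ?_⟩
  · rw [mem_cover, mem_torus_iff]
    simp only [gl_mul, gl_unip, Units.val_mul, coe_upperRightHom, Matrix.mul_apply,
      Fin.sum_univ_two]
    simp [hx]
    field_simp
    ring
  · rw [← mul_assoc, ← unip_add, add_neg_cancel, unip_zero, one_mul]

variable {V : Type*} [AddCommGroup V] [Module ℂ V] {τ : cover (torus E) →* Module.End ℂ V}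

omit [CharZero E] in
theorem apply_unip_mul {f : Mp E → V} (hf : f ∈ inducedSpace τ) (n : E) (a : cover (torus E))
    (g : Mp E) : f (unip n * a * g) = ((deltaHalf (a : Mp E).gl : ℝ) : ℂ) • τ a (f g) :=
  hf.2 n a g

variable (τ) in
open Classical in
/-- The function on the cover supported on the big cell which is given by `Φ` on `w N`. -/
def bigCell (Φ : E → V) (x : Mp E) : V :=
  if h : x.gl.1 1 0 ≠ 0 then
    ((deltaHalf (levi x).gl : ℝ) : ℂ) • τ ⟨levi x, levi_mem h⟩ (Φ (x.gl.1 1 1 / x.gl.1 1 0))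
  else 0

theorem bigCell_of_eq (Φ : E → V) {x : Mp E} (hx : x.gl.1 1 0 = 0) : bigCell τ Φ x = 0 :=
  dif_neg (not_not.2 hx)

theorem bigCell_apply (Φ : E → V) (a : cover (torus E)) (m n : E) :
    bigCell τ Φ (unip m * (a : Mp E) * weyl * unip n) = ((deltaHalf (a : Mp E).gl : ℝ) : ℂ) • τ a (Φ n) := by
  obtain ⟨h1, h2, h3⟩ := bruhat_apply a.2 m n
  have h4 : (⟨levi (unip m * (a : Mp E) * weyl * unip n), levi_mem h1⟩ : cover (torus E)) = a :=
    Subtype.ext h3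
  rw [bigCell, dif_pos h1, h2, h4, h3]

theorem bigCell_weyl (Φ : E → V) (n : E) : bigCell τ Φ (weyl * unip n) = Φ n := by
  have h := bigCell_apply (τ := τ) Φ 1 0 n
  have h1 : deltaHalf (1 : GL (Fin 2) E) = 1 := deltaHalf_of_mem_scalars (one_mem _)
  have h2 : ((1 : cover (torus E)) : Mp E).gl = 1 := rfl
  rw [h2, h1] at h
  simpa using h

theorem bigCell_unip_mul (Φ : E → V) (n : E) (b : cover (torus E)) (x : Mp E) :
    bigCell τ Φ (unip n * (b : Mp E) * x) = ((deltaHalf (b : Mp E).gl : ℝ) : ℂ) • τ b (bigCell τ Φ x) := by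
  by_cases hx : x.gl.1 1 0 = 0
  · obtain ⟨h1, h2⟩ := mem_torus_iff.1 (mem_cover.1 b.2)
    rw [bigCell_of_eq Φ hx, bigCell_of_eq, map_zero, smul_zero]
    simp only [gl_mul, gl_unip, Units.val_mul, coe_upperRightHom, Matrix.mul_apply,
      Fin.sum_univ_two]
    simp [h2, hx]
  · have hx' := bruhat x
    generalize x.gl.1 0 0 / x.gl.1 1 0 = m at hx'
    generalize x.gl.1 1 1 / x.gl.1 1 0 = r at hx'
    let a : cover (torus E) := ⟨levi x, levi_mem hx⟩
    have e : unip n * (b : Mp E) * x =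
        unip (n + (b : Mp E).gl.1 0 0 / (b : Mp E).gl.1 1 1 * m) * ((b * a : cover (torus E)) : Mp E) *
          weyl * unip r := by
      conv_lhs => rw [← hx']
      rw [unip_add, Submonoid.coe_mul, mul_assoc (unip n) (unip _), ← mul_assoc (unip _) (b : Mp E),
        ← mul_unip_of_mem_torus b.2]
      simp only [mul_assoc]
      rfl
    rw [e, bigCell_apply]
    conv_rhs => rw [← hx']
    change _ = _ • τ b (bigCell τ Φ (unip m * (a : Mp E) * weyl * unip r))
    rw [bigCell_apply, Submonoid.coe_mul, gl_mul, deltaHalf_mul (mem_cover.1 b.2) (mem_cover.1 a.2), map_mul, map_smul,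
      smul_smul]
    simp

/-- Elements near `1` lie in the open cell `N A N⁻`, with components near `1`. -/
theorem IsLocalSection.exists_eventually_eq {σ : GL (Fin 2) E → Mp E} (hσ : IsLocalSection σ) :
    ∃ (m r : GL (Fin 2) E → E) (D : GL (Fin 2) E → GL (Fin 2) E), Tendsto r (𝓝 1) (𝓝 0) ∧
      Tendsto D (𝓝 1) (𝓝 1) ∧ ∀ᶠ k in 𝓝 1, D k ∈ torus E ∧
        σ k = unip (m k) * σ (D k) * (weyl * unip (r k) * weyl⁻¹) := by
  have h (i j) : Tendsto (fun g : GL (Fin 2) E ↦ g.1 i j) (𝓝 1)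
      (𝓝 ((1 : Matrix (Fin 2) (Fin 2) E) i j)) :=
    (Units.continuous_val.matrix_elem i j).tendsto' _ _ (by simp)
  have hm : Tendsto (fun g : GL (Fin 2) E ↦ g.1 0 1 / g.1 1 1) (𝓝 1) (𝓝 0) := by
    have := (h 0 1).div (h 1 1) (by simp)
    simp only [Matrix.one_apply_eq, ne_eq, zero_ne_one, not_false_eq_true, Matrix.one_apply_ne,
      zero_div] at this
    exact this
  have hr : Tendsto (fun g : GL (Fin 2) E ↦ -(g.1 1 0 / g.1 1 1)) (𝓝 1) (𝓝 0) := by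
    have := ((h 1 0).div (h 1 1) (by simp)).neg
    simp only [Matrix.one_apply_eq, ne_eq, one_ne_zero, not_false_eq_true, Matrix.one_apply_ne,
      zero_div, neg_zero] at this
    exact this
  have hu : Tendsto (fun m : E ↦ (upperRightHom m : GL (Fin 2) E)) (𝓝 0) (𝓝 1) :=
    Matrix.GeneralLinearGroup.continuous_upperRightHom.tendsto' _ _ (AddChar.map_zero_eq_one _)
  have hL : Tendsto (fun g : GL (Fin 2) E ↦
      weylGL E * upperRightHom (-(g.1 1 0 / g.1 1 1)) * (weylGL E)⁻¹) (𝓝 1) (𝓝 1) := by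
    simpa using ((hu.comp hr).const_mul (weylGL E)).mul_const (weylGL E)⁻¹
  have hD : Tendsto (fun g : GL (Fin 2) E ↦ (upperRightHom (g.1 0 1 / g.1 1 1))⁻¹ * g *
      (weylGL E * upperRightHom (-(g.1 1 0 / g.1 1 1)) * (weylGL E)⁻¹)⁻¹) (𝓝 1) (𝓝 1) := by
    simpa using ((hu.comp hm).inv.mul tendsto_id).mul hL.inv
  refine ⟨fun g ↦ g.1 0 1 / g.1 1 1, _, _, hr, hD, ?_⟩
  obtain ⟨U, hU, hmul⟩ := hσ.mul
  have hU1 := hU.mem_nhds U.one_mem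
  have hw := (hu.comp hr).eventually (hσ.eventually_conj weyl)
  filter_upwards [(hu.comp hm) hU1, hD hU1, hL hU1, hm.eventually hσ.eventually_map_unip, hw,
    hr.eventually hσ.eventually_map_unip, (h 1 1).eventually_ne (by simp : _ ≠ (0 : E))]
    with k h1 h2 h3 h4 h5 h6 h7
  constructor
  · have hi (n : E) : (((upperRightHom n)⁻¹ : GL (Fin 2) E) : Matrix (Fin 2) (Fin 2) E) =
        !![1, -n; 0, 1] := rfl
    have hw1 : ((weylGL E : GL (Fin 2) E) : Matrix (Fin 2) (Fin 2) E) = !![0, 1; -1, 0] := rfl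
    have hw2 : (((weylGL E)⁻¹ : GL (Fin 2) E) : Matrix (Fin 2) (Fin 2) E) = !![0, -1; 1, 0] := rfl
    rw [mem_torus_iff, _root_.mul_inv_rev, _root_.mul_inv_rev, inv_inv]
    simp only [Units.val_mul, hi, hw1, hw2]
    simp only [Matrix.mul_apply, Fin.sum_univ_two]
    constructor
    · simp
      field_simp
      ring
    · simp
      field_simp
      ring
  · have h5' : weyl * σ (upperRightHom (-(k.1 1 0 / k.1 1 1))) * weyl⁻¹ =
        σ (weylGL E * upperRightHom (-(k.1 1 0 / k.1 1 1)) * (weylGL E)⁻¹) := h5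
    rw [← h4, ← h6, h5']
    refine Eq.trans (congrArg σ ?_)
      ((hmul _ (U.mul_mem h1 h2) _ h3).trans (congrArg (· * _) (hmul _ h1 _ h2)))
    exact (fun a b k : GL (Fin 2) E ↦ show k = a * (a⁻¹ * k * b⁻¹) * b by group) _ _ k

/-- By equivariance, local constancy need only be checked at `1` and at the points `wn`. Near `1`
the coordinate `d/c` is either undefined or so large that it leaves the support of `Φ`. Near `wn`,
conjugation moves the perturbation to the left, where it factors through `N A N⁻`: the `N` part acts
trivially, the `A` part fixes `Φ(n)` by smoothness of `τ`, and the `N⁻` part shifts `n` slightly. -/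
theorem bigCell_mem {σ : GL (Fin 2) E → Mp E} (hσ : IsLocalSection σ) (hτ : IsSmoothRep τ)
    {Φ : E → V} (hΦ : IsLocallyConstant Φ) (hΦ' : HasCompactSupport Φ) :
    bigCell τ Φ ∈ inducedSpace τ := by
  refine ⟨hσ.isLocallyConstant_iff.2 fun x ↦ ?_, bigCell_unip_mul Φ⟩
  have key (n : E) (b : cover (torus E)) (y : Mp E)
      (hy : ∀ᶠ k in 𝓝 1, bigCell τ Φ (y * σ k) = bigCell τ Φ y) :
      ∀ᶠ k in 𝓝 1, bigCell τ Φ (unip n * (b : Mp E) * y * σ k) = bigCell τ Φ (unip n * (b : Mp E) * y) := by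
    filter_upwards [hy] with k hk
    rw [mul_assoc, bigCell_unip_mul, hk, bigCell_unip_mul]
  have h (i j) : Tendsto (fun g : GL (Fin 2) E ↦ g.1 i j) (𝓝 1)
      (𝓝 ((1 : Matrix (Fin 2) (Fin 2) E) i j)) :=
    (Units.continuous_val.matrix_elem i j).tendsto' _ _ (by simp)
  by_cases hx : x.gl.1 1 0 = 0
  · obtain ⟨m, a, rfl⟩ := exists_eq_unip_mul_of_eq hx
    have h1 : ∀ᶠ k in 𝓝 1, bigCell τ Φ (1 * σ k) = bigCell τ Φ 1 := by
      have ht : Tendsto (fun g : GL (Fin 2) E ↦ g.1 1 0 / g.1 1 1) (𝓝 1) (𝓝 0) := by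
        have := (h 1 0).div (h 1 1) (by simp)
        simp only [Matrix.one_apply_eq, ne_eq, one_ne_zero, not_false_eq_true, Matrix.one_apply_ne,
          zero_div] at this
        exact this
      have hK : ∀ᶠ t in 𝓝 (0 : E), ∀ n ∈ tsupport Φ, t * n ≠ 1 := by
        refine hΦ'.isCompact.eventually_forall_of_forall_eventually fun n _ ↦ ?_
        have : Tendsto (fun z : E × E ↦ z.1 * z.2) (𝓝 (0, n)) (𝓝 0) :=
          continuous_mul.tendsto' _ _ (by simp)
        exact this.eventually_ne zero_ne_one
      filter_upwards [ht.eventually hK, (h 1 1).eventually_ne (by simp : _ ≠ (0 : E))] with k hk hk1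
      rw [one_mul, bigCell_of_eq (x := 1) Φ (by rfl)]
      by_cases hk0 : k.1 1 0 = 0
      · rw [bigCell_of_eq Φ (by rwa [hσ.gl])]
      · have hΦk : Φ (k.1 1 1 / k.1 1 0) = 0 := by
          by_contra hne
          exact hk _ (subset_tsupport _ hne) (by field_simp)
        have h2 : (σ k).gl.1 1 0 ≠ 0 := by rwa [hσ.gl]
        rw [bigCell, dif_pos h2, hσ.gl, hΦk, map_zero, smul_zero]
    simpa using key m a 1 h1
  · rw [← bruhat x, mul_assoc _ weyl]
    refine key _ ⟨levi x, levi_mem hx⟩ (weyl * unip _) ?_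
    generalize x.gl.1 1 1 / x.gl.1 1 0 = n
    obtain ⟨m, r, D, hr, hD, hk⟩ := hσ.exists_eventually_eq
    set y : Mp E := weyl * unip n
    have hc : Tendsto (fun k ↦ y.gl * k * y.gl⁻¹) (𝓝 1) (𝓝 1) :=
      Continuous.tendsto' (by fun_prop) _ _ (by simp)
    have hn : ∀ᶠ t in 𝓝 0, Φ (t + n) = Φ n := by
      have h1 : Tendsto (fun t : E ↦ t + n) (𝓝 0) (𝓝 n) :=
        Continuous.tendsto' (by fun_prop) _ _ (by simp)
      exact h1.eventually ((IsLocallyConstant.iff_eventually_eq _).1 hΦ n)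
    filter_upwards [hσ.eventually_conj y, hc.eventually hk, hc.eventually (hr.eventually hn),
      hc.eventually (hD.eventually eventually_deltaHalf_eq_one),
      hc.eventually (hD.eventually (hσ.eventually_fixed hτ (Φ n)))] with k h1 h2 h3 h4 h5
    generalize y.gl * k * y.gl⁻¹ = k' at *
    rw [mul_inv_eq_iff_eq_mul] at h1
    obtain ⟨h2, h2'⟩ := h2
    let a : cover (torus E) := ⟨σ (D k'), mem_cover.2 ((hσ.gl (D k')).symm ▸ h2)⟩
    have e : y * σ k = unip (m k') * (a : Mp E) * weyl * unip (r k' + n) := by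
      rw [h1, h2', unip_add]
      simp only [y, a]
      group
    have ha : (a : Mp E).gl = D k' := hσ.gl _
    rw [e, bigCell_apply, h3, h5 h2, ha, h4, bigCell_weyl]
    simp

theorem isLocallyConstant_restrict {σ : GL (Fin 2) E → Mp E} (hσ : IsLocalSection σ)
    {f : Mp E → V} (hf : f ∈ inducedSpace τ) : IsLocallyConstant fun n ↦ f (weyl * unip n) := by
  refine (IsLocallyConstant.iff_eventually_eq _).2 fun n ↦ ?_
  have hu : Tendsto (fun t : E ↦ (upperRightHom (t - n) : GL (Fin 2) E)) (𝓝 n) (𝓝 1) :=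
    (Matrix.GeneralLinearGroup.continuous_upperRightHom.comp
      (continuous_id.sub continuous_const)).tendsto' _ _ (by simp [AddChar.map_zero_eq_one])
  have hs : Tendsto (fun t : E ↦ t - n) (𝓝 n) (𝓝 0) :=
    Continuous.tendsto' (by fun_prop) _ _ (by simp)
  filter_upwards [hu.eventually (hσ.isLocallyConstant_iff.1 hf.1 (weyl * unip n)),
    hs.eventually hσ.eventually_map_unip] with t h1 h2
  rw [h2, mul_assoc, ← unip_add, add_sub_cancel] at h1
  exact h1

/-- For `n ≠ 0` the element `wn` is a Borel element times the lower unipotent `w u(-1/n) w⁻¹`. For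
large `n` this tends to `1`, where `f` vanishes by local constancy. -/
theorem hasCompactSupport_restrict {σ : GL (Fin 2) E → Mp E} (hσ : IsLocalSection σ)
    {f : Mp E → V} (hf : f ∈ inducedSpace τ) (hf1 : f 1 = 0) :
    HasCompactSupport fun n ↦ f (weyl * unip n) := by
  have hu : Tendsto (fun t : E ↦ (upperRightHom t : GL (Fin 2) E)) (𝓝 0) (𝓝 1) :=
    Matrix.GeneralLinearGroup.continuous_upperRightHom.tendsto' _ _ (AddChar.map_zero_eq_one _)
  have hu' : Tendsto (fun t : E ↦ weylGL E * (upperRightHom t : GL (Fin 2) E) * (weylGL E)⁻¹)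
      (𝓝 0) (𝓝 1) := by
    simpa using (hu.const_mul (weylGL E)).mul_const (weylGL E)⁻¹
  have hev : ∀ᶠ t in 𝓝 (0 : E), f (weyl * unip t * weyl⁻¹) = 0 := by
    filter_upwards [hu'.eventually (hσ.isLocallyConstant_iff.1 hf.1 1),
      hu.eventually (hσ.eventually_conj weyl), hσ.eventually_map_unip] with t h1 h2 h3
    rw [one_mul] at h1
    rw [← h3, h2, ← hf1, ← h1]
    rfl
  obtain ⟨γ, hγ, hball⟩ := (IsValuativeTopology.hasBasis_nhds_zero' E).mem_iff.1 hev
  refine HasCompactSupport.intro (IsNonarchimedeanLocalField.isCompact_closedBall E γ⁻¹) ?_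
  intro n hn
  have hn' : γ⁻¹ < valuation E n := not_le.1 hn
  have hn0 : n ≠ 0 := by
    rintro rfl
    simp at hn'
  have hlt : valuation E (-n⁻¹) < γ := by
    rw [Valuation.map_neg, map_inv₀]
    exact inv_lt_of_inv_lt₀ (zero_lt_iff.2 hγ) hn'
  have h0 := hball hlt
  set x : Mp E := weyl * unip n * (weyl * unip (-n⁻¹) * weyl⁻¹)⁻¹
  have hx : x.gl.1 1 0 = 0 := by
    have hi (n : E) : (((upperRightHom n)⁻¹ : GL (Fin 2) E) : Matrix (Fin 2) (Fin 2) E) =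
        !![1, -n; 0, 1] := rfl
    have hw1 : ((weylGL E : GL (Fin 2) E) : Matrix (Fin 2) (Fin 2) E) = !![0, 1; -1, 0] := rfl
    have hw2 : (((weylGL E)⁻¹ : GL (Fin 2) E) : Matrix (Fin 2) (Fin 2) E) = !![0, -1; 1, 0] := rfl
    have : x.gl = weylGL E * upperRightHom n *
      (weylGL E * upperRightHom (-n⁻¹) * (weylGL E)⁻¹)⁻¹ := rfl
    rw [this, _root_.mul_inv_rev, _root_.mul_inv_rev, inv_inv]
    simp only [Units.val_mul, hi, hw1, hw2, coe_upperRightHom, Matrix.mul_apply, Fin.sum_univ_two]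
    simp [hn0]
  obtain ⟨m, a, ha⟩ := exists_eq_unip_mul_of_eq hx
  have e : weyl * unip n = unip m * (a : Mp E) * (weyl * unip (-n⁻¹) * weyl⁻¹) := by
    rw [← ha]
    simp only [x]
    group
  change f (weyl * unip n) = 0
  rw [e, apply_unip_mul hf]
  rw [h0, map_zero, smul_zero]

/-- The complement of the big cell is the inverse image of the Borel subgroup, where `f` is
determined by `f(1) = 0`. -/
theorem eq_bigCell {f : Mp E → V} (hf : f ∈ inducedSpace τ) (hf1 : f 1 = 0) :
    f = bigCell τ fun n ↦ f (weyl * unip n) := by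
  ext x
  by_cases hx : x.gl.1 1 0 = 0
  · rw [bigCell_of_eq _ hx]
    obtain ⟨m, a, rfl⟩ := exists_eq_unip_mul_of_eq hx
    rw [← mul_one (unip m * _), apply_unip_mul hf, hf1, map_zero, smul_zero]
  · rw [← bruhat x]
    have h1 := bigCell_apply (τ := τ) (fun n ↦ f (weyl * unip n)) ⟨levi x, levi_mem hx⟩
      (x.gl.1 0 0 / x.gl.1 1 0) (x.gl.1 1 1 / x.gl.1 1 0)
    rw [h1, mul_assoc _ weyl]
    exact apply_unip_mul hf _ ⟨levi x, levi_mem hx⟩ _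

end BigCell

end Metaplectic

end

/-! ### Irreducible projective representations of `G × G` restricted to the diagonal. -/

section

open LaurentPolynomial Polynomial

/-- If `T - 1` is surjective and the space is generated by finitely many vectors under the powers
of `T`, then `T` is algebraic. -/
theorem Module.End.exists_aeval_eq_zero_of_surjective_sub_one {V : Type*} [AddCommGroup V]
    [Module ℂ V] (T : (Module.End ℂ V)ˣ)
    (hT : Function.Surjective ((T : Module.End ℂ V) - 1 : Module.End ℂ V)) {s : Set V}
    (hs : s.Finite)
    (hgen : ∀ S : Submodule ℂ V,
      (∀ v ∈ s, ∀ n : ℤ, ((T ^ n : (Module.End ℂ V)ˣ) : Module.End ℂ V) v ∈ S) → S = ⊤) :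
    ∃ p : ℂ[X], p ≠ 0 ∧ aeval (T : Module.End ℂ V) p = 0 := by
  let ρ : ℂ[T;T⁻¹] →ₐ[ℂ] Module.End ℂ V := AddMonoidAlgebra.lift ℂ (Module.End ℂ V) ℤ
    ((Units.coeHom _).comp (zpowersHom _ T))
  have hρT (n : ℤ) : ρ (LaurentPolynomial.T n) = ((T ^ n : (Module.End ℂ V)ˣ) : Module.End ℂ V) := by
    exact (AddMonoidAlgebra.lift_single _ _ _).trans (one_smul _ _)
  let : Module ℂ[T;T⁻¹] V := Module.compHom V ρ.toRingHom
  have hsmul (r : ℂ[T;T⁻¹]) (v : V) : r • v = ρ r v := rfl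
  have htop : Submodule.span ℂ[T;T⁻¹] s = ⊤ := by
    let S : Submodule ℂ V :=
      { carrier := Submodule.span ℂ[T;T⁻¹] s
        add_mem' := fun h1 h2 ↦ Submodule.add_mem _ h1 h2
        zero_mem' := Submodule.zero_mem _
        smul_mem' := fun c v hv ↦ by
          have := Submodule.smul_mem _ (algebraMap ℂ ℂ[T;T⁻¹] c) hv
          rwa [hsmul, AlgHom.commutes] at this }
    have hS : S = ⊤ := hgen S fun v hv n ↦ by
      have := Submodule.smul_mem _ (LaurentPolynomial.T n) (Submodule.subset_span (R := ℂ[T;T⁻¹]) hv)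
      rwa [hsmul, hρT] at this
    refine eq_top_iff.2 fun v _ ↦ ?_
    have : v ∈ S := hS ▸ Submodule.mem_top
    exact this
  -- Nakayama's lemma: `V` is finitely generated over `ℂ[T, T⁻¹]` and equals `(T - 1)V`, so some `r
  -- ≡ 1` modulo `T - 1` annihilates it. Evaluation at `T = 1` shows `r ≠ 0`, and a power of `T`
  -- clears the denominators.
  obtain ⟨r, hr, hr0⟩ := Submodule.exists_sub_one_mem_and_smul_eq_zero_of_fg_of_le_smul
    (Ideal.span {(LaurentPolynomial.T 1 - 1 : ℂ[T;T⁻¹])}) (⊤ : Submodule ℂ[T;T⁻¹] V)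
    ((Submodule.fg_def.2 ⟨s, hs, htop⟩)) (fun v _ ↦ by
      obtain ⟨w, rfl⟩ := hT v
      have h1 := Submodule.smul_mem_smul (Ideal.mem_span_singleton_self
        (LaurentPolynomial.T 1 - 1 : ℂ[T;T⁻¹])) (Submodule.mem_top : w ∈ (⊤ : Submodule ℂ[T;T⁻¹] V))
      rwa [hsmul, map_sub, hρT, map_one, zpow_one] at h1)
  have hr1 : r ≠ 0 := by
    rintro rfl
    obtain ⟨q, hq⟩ := Ideal.mem_span_singleton'.1 hr
    have := congrArg (LaurentPolynomial.eval₂ (RingHom.id ℂ) 1) hq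
    simp at this
  obtain ⟨n, p, hp⟩ := LaurentPolynomial.exists_T_pow r
  refine ⟨p, ?_, ?_⟩
  · rintro rfl
    rw [map_zero] at hp
    exact hr1 ((LaurentPolynomial.isUnit_T (R := ℂ) n).mul_left_eq_zero.1 hp.symm)
  · have h1 : (ρ.comp Polynomial.toLaurentAlg) = aeval (T : Module.End ℂ V) := by
      refine Polynomial.algHom_ext ?_
      rw [AlgHom.comp_apply, Polynomial.toLaurentAlg_apply, Polynomial.toLaurent_X, hρT, zpow_one,
        aeval_X]
    rw [← h1, AlgHom.comp_apply, Polynomial.toLaurentAlg_apply, hp, mul_comm, map_mul]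
    have h2 : ρ r = 0 := LinearMap.ext fun v ↦ hr0 v trivial
    rw [h2, mul_zero]

namespace Metaplectic

/-- A projective representation of `G × G` with cocycle `((a, d), (a', d')) ↦ h(a, d')`. -/
structure TwistedRep {G : Type*} [CommGroup G] (h : G →* G →* ℂˣ) (V : Type*) [AddCommGroup V]
    [Module ℂ V] where
  op : G → G → Module.End ℂ V
  op_one : op 1 1 = 1
  op_mul (a d a' d' : G) : op a d * op a' d' = (h a d' : ℂ) • op (a * a') (d * d')

namespace TwistedRep

variable {G : Type*} [CommGroup G] {h : G →* G →* ℂˣ} {V : Type*} [AddCommGroup V] [Module ℂ V]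
  (R : TwistedRep h V)

/-- Irreducibility of a projective representation. -/
def Irred : Prop :=
  ∀ S : Submodule ℂ V, (∀ a d, ∀ v ∈ S, R.op a d v ∈ S) → S = ⊥ ∨ S = ⊤

variable {R}

theorem op_apply (a d a' d' : G) (v : V) :
    R.op a d (R.op a' d' v) = (h a d' : ℂ) • R.op (a * a') (d * d') v := by
  rw [← Module.End.mul_apply, R.op_mul, LinearMap.smul_apply]

theorem Irred.eq_top (hR : R.Irred) {v : V} (hv : v ≠ 0) {S : Submodule ℂ V}
    (hS : ∀ a d, R.op a d v ∈ S) : S = ⊤ := by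
  have h1 : Submodule.span ℂ (Set.range fun p : G × G ↦ R.op p.1 p.2 v) = ⊤ := by
    refine (hR _ fun a d w hw ↦ ?_).resolve_left fun hbot ↦ hv ?_
    · induction hw using Submodule.span_induction with
      | mem x hx =>
        obtain ⟨p, rfl⟩ := hx
        dsimp only
        rw [op_apply]
        exact Submodule.smul_mem _ _ (Submodule.subset_span ⟨(a * p.1, d * p.2), rfl⟩)
      | zero => rw [map_zero]; exact Submodule.zero_mem _
      | add x y _ _ hx hy => rw [map_add]; exact Submodule.add_mem _ hx hy
      | smul c x _ hx => rw [map_smul]; exact Submodule.smul_mem _ _ hx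
    · have : v ∈ Submodule.span ℂ (Set.range fun p : G × G ↦ R.op p.1 p.2 v) :=
        Submodule.subset_span ⟨(1, 1), by simp [R.op_one]⟩
      rwa [hbot, Submodule.mem_bot] at this
  rw [eq_top_iff, ← h1, Submodule.span_le]
  rintro _ ⟨p, rfl⟩
  exact hS _ _

/-- Schur's lemma in the form that needs no bound on the dimension of `V`: kernel and range of an
intertwiner are invariant. -/
theorem Irred.eq_zero_of_not_isUnit (hR : R.Irred) {φ : Module.End ℂ V}
    (hφ : ∀ a d, Commute φ (R.op a d)) (hu : ¬ IsUnit φ) : φ = 0 := by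
  have hc (a d) (v : V) : φ (R.op a d v) = R.op a d (φ v) := LinearMap.congr_fun (hφ a d) v
  rw [Module.End.isUnit_iff] at hu
  by_contra hne
  refine hu ⟨LinearMap.ker_eq_bot.1 ?_, LinearMap.range_eq_top.1 ?_⟩
  · refine (hR _ fun a d v hv ↦ ?_).resolve_right fun ht ↦ hne (LinearMap.ker_eq_top.1 ht)
    rw [LinearMap.mem_ker] at hv ⊢
    rw [hc, hv, map_zero]
  · refine (hR _ fun a d v hv ↦ ?_).resolve_left fun ht ↦ hne (LinearMap.range_eq_bot.1 ht)
    obtain ⟨w, rfl⟩ := hv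
    exact ⟨R.op a d w, hc a d w⟩

/-- As `p(φ) = 0` factors over `ℂ`, some `φ - c` is not invertible, hence zero by Schur's lemma.
This replaces the existence of eigenvalues, which is not available before `V` is known to be finite
dimensional. -/
theorem Irred.exists_eq_smul_of_aeval_eq_zero [Nontrivial V] (hR : R.Irred) {φ : Module.End ℂ V}
    (hφ : ∀ a d, Commute φ (R.op a d)) {p : ℂ[X]} (hp : p ≠ 0) (hp0 : aeval φ p = 0) :
    ∃ c : ℂ, φ = c • (1 : Module.End ℂ V) := by
  obtain ⟨c, hc, -⟩ := spectrum.exists_mem_of_not_isUnit_aeval_prod (R := ℂ) (a := φ) (p := p) <| by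
    have := hp0
    rw [(IsAlgClosed.splits p).eq_prod_roots, map_mul, aeval_C] at this
    rw [← Algebra.smul_def, smul_eq_zero] at this
    rw [this.resolve_left (by simpa using hp)]
    exact not_isUnit_zero
  refine ⟨c, ?_⟩
  have h1 := hR.eq_zero_of_not_isUnit (φ := algebraMap ℂ _ c - φ)
    (fun a d ↦ Commute.sub_left (Algebra.commutes c (R.op a d)) (hφ a d)) hc
  rw [← sub_eq_zero.1 h1, Algebra.algebraMap_eq_smul_one]

theorem op_mul_op_sq (hsymm : ∀ a b, h a b = h b a) (hsq : ∀ a b, h (a ^ 2) b = 1) (a d x y : G) :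
    R.op a d * R.op (x ^ 2) (y ^ 2) = R.op (a * x ^ 2) (d * y ^ 2) := by
  rw [R.op_mul, hsymm, hsq, Units.val_one, one_smul]

theorem op_sq_commute (hsymm : ∀ a b, h a b = h b a) (hsq : ∀ a b, h (a ^ 2) b = 1) (a d x y : G) :
    Commute (R.op (x ^ 2) (y ^ 2)) (R.op a d) := by
  rw [Commute, SemiconjBy, op_mul_op_sq hsymm hsq, R.op_mul, hsq, Units.val_one, one_smul,
    mul_comm a, mul_comm d]

/-- The homomorphism `x ↦ R(1, x²)`. -/
def sqHom (R : TwistedRep h V) : G →* Module.End ℂ V where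
  toFun x := R.op 1 (x ^ 2)
  map_one' := by rw [one_pow, R.op_one]
  map_mul' x y := by
    rw [R.op_mul, map_one, MonoidHom.one_apply, Units.val_one, one_smul, one_mul, mul_pow]

theorem sqHom_commute (hsymm : ∀ a b, h a b = h b a) (hsq : ∀ a b, h (a ^ 2) b = 1) (a d x : G) :
    Commute (R.sqHom x) (R.op a d) := by
  have := op_sq_commute (R := R) hsymm hsq a d 1 x
  rwa [one_pow] at this

theorem exists_mul_sq (a : G) : ∃ x : G,
    a = (QuotientGroup.mk a : G ⧸ (powMonoidHom 2 : G →* G).range).out * x ^ 2 := by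
  obtain ⟨x, hx⟩ := QuotientGroup.mk_out_eq_mul (powMonoidHom 2 : G →* G).range a
  obtain ⟨y, hy⟩ := x.2
  refine ⟨y⁻¹, ?_⟩
  rw [hx, ← hy]
  simp

/-- The elements with square entries act by scalars. -/
theorem Irred.exists_op_sq_eq_smul [Nontrivial V] (hR : R.Irred)
    [Finite (G ⧸ (powMonoidHom 2 : G →* G).range)]
    (hsymm : ∀ a b, h a b = h b a) (hsq : ∀ a b, h (a ^ 2) b = 1)
    (hz : ∀ x, ∃ c : ℂ, R.op (x ^ 2) (x ^ 2) = c • (1 : Module.End ℂ V))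
    (hfin : ∃ ϖ : G, ∀ x, ∃ n : ℤ, ∃ k > 0, R.sqHom ((x * ϖ ^ n) ^ k) = 1) (x y : G) :
    ∃ c : ℂ, R.op (x ^ 2) (y ^ 2) = c • (1 : Module.End ℂ V) := by
  obtain ⟨ϖ, hϖ⟩ := hfin
  have hcomm := sqHom_commute (R := R) hsymm hsq
  -- The first factor is scalar by `hz`, so only the elements `(1, x²)` remain. By `hfin` these
  -- operators are, up to roots of unity, powers of the one attached to `ϖ`.
  have hprod (x y : G) : R.op (x ^ 2) (y ^ 2) = R.op (x ^ 2) (x ^ 2) * R.sqHom (y / x) := by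
    change _ = _ * R.op 1 ((y / x) ^ 2)
    rw [R.op_mul, hsq, Units.val_one, one_smul, mul_one, ← mul_pow, mul_div_cancel]
  let T : (Module.End ℂ V)ˣ := Units.map R.sqHom (toUnits ϖ)
  have hT (n : ℤ) : ((T ^ n : (Module.End ℂ V)ˣ) : Module.End ℂ V) = R.sqHom (ϖ ^ n) := by
    rw [← map_zpow, ← map_zpow]
    rfl
  -- every operator is a multiple of a power of `T`
  have hpow (x : G) : ∃ (n : ℤ) (c : ℂ), R.sqHom x = c • R.sqHom (ϖ ^ n) := by
    obtain ⟨n, k, hk, h1⟩ := hϖ x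
    obtain ⟨c, hc⟩ := hR.exists_eq_smul_of_aeval_eq_zero (φ := R.sqHom (x * ϖ ^ n))
      (fun a d ↦ hcomm a d _) (p := X ^ k - 1) (X_pow_sub_C_ne_zero hk 1) (by
        rw [map_sub, map_pow, aeval_X, map_one, ← map_pow, h1, sub_self])
    refine ⟨-n, c, ?_⟩
    rw [← mul_inv_cancel_right x (ϖ ^ n), map_mul, hc, smul_mul_assoc, one_mul, _root_.zpow_neg]
  -- Either `T = 1`, or `T - 1` is invertible by Schur's lemma. In the second case the vectors `R(a,
  -- d)v`, for representatives `a, d` of the square classes, generate `V` under the powers of `T`,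
  -- so `T` is algebraic and hence scalar.
  have hTs : ∃ c : ℂ, R.sqHom ϖ = c • (1 : Module.End ℂ V) := by
    by_cases h1 : R.sqHom ϖ - 1 = 0
    · exact ⟨1, by rw [one_smul, sub_eq_zero.1 h1]⟩
    have hu : IsUnit (R.sqHom ϖ - 1) := by
      by_contra hu
      exact h1 (hR.eq_zero_of_not_isUnit
        (fun a d ↦ (hcomm a d ϖ).sub_left (Commute.one_left _)) hu)
    obtain ⟨v, hv⟩ := exists_ne (0 : V)
    obtain ⟨p, hp, hp0⟩ := Module.End.exists_aeval_eq_zero_of_surjective_sub_one T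
      ((Module.End.isUnit_iff _).1 hu).2 (Set.finite_range
        fun q : (G ⧸ (powMonoidHom 2 : G →* G).range) × (G ⧸ (powMonoidHom 2 : G →* G).range) ↦
          R.op q.1.out q.2.out v) (fun S hS ↦ hR.eq_top hv fun a d ↦ by
        obtain ⟨x, hx⟩ := exists_mul_sq a
        obtain ⟨y, hy⟩ := exists_mul_sq d
        obtain ⟨c, hc⟩ := hz x
        obtain ⟨n, c', hc'⟩ := hpow (y / x)
        have h2 := hS _ ⟨(a, d), rfl⟩ n
        rw [hT] at h2
        have h3 : R.op a d v = (c * c') • R.sqHom (ϖ ^ n) (R.op (QuotientGroup.mk a :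
            G ⧸ (powMonoidHom 2 : G →* G).range).out (QuotientGroup.mk d :
            G ⧸ (powMonoidHom 2 : G →* G).range).out v) := by
          conv_lhs => rw [hx, hy, ← op_mul_op_sq hsymm hsq, hprod, hc, hc']
          rw [← Module.End.mul_apply, (hcomm _ _ _).eq]
          simp [smul_smul, mul_comm]
        rw [h3]
        exact S.smul_mem _ h2)
    exact hR.exists_eq_smul_of_aeval_eq_zero (fun a d ↦ hcomm a d ϖ) hp hp0
  obtain ⟨c, hc⟩ := hTs
  obtain ⟨c₁, hc₁⟩ := hz x
  obtain ⟨n, c₂, hc₂⟩ := hpow (y / x)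
  have hTn : ∃ c : ℂ, R.sqHom (ϖ ^ n) = c • (1 : Module.End ℂ V) := by
    have hc' : (T : Module.End ℂ V) = c • (1 : Module.End ℂ V) := hc
    have hc0 : c ≠ 0 := by
      rintro rfl
      rw [zero_smul] at hc'
      exact T.ne_zero hc'
    let u : (Module.End ℂ V)ˣ := Units.map (algebraMap ℂ (Module.End ℂ V)).toMonoidHom (Units.mk0 c hc0)
    have hu : T = u := by
      ext1
      rw [hc', ← Algebra.algebraMap_eq_smul_one]
      rfl
    refine ⟨c ^ n, ?_⟩
    rw [← hT, hu, ← map_zpow, ← Algebra.algebraMap_eq_smul_one]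
    change (algebraMap ℂ (Module.End ℂ V)) ((Units.mk0 c hc0 ^ n : ℂˣ) : ℂ) = _
    simp
  obtain ⟨c₃, hc₃⟩ := hTn
  refine ⟨c₁ * (c₂ * c₃), ?_⟩
  rw [hprod, hc₁, hc₂, hc₃, smul_mul_assoc, one_mul, smul_smul, smul_smul, mul_assoc]

/-- The operators `R(t, t)` commute because `h` is symmetric, and each has a scalar square `b²`. So
either `v` is an eigenvector for `-b`, or `R(t, t)v + bv` is one for `b` and keeps the earlier
eigenvalues. -/
theorem exists_eigenvector_finset [Nontrivial V]
    (hsymm : ∀ a b, h a b = h b a)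
    (hz : ∀ x, ∃ c : ℂ, R.op (x ^ 2) (x ^ 2) = c • (1 : Module.End ℂ V)) (F : Finset G) :
    ∃ v : V, v ≠ 0 ∧ ∀ t ∈ F, ∃ c : ℂ, R.op t t v = c • v := by
  classical
  have hcomm (s t : G) (v : V) : R.op s s (R.op t t v) = R.op t t (R.op s s v) := by
    rw [op_apply, op_apply, hsymm, mul_comm s]
  induction F using Finset.induction_on with
  | empty =>
    obtain ⟨v, hv⟩ := exists_ne (0 : V)
    exact ⟨v, hv, by simp⟩
  | insert t F _ ih =>
    obtain ⟨v, hv, hF⟩ := ih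
    obtain ⟨c, hc⟩ := hz t
    have h2 : ∃ c : ℂ, R.op t t (R.op t t v) = c ^ 2 • v := by
      obtain ⟨b, hb⟩ := IsAlgClosed.exists_pow_nat_eq ((h t t : ℂ) * c) two_pos
      refine ⟨b, ?_⟩
      rw [op_apply, ← sq, hc, hb]
      simp [smul_smul]
    obtain ⟨b, hb⟩ := h2
    by_cases h0 : R.op t t v + b • v = 0
    · refine ⟨v, hv, fun s hs ↦ ?_⟩
      rcases Finset.mem_insert.1 hs with rfl | hs
      · exact ⟨-b, by rw [neg_smul, eq_neg_of_add_eq_zero_left h0]⟩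
      · exact hF s hs
    · refine ⟨_, h0, fun s hs ↦ ?_⟩
      rcases Finset.mem_insert.1 hs with rfl | hs
      · refine ⟨b, ?_⟩
        rw [map_add, hb, map_smul, smul_add, smul_smul, sq, add_comm]
      · obtain ⟨e, he⟩ := hF s hs
        refine ⟨e, ?_⟩
        rw [map_add, hcomm, he, map_smul, map_smul, he, smul_add, smul_comm b]

/-- An irreducible projective representation of `G × G` decomposes under the diagonal with
multiplicity one into the translates of one character by the characters `h(a, ·)`. -/
theorem Irred.exists_basis [Nontrivial V] (hR : R.Irred)
    [Finite (G ⧸ (powMonoidHom 2 : G →* G).range)]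
    (hsymm : ∀ a b, h a b = h b a) (hsq : ∀ a b, h (a ^ 2) b = 1)
    (hnd : ∀ a, h a = 1 → ∃ x, a = x ^ 2)
    (hz : ∀ x, ∃ c : ℂ, R.op (x ^ 2) (x ^ 2) = c • (1 : Module.End ℂ V))
    (hfin : ∃ ϖ : G, ∀ x, ∃ n : ℤ, ∃ k > 0, R.sqHom ((x * ϖ ^ n) ^ k) = 1) :
    ∃ (b : Module.Basis (G ⧸ (powMonoidHom 2 : G →* G).range) ℂ V) (c : G → ℂ),
      (∀ t, c t ≠ 0) ∧ ∀ q t, R.op t t (b q) = ((h q.out t : ℂ) * c t) • b q := by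
  classical
  set Q := G ⧸ (powMonoidHom 2 : G →* G).range
  have : Fintype Q := Fintype.ofFinite Q
  have hscal := hR.exists_op_sq_eq_smul hsymm hsq hz hfin
  obtain ⟨v, hv, hF⟩ := exists_eigenvector_finset (R := R) hsymm hz
    (Finset.univ.image fun q : Q ↦ q.out)
  -- Representatives of the square classes suffice, since elements with square entries act by
  -- scalars.
  have hv' (t : G) : ∃ c : ℂ, R.op t t v = c • v := by
    obtain ⟨x, hx⟩ := exists_mul_sq t
    obtain ⟨c, hc⟩ := hscal x x
    obtain ⟨c', hc'⟩ := hF (QuotientGroup.mk t : Q).out (Finset.mem_image_of_mem _ (Finset.mem_univ _))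
    refine ⟨c * c', ?_⟩
    rw [hx, ← op_mul_op_sq hsymm hsq, hc, mul_smul_comm, mul_one, LinearMap.smul_apply]
    change c • R.op (QuotientGroup.mk t : Q).out (QuotientGroup.mk t : Q).out v = _
    rw [hc', smul_smul]
  choose c hc using hv'
  have hne (a d : G) {w : V} (hw : w ≠ 0) : R.op a d w ≠ 0 := by
    intro h0
    have h1 := op_apply (R := R) a⁻¹ d⁻¹ a d w
    rw [h0, map_zero, inv_mul_cancel, inv_mul_cancel, R.op_one] at h1
    exact hw ((smul_eq_zero.1 h1.symm).resolve_left (Units.ne_zero _))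
  have hc0 (t : G) : c t ≠ 0 := by
    intro h0
    have := hne t t hv
    rw [hc, h0, zero_smul] at this
    exact this rfl
  let b (q : Q) : V := R.op q.out 1 v
  have hb (q : Q) (t : G) : R.op t t (b q) = ((h q.out t : ℂ) * c t) • b q := by
    have h1 : R.op q.out 1 (R.op t t v) = (h q.out t : ℂ) • R.op (q.out * t) (1 * t) v :=
      op_apply _ _ _ _ _
    rw [hc, map_smul] at h1
    change R.op t t (R.op q.out 1 v) = _
    rw [op_apply, map_one, Units.val_one, one_smul, mul_one, mul_comm t]
    rw [one_mul] at h1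
    have h2 : (h q.out t : ℂ) * (h q.out t : ℂ) = 1 := by
      rw [← Units.val_mul, ← MonoidHom.mul_apply, ← map_mul, ← sq, hsq, Units.val_one]
    rw [mul_smul, h1, smul_smul, h2, one_smul]
  -- Up to a scalar, `R(a, d)v` is `R(a/d, 1)v`, because `v` is an eigenvector of `R(d, d)`; and
  -- `a/d` matters only modulo squares.
  have hspan : Submodule.span ℂ (Set.range b) = ⊤ := by
    refine hR.eq_top hv fun a d ↦ ?_
    have h1 : R.op (a / d) 1 (R.op d d v) = (h (a / d) d : ℂ) • R.op a d v := by
      rw [op_apply, div_mul_cancel, one_mul]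
    rw [← inv_smul_eq_iff₀ (Units.ne_zero _), hc] at h1
    rw [← h1, map_smul]
    refine Submodule.smul_mem _ _ (Submodule.smul_mem _ _ ?_)
    obtain ⟨x, hx⟩ := exists_mul_sq (a / d)
    obtain ⟨e, he⟩ := hscal x 1
    have h3 := op_mul_op_sq (R := R) hsymm hsq (QuotientGroup.mk (a / d) : Q).out 1 x 1
    rw [he, one_pow, mul_one, ← hx, mul_smul_comm, mul_one] at h3
    rw [← h3]
    exact Submodule.smul_mem _ _ (Submodule.subset_span ⟨_, rfl⟩)
  have hinj : Function.Injective fun q : Q ↦ (Units.coeHom ℂ).comp (h q.out) := by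
    intro q q' hqq
    have h1 : h (q.out⁻¹ * q'.out) = 1 := by
      rw [map_mul, map_inv, inv_mul_eq_one]
      ext t
      exact DFunLike.congr_fun hqq t
    obtain ⟨x, hx⟩ := hnd _ h1
    rw [← q.out_eq', ← q'.out_eq']
    exact QuotientGroup.eq.2 ⟨x, hx.symm⟩
  have hli : LinearIndependent ℂ b := by
    rw [Fintype.linearIndependent_iff]
    intro g hg q
    have hchar := Fintype.linearIndependent_iff.1
      ((linearIndependent_monoidHom G ℂ).comp _ hinj)
    by_contra hgq
    have hbq : g q • b q ≠ 0 := smul_ne_zero hgq (hne _ _ hv)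
    refine hbq ((Module.forall_dual_apply_eq_zero_iff ℂ _).1 fun ξ ↦ ?_)
    refine hchar (fun q ↦ ξ (g q • b q)) (funext fun t ↦ ?_) q
    -- The eigenvalues `h(q, t) c(t)` are not characters of `t` because of the cocycle. Division by
    -- `c(t)` leaves a linear relation between the distinct characters `h(q, ·)`.
    have h1 := congrArg (fun w ↦ (c t)⁻¹ * ξ (R.op t t w)) hg
    simp only [map_sum, map_smul, map_zero, mul_zero, hb, Finset.mul_sum, smul_eq_mul] at h1
    simp only [Finset.sum_apply, Pi.smul_apply, Function.comp_apply, MonoidHom.coe_comp,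
      Units.coeHom_apply, smul_eq_mul, map_smul, Pi.zero_apply]
    rw [← h1]
    refine Finset.sum_congr rfl fun q _ ↦ ?_
    have := hc0 t
    field_simp
  exact ⟨Module.Basis.mk hli hspan.ge, c, hc0, fun q t ↦ by simpa using hb q t⟩

end TwistedRep

end Metaplectic

end

/-! ### Genuine representations of the cover of the torus, restricted to the cover of the center. -/

noncomputable section

open ValuativeRel Filter Topology

namespace Metaplectic

section Torus

variable {E : Type*} [Field E]

/-- The matrix `diag(a, d)`. -/
def diagGL (a d : Eˣ) : GL (Fin 2) E :=
  ⟨!![(a : E), 0; 0, (d : E)], !![((a⁻¹ : Eˣ) : E), 0; 0, ((d⁻¹ : Eˣ) : E)],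
    by simp [Matrix.one_fin_two], by simp [Matrix.one_fin_two]⟩

theorem coe_diagGL (a d : Eˣ) :
    (diagGL a d : Matrix (Fin 2) (Fin 2) E) = !![(a : E), 0; 0, (d : E)] := rfl

theorem diagGL_mul (a d a' d' : Eˣ) : diagGL a d * diagGL a' d' = diagGL (a * a') (d * d') := by
  ext i j
  fin_cases i <;> fin_cases j <;> simp [coe_diagGL]

theorem scalar_eq_diagGL (t : Eˣ) : Matrix.GeneralLinearGroup.scalar (Fin 2) t = diagGL t t := by
  ext i j
  fin_cases i <;> fin_cases j <;> simp [coe_diagGL]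

theorem diagGL_mem_torus (a d : Eˣ) : diagGL a d ∈ torus E := by
  simp [mem_torus_iff, coe_diagGL]

theorem exists_eq_diagGL {g : GL (Fin 2) E} (hg : g ∈ torus E) : ∃ a d, g = diagGL a d := by
  obtain ⟨h1, h2⟩ := mem_torus_iff.1 hg
  have hd := g.det_ne_zero
  rw [Matrix.det_fin_two, h1, zero_mul, sub_zero] at hd
  refine ⟨Units.mk0 _ (left_ne_zero_of_mul hd), Units.mk0 _ (right_ne_zero_of_mul hd), ?_⟩
  ext i j
  fin_cases i <;> fin_cases j <;> simp [coe_diagGL, h1, h2]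

theorem mem_scalars_iff {g : GL (Fin 2) E} : g ∈ scalars E ↔ ∃ t, g = diagGL t t := by
  constructor
  · rintro ⟨t, rfl⟩
    exact ⟨t, scalar_eq_diagGL t⟩
  · rintro ⟨t, rfl⟩
    exact ⟨t, scalar_eq_diagGL t⟩

theorem diagGL_sq_mem_scalarsSq (t : Eˣ) : diagGL (t ^ 2) (t ^ 2) ∈ scalarsSq E :=
  ⟨t, scalar_eq_diagGL _⟩

theorem cover_scalars_le : cover (scalars E) ≤ cover (torus E) := by
  intro z hz
  obtain ⟨t, ht⟩ := mem_scalars_iff.1 (mem_cover.1 hz)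
  exact mem_cover.2 (ht ▸ diagGL_mem_torus t t)

/-- The lift of `diag(a, d)` to the cover. -/
def dg (a d : Eˣ) : cover (torus E) := ⟨⟨diagGL a d, 1⟩, diagGL_mem_torus a d⟩

/-- The lift of a scalar matrix to the cover. -/
def scalarLift (t : Eˣ) : cover (scalars E) :=
  ⟨⟨diagGL t t, 1⟩, mem_scalars_iff.2 ⟨t, rfl⟩⟩

/-- The central subgroup of order two, in the inverse image of a subgroup. -/
def muCover (H : Subgroup (GL (Fin 2) E)) (ε : ℤˣ) : cover H := ⟨muElt ε, muElt_mem_cover H ε⟩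

theorem mul_muElt (x : Mp E) (ε : ℤˣ) : x * muElt ε = ⟨x.gl, x.sign * ε⟩ := by
  rw [mul_def]
  simp [muElt, cocycle_one_right]

theorem exists_eq_dg_mul (x : cover (torus E)) :
    ∃ a d ε, x = dg a d * muCover (torus E) ε := by
  obtain ⟨a, d, h⟩ := exists_eq_diagGL (mem_cover.1 x.2)
  refine ⟨a, d, (x : Mp E).sign, Subtype.ext ?_⟩
  change (x : Mp E) = ⟨diagGL a d, 1⟩ * muElt _
  rw [mul_muElt, one_mul, ← h]

theorem exists_eq_scalarLift_mul (z : cover (scalars E)) :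
    ∃ t ε, z = scalarLift t * muCover (scalars E) ε := by
  obtain ⟨t, h⟩ := mem_scalars_iff.1 (mem_cover.1 z.2)
  refine ⟨t, (z : Mp E).sign, Subtype.ext ?_⟩
  change (z : Mp E) = ⟨diagGL t t, 1⟩ * muElt _
  rw [mul_muElt, one_mul, ← h]

variable [CharZero E] [ValuativeRel E] [TopologicalSpace E] [IsNonarchimedeanLocalField E]

theorem cocycle_diagGL (a d a' d' : Eˣ) :
    cocycle (diagGL a d) (diagGL a' d') = hilbertSymbol (a : E) d' := by
  apply signToZMod_injective
  have hp (a d : Eˣ) : slPart (diagGL a d : Matrix (Fin 2) (Fin 2) E) =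
      !![(a : E), 0; 0, ((a⁻¹ : Eˣ) : E)] := by
    rw [slPart_eq, coe_diagGL]
    simp [Matrix.det_fin_two]
    field_simp
  have hx (a b : E) : kubotaX !![a, 0; 0, b] = b := kubotaX_of_eq (by simp)
  have hdet : (diagGL a' d' : Matrix (Fin 2) (Fin 2) E).det = (a' * d' : Eˣ) := by
    simp [coe_diagGL, Matrix.det_fin_two]
  have hc : conjBy ((a' * d' : Eˣ) : E) !![(a : E), 0; 0, ((a⁻¹ : Eˣ) : E)] =
      !![(a : E), 0; 0, ((a⁻¹ : Eˣ) : E)] := by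
    rw [conjBy_eq]
    ext i j
    fin_cases i <;> fin_cases j <;> simp
    field_simp
  rw [cocycle, hp, hp, hdet, hc, signToZMod_mul,
    signToZMod_cocycleSL (x := a⁻¹) (y := a'⁻¹) (z := a⁻¹ * a'⁻¹) (hx _ _) (hx _ _)
      (by rw [Matrix.mul_fin_two]; simp [hx]), kubotaV_of_eq _ (by simp)]
  change _ + addSymbol (a' * d') a⁻¹ = addSymbol a d'
  simp only [addCocycle_eq, addSymbol_mul_left, addSymbol_mul_right, addSymbol_self,
    addSymbol_inv_left, addSymbol_inv_right]
  grind [addSymbol_comm]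

theorem dg_mul (a d a' d' : Eˣ) :
    dg a d * dg a' d' = dg (a * a') (d * d') * muCover (torus E) (hilbertSymbol (a : E) d') := by
  apply Subtype.ext
  change (⟨diagGL a d, 1⟩ * ⟨diagGL a' d', 1⟩ : Mp E) = ⟨diagGL _ _, 1⟩ * muElt _
  rw [mul_muElt, mul_def, cocycle_diagGL, diagGL_mul, one_mul]

theorem scalarLift_mul (s t : Eˣ) :
    scalarLift s * scalarLift t =
      scalarLift (s * t) * muCover (scalars E) (hilbertSymbol (s : E) t) := by
  apply Subtype.ext
  change (⟨diagGL s s, 1⟩ * ⟨diagGL t t, 1⟩ : Mp E) = ⟨diagGL _ _, 1⟩ * muElt _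
  rw [mul_muElt, mul_def, cocycle_diagGL, diagGL_mul, one_mul]

variable (E) in
/-- The Hilbert symbol as a bimultiplicative map. -/
def symbolHom : Eˣ →* Eˣ →* ℂˣ :=
  MonoidHom.mk' (fun a ↦ MonoidHom.mk'
    (fun b ↦ Units.map (Int.castRingHom ℂ).toMonoidHom (hilbertSymbol (a : E) b))
    fun b c ↦ by rw [Units.val_mul, hilbertSymbol_mul_right _ b.ne_zero c.ne_zero, map_mul])
    fun a b ↦ by
      ext c
      simp [hilbertSymbol_mul_left _ a.ne_zero b.ne_zero]

theorem symbolHom_apply (a b : Eˣ) :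
    symbolHom E a b = Units.map (Int.castRingHom ℂ).toMonoidHom (hilbertSymbol (a : E) b) := rfl

theorem coe_symbolHom (a b : Eˣ) :
    (symbolHom E a b : ℂ) = ((hilbertSymbol (a : E) b : ℤ) : ℂ) := rfl

theorem symbolHom_comm (a b : Eˣ) : symbolHom E a b = symbolHom E b a := by
  rw [symbolHom_apply, hilbertSymbol_comm, symbolHom_apply]

theorem symbolHom_sq (a b : Eˣ) : symbolHom E (a ^ 2) b = 1 := by
  rw [symbolHom_apply, Units.val_pow_eq_pow_val, hilbertSymbol_sq_left _ a.ne_zero, map_one]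

theorem exists_eq_sq_of_symbolHom_eq_one (a : Eˣ) (ha : symbolHom E a = 1) : ∃ x, a = x ^ 2 := by
  by_contra! hcon
  obtain ⟨b, hb, h⟩ := exists_hilbertSymbol_eq_neg_one (a := (a : E)) fun x hx ↦ by
    have hx0 : x ≠ 0 := by
      rintro rfl
      exact a.ne_zero (by rw [← hx]; simp)
    exact hcon (Units.mk0 x hx0) (by ext; simp [hx])
  have h1 : (symbolHom E a (Units.mk0 b hb) : ℂ) = 1 := by rw [ha]; rfl
  rw [coe_symbolHom, Units.val_mk0, h] at h1
  norm_num at h1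

variable {V : Type*} [AddCommGroup V] [Module ℂ V]

/-- A genuine representation of the cover of the torus as a projective representation. -/
def torusRep (τ : cover (torus E) →* Module.End ℂ V) (hτ : IsGenuine τ) :
    TwistedRep (symbolHom E) V where
  op a d := τ (dg a d)
  op_one := by
    have : dg (E := E) 1 1 = 1 := Subtype.ext <| by
      change (⟨diagGL 1 1, 1⟩ : Mp E) = ⟨1, 1⟩
      congr 1
      ext i j
      fin_cases i <;> fin_cases j <;> simp [coe_diagGL]
    rw [this, map_one]
  op_mul a d a' d' := by
    rw [← map_mul, dg_mul, map_mul]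
    ext v
    rw [Module.End.mul_apply]
    change τ _ (τ ⟨muElt _, muElt_mem_cover _ _⟩ v) = _
    rw [hτ, map_smul]
    rfl

variable {τ : cover (torus E) →* Module.End ℂ V}

theorem torusRep_op (hτ : IsGenuine τ) (a d : Eˣ) : (torusRep τ hτ).op a d = τ (dg a d) := rfl

omit [CharZero E] [ValuativeRel E] [TopologicalSpace E] [IsNonarchimedeanLocalField E] in
theorem apply_mul_muCover (hτ : IsGenuine τ) (x : cover (torus E)) (ε : ℤˣ) (v : V) :
    τ (x * muCover (torus E) ε) v = ((ε : ℤ) : ℂ) • τ x v := by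
  rw [map_mul, Module.End.mul_apply]
  change τ _ (τ ⟨muElt _, muElt_mem_cover _ _⟩ v) = _
  rw [hτ, map_smul]

theorem torusRep_irred (hτ : IsGenuine τ) (hirr : IsIrred τ) : (torusRep τ hτ).Irred := by
  refine fun S hS ↦ hirr.2 S fun x v hv ↦ ?_
  obtain ⟨a, d, ε, rfl⟩ := exists_eq_dg_mul x
  rw [apply_mul_muCover hτ]
  exact S.smul_mem _ (hS a d v hv)

omit [CharZero E] in
-- By compactness of the ring of integers two powers `u^i`, `u^j` are arbitrarily close, and `u^i`
-- has valuation `1`.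
theorem exists_pow_sub_one_lt {u : E} (hu : valuation E u = 1) {γ : ValueGroupWithZero E}
    (hγ : γ ≠ 0) : ∃ k > 0, valuation E (u ^ k - 1) < γ := by
  obtain ⟨x, -, hx⟩ := (IsNonarchimedeanLocalField.isCompact_closedBall E 1).exists_mapClusterPt
    (f := atTop) (u := fun n : ℕ ↦ u ^ n)
    (le_principal_iff.2 (mem_map.2 (Eventually.of_forall fun n ↦ by simp [hu])))
  have hfreq := mapClusterPt_iff_frequently.1 hx _
    ((IsValuativeTopology.hasBasis_nhds' x).mem_of_mem hγ)
  obtain ⟨i, hi⟩ := hfreq.exists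
  obtain ⟨j, hj, hj'⟩ := (frequently_atTop.1 hfreq) (i + 1)
  refine ⟨j - i, by omega, ?_⟩
  have h1 : valuation E (u ^ j - u ^ i) < γ := by
    rw [← sub_sub_sub_cancel_right _ _ x]
    exact Valuation.map_sub_lt _ hj' hi
  have h2 : u ^ j - u ^ i = u ^ i * (u ^ (j - i) - 1) := by
    rw [mul_sub, ← pow_add, mul_one]
    congr 2
    omega
  rwa [h2, map_mul, map_pow, hu, one_pow, one_mul] at h1

/-- For `x` near `1` the lift of `diag(1, x²)` is the square of `σ(diag(1, x))`, which fixes a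
chosen nonzero vector by smoothness; Schur's lemma makes the operator the identity. With `ϖ` a
uniformizer, every `x` is a unit up to a power of `ϖ`, and some power of a unit is near `1`. -/
theorem exists_sqHom_eq_one (hτ : IsGenuine τ) (hirr : IsIrred τ) (hsm : IsSmoothRep τ) :
    ∃ ϖ : Eˣ, ∀ x, ∃ n : ℤ, ∃ k > 0, (torusRep τ hτ).sqHom ((x * ϖ ^ n) ^ k) = 1 := by
  have := hirr.1
  obtain ⟨σ, hσ⟩ := exists_isLocalSection hsm hτ
  obtain ⟨v, hv⟩ := exists_ne (0 : V)
  have hc : Tendsto (fun x : Eˣ ↦ diagGL 1 x) (𝓝 1) (𝓝 1) := by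
    have : Continuous fun x : Eˣ ↦ diagGL 1 x := by
      rw [Units.continuous_iff]
      constructor <;> refine continuous_matrix fun i j ↦ ?_
      · fin_cases i <;> fin_cases j <;> simp [coe_diagGL] <;> fun_prop
      · change Continuous fun x : Eˣ ↦ !![(((1 : Eˣ)⁻¹ : Eˣ) : E), 0; 0, ((x⁻¹ : Eˣ) : E)] i j
        fin_cases i <;> fin_cases j
        exacts [continuous_const, continuous_const, continuous_const, Units.continuous_coe_inv]
    refine this.tendsto' _ _ ?_
    ext i j
    fin_cases i <;> fin_cases j <;> simp [coe_diagGL]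
  have hev : ∀ᶠ x : Eˣ in 𝓝 1, (torusRep τ hτ).sqHom x = 1 := by
    filter_upwards [hc.eventually (hσ.eventually_fixed hsm v)] with x hx
    have h1 := hx (diagGL_mem_torus 1 x)
    set y : cover (torus E) := ⟨σ (diagGL 1 x), mem_cover.2 ((hσ.gl _).symm ▸ diagGL_mem_torus 1 x)⟩
    have h2 : dg 1 (x ^ 2) = y * y := by
      have h3 := dg_mul 1 x 1 x
      rw [Units.val_one, hilbertSymbol_one_left, one_mul, ← sq x] at h3
      have h4 : muCover (torus E) 1 = 1 := rfl
      rw [h4, mul_one] at h3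
      rw [← h3]
      exact Subtype.ext (mul_self_eq_of_gl_eq (x := (dg 1 x : Mp E)) (y := (y : Mp E))
        (hσ.gl _).symm)
    have h3 : (torusRep τ hτ).sqHom x v = v := by
      change τ (dg 1 (x ^ 2)) v = v
      rw [h2, map_mul, Module.End.mul_apply, h1, h1]
    rw [← sub_eq_zero]
    refine (torusRep_irred hτ hirr).eq_zero_of_not_isUnit (fun a d ↦
      (TwistedRep.sqHom_commute symbolHom_comm symbolHom_sq a d x).sub_left (Commute.one_left _))
      fun hu ↦ hv (((Module.End.isUnit_iff _).1 hu).1 ?_)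
    rw [map_zero, LinearMap.sub_apply, h3, Module.End.one_apply, sub_self]
  rw [Units.isEmbedding_val₀.nhds_eq_comap, Filter.eventually_comap] at hev
  obtain ⟨γ, hγ, hball⟩ := (IsValuativeTopology.hasBasis_nhds' ((1 : Eˣ) : E)).mem_iff.1 hev
  obtain ⟨p, hp⟩ := IsDiscreteValuationRing.exists_irreducible 𝒪[E]
  have hp0 : algebraMap 𝒪[E] E p ≠ 0 := by simpa using hp.ne_zero
  refine ⟨Units.mk0 _ hp0, fun x ↦ ?_⟩
  obtain ⟨n, u, hu⟩ := IsDiscreteValuationRing.exists_zpow_mul_isUnit (E := E) hp x.ne_zero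
  have hu1 : valuation E (algebraMap 𝒪[E] E u) = 1 :=
    (Valuation.Integers.isUnit_iff_valuation_eq_one
      (Valuation.integer.integers (valuation E))).1 u.isUnit
  obtain ⟨k, hk, hlt⟩ := exists_pow_sub_one_lt hu1 hγ
  refine ⟨-n, k, hk, hball (by rwa [Units.val_one]) _ ?_⟩
  rw [Units.val_pow_eq_pow_val, Units.val_mul, Units.val_zpow_eq_zpow_val, Units.val_mk0, hu,
    mul_right_comm, ← zpow_add₀ hp0, add_neg_cancel, zpow_zero, one_mul]

/-- The eigenbasis indexed by `Eˣ/Eˣ²` gives distinct elements of `Ω(ω)`, by nondegeneracy.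
Conversely the quotient of two elements of `Ω(ω)` is a character of `Eˣ/Eˣ²`, so there are no more
of them than square classes. -/
theorem exists_basis_omega (hgen : IsGenuine τ) (hirr : IsIrred τ) (hsm : IsSmoothRep τ)
    {ω : cover (scalarsSq E) →* ℂˣ}
    (hω : ∀ (z : cover (scalarsSq E)) (v : V),
      τ ⟨z, cover_scalars_le (cover_scalarsSq_le z.2)⟩ v = (ω z : ℂ) • v) :
    Nat.card (Omega ω) = (powMonoidHom 2 : Eˣ →* Eˣ).range.index ∧
    ∃ b : Module.Basis (Omega ω) ℂ V, ∀ (μ : Omega ω) (z : cover (scalars E)),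
      τ ⟨z, cover_scalars_le z.2⟩ (b μ) = (μ.1 z : ℂ) • b μ := by
  have := hirr.1
  set Q := Eˣ ⧸ (powMonoidHom 2 : Eˣ →* Eˣ).range
  have hindex : Nat.card Q = (powMonoidHom 2 : Eˣ →* Eˣ).range.index := rfl
  have hQ : Finite Q := Nat.finite_of_card_ne_zero (index_sq_units_ne_zero E)
  obtain ⟨b, c, hc0, hb⟩ := (torusRep_irred hgen hirr).exists_basis symbolHom_comm symbolHom_sq
    exists_eq_sq_of_symbolHom_eq_one
    (fun x ↦ by
      let z : cover (scalarsSq E) := ⟨dg (x ^ 2) (x ^ 2), diagGL_sq_mem_scalarsSq x⟩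
      exact ⟨ω z, LinearMap.ext fun v ↦ hω z v⟩)
    (exists_sqHom_eq_one hgen hirr hsm)
  -- the action of the cover of the center as a representation
  let ρ : cover (scalars E) →* Module.End ℂ V := τ.comp (Submonoid.inclusion cover_scalars_le)
  have hρ (t : Eˣ) (ε : ℤˣ) (q : Q) : ρ (scalarLift t * muCover (scalars E) ε) (b q) =
      (((ε : ℤ) : ℂ) * ((symbolHom E q.out t : ℂ) * c t)) • b q := by
    rw [mul_smul, ← hb, torusRep_op, ← apply_mul_muCover hgen]
    rfl
  have hex (q : Q) (z : cover (scalars E)) : ∃ a : ℂˣ, ρ z (b q) = (a : ℂ) • b q := by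
    obtain ⟨t, ε, rfl⟩ := exists_eq_scalarLift_mul z
    refine ⟨Units.mk0 _ ?_, hρ t ε q⟩
    exact mul_ne_zero (by exact_mod_cast ε.ne_zero) (mul_ne_zero (Units.ne_zero _) (hc0 t))
  choose f hf using hex
  have hfeq {q : Q} {z : cover (scalars E)} {a : ℂˣ} (h : ρ z (b q) = (a : ℂ) • b q) :
      f q z = a := Units.ext (smul_left_injective ℂ (b.ne_zero q) ((hf q z).symm.trans h))
  let F (q : Q) : cover (scalars E) →* ℂˣ :=
    { toFun := f q
      map_one' := hfeq (by simp)
      map_mul' := fun z w ↦ hfeq (by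
        rw [map_mul, Module.End.mul_apply, hf, map_smul, hf, smul_smul, Units.val_mul, mul_comm]) }
  let g (q : Q) : Omega ω := ⟨F q, MonoidHom.ext fun z ↦ hfeq (hω z (b q))⟩
  have hg : Function.Injective g := by
    intro q q' hqq
    have h1 (t : Eˣ) : symbolHom E q.out t = symbolHom E q'.out t := by
      have h2 : f q (scalarLift t * muCover _ 1) = f q' (scalarLift t * muCover _ 1) :=
        DFunLike.congr_fun (congrArg Subtype.val hqq) _
      have h3 := (hf q (scalarLift t * muCover _ 1)).symm.trans (hρ t 1 q)
      have h4 := (hf q' (scalarLift t * muCover _ 1)).symm.trans (hρ t 1 q')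
      have h5 := smul_left_injective ℂ (b.ne_zero q) h3
      have h6 := smul_left_injective ℂ (b.ne_zero q') h4
      rw [h2, h6] at h5
      simpa [hc0 t, Units.ext_iff] using h5.symm
    obtain ⟨x, hx⟩ := exists_eq_sq_of_symbolHom_eq_one (q.out⁻¹ * q'.out) (by
      rw [map_mul, map_inv, inv_mul_eq_one]
      exact MonoidHom.ext h1)
    rw [← q.out_eq', ← q'.out_eq']
    exact QuotientGroup.eq.2 ⟨x, hx.symm⟩
  let μ₀ : Omega ω := g 1
  have hagree (μ : Omega ω) (z : cover (scalarsSq E)) :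
      μ.1 ⟨z, cover_scalarsSq_le z.2⟩ = ω z := DFunLike.congr_fun μ.2 z
  have hmu (μ : Omega ω) (ε : ℤˣ) : μ.1 (muCover _ ε) = ω (muCover _ ε) := hagree μ (muCover _ ε)
  let χ (μ : Omega ω) : Eˣ →* ℂˣ := MonoidHom.mk'
    (fun t ↦ μ.1 (scalarLift t) / μ₀.1 (scalarLift t)) fun s t ↦ by
      have h1 (μ : Omega ω) := congrArg μ.1 (scalarLift_mul s t)
      simp only [map_mul, hmu] at h1
      rw [div_mul_div_comm, h1, h1, mul_div_mul_right_eq_div]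
  have hχ (μ : Omega ω) : ∀ x ∈ (powMonoidHom 2 : Eˣ →* Eˣ).range, χ μ x = 1 := by
    rintro _ ⟨x, rfl⟩
    have h1 (μ : Omega ω) := hagree μ ⟨scalarLift (x ^ 2), diagGL_sq_mem_scalarsSq x⟩
    exact div_eq_one.2 ((h1 μ).trans (h1 μ₀).symm)
  have hinj : Function.Injective fun μ ↦ QuotientGroup.lift _ (χ μ) (hχ μ) := by
    intro μ μ' h
    refine Subtype.ext (MonoidHom.ext fun z ↦ ?_)
    obtain ⟨t, ε, rfl⟩ := exists_eq_scalarLift_mul z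
    rw [map_mul, map_mul, hmu, hmu]
    congr 1
    exact div_left_injective (DFunLike.congr_fun h (QuotientGroup.mk t))
  have hexp (H : Type _) [CommGroup H] [Finite H] : NeZero (Monoid.exponent H) :=
    ⟨Monoid.exponent_ne_zero_of_finite⟩
  have := hexp Q
  have hdual := CommGroup.card_monoidHom_of_hasEnoughRootsOfUnity Q ℂ
  have : Finite (Q →* ℂˣ) := Nat.finite_of_card_ne_zero (by
    rw [hdual]
    exact Nat.card_pos.ne')
  have hle : Nat.card (Omega ω) ≤ Nat.card Q := by
    rw [← hdual]
    exact Nat.card_le_card_of_injective _ hinj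
  have hfin : Finite (Omega ω) := Finite.of_injective _ hinj
  have hbij : Function.Bijective g := hg.bijective_of_nat_card_le hle
  refine ⟨by rw [← hindex, Nat.card_congr (Equiv.ofBijective g hbij)],
    b.reindex (Equiv.ofBijective g hbij), fun μ z ↦ ?_⟩
  obtain ⟨q, rfl⟩ := hbij.2 μ
  have : (b.reindex (Equiv.ofBijective g hbij)) (g q) = b q := by
    rw [Module.Basis.reindex_apply]
    congr 1
    exact (Equiv.ofBijective g hbij).symm_apply_apply q
  rw [this]
  exact hf q z

end Torus

end Metaplectic

end

/-! ### Whittaker functionals and the twisted Jacquet module. -/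

noncomputable section

open ValuativeRel Filter Topology MeasureTheory

namespace Metaplectic

section LocallyConstant

variable {E : Type*} [Field E] [ValuativeRel E] [TopologicalSpace E] [IsNonarchimedeanLocalField E]

/-- A locally constant function with compact support is periodic under an open subgroup. -/
theorem exists_nhds_forall_add_eq {X : Type*} [Zero X] {Φ : E → X} (hΦ : IsLocallyConstant Φ)
    (hΦ' : HasCompactSupport Φ) : ∀ᶠ t in 𝓝 (0 : E), ∀ n, Φ (n + t) = Φ n := by
  have h1 : ∀ᶠ t in 𝓝 (0 : E), ∀ n ∈ tsupport Φ, Φ (n + t) = Φ n := by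
    refine hΦ'.isCompact.eventually_forall_of_forall_eventually fun n _ ↦ ?_
    have ha : Tendsto (fun z : E × E ↦ z.2 + z.1) (𝓝 (0, n)) (𝓝 n) :=
      Continuous.tendsto' (by fun_prop) _ _ (by simp)
    have hb : Tendsto (fun z : E × E ↦ z.2) (𝓝 (0, n)) (𝓝 n) := continuous_snd.tendsto' _ _ rfl
    have hc := (IsLocallyConstant.iff_eventually_eq _).1 hΦ n
    filter_upwards [ha.eventually hc, hb.eventually hc] with z h1 h2
    rw [h1, h2]
  have h2 : Tendsto (fun t : E ↦ -t) (𝓝 0) (𝓝 0) := continuous_neg.tendsto' _ _ neg_zero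
  filter_upwards [h1, h2.eventually h1] with t h3 h4 n
  by_cases hn : n ∈ tsupport Φ
  · exact h3 n hn
  by_cases hnt : n + t ∈ tsupport Φ
  · have := h4 _ hnt
    rwa [add_neg_cancel_right, eq_comm] at this
  · rw [image_eq_zero_of_notMem_tsupport hn, image_eq_zero_of_notMem_tsupport hnt]

theorem isLocallyConstant_indicator {I : AddSubgroup E} (hI : IsOpen (I : Set E)) {X : Type*}
    [Zero X] (x : X) : IsLocallyConstant ((I : Set E).indicator fun _ ↦ x) := by
  classical
  refine (IsLocallyConstant.iff_eventually_eq _).2 fun n ↦ ?_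
  by_cases hn : n ∈ I
  · filter_upwards [hI.mem_nhds hn] with m hm
    rw [Set.indicator_of_mem hm, Set.indicator_of_mem (show n ∈ (I : Set E) from hn)]
  · filter_upwards [(I.isClosed_of_isOpen hI).isOpen_compl.mem_nhds hn] with m hm
    rw [Set.indicator_of_notMem hm, Set.indicator_of_notMem (show n ∉ (I : Set E) from hn)]

theorem hasCompactSupport_indicator {I : AddSubgroup E} (hI : IsCompact (I : Set E)) {X : Type*}
    [Zero X] (x : X) : HasCompactSupport ((I : Set E).indicator fun _ ↦ x) :=
  HasCompactSupport.intro hI fun _ h ↦ Set.indicator_of_notMem h _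

/-- The Fourier transform of the indicator function of a small compact open subgroup does not
vanish at `ψ`. -/
theorem exists_openAddSubgroup_integral_ne_zero [MeasurableSpace E] [BorelSpace E]
    {ψ : AddChar E Circle} (hψ : Continuous ψ) {s : Set E} (hs : s ∈ 𝓝 0) :
    ∃ I : AddSubgroup E, IsOpen (I : Set E) ∧ IsCompact (I : Set E) ∧ (I : Set E) ⊆ s ∧
      ∫ n, (ψ (-n) : ℂ) * (I : Set E).indicator (fun _ ↦ 1) n ∂(Measure.addHaar : Measure E) ≠ 0 := by
  have hc : Continuous fun n : E ↦ (ψ (-n) : ℂ) :=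
    (continuous_subtype_val : Continuous fun z : Circle ↦ (z : ℂ)).comp (hψ.comp continuous_neg)
  -- On a small subgroup `ψ` takes values with positive real part, so the integral cannot cancel.
  have hre : ∀ᶠ n in 𝓝 (0 : E), 0 < (ψ (-n) : ℂ).re := by
    have h1 : Tendsto (fun n : E ↦ (ψ (-n) : ℂ).re) (𝓝 0) (𝓝 1) :=
      (Complex.continuous_re.comp hc).tendsto' _ _ (by simp)
    exact h1.eventually (lt_mem_nhds one_pos)
  obtain ⟨I, hI, hIc, -, hIs⟩ := exists_openAddSubgroup_subset (Filter.inter_mem hs hre)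
  refine ⟨I, hI, hIc, fun x hx ↦ (hIs hx).1, fun h0 ↦ ?_⟩
  set φ : E → ℂ := fun n ↦ (ψ (-n) : ℂ) * (I : Set E).indicator (fun _ ↦ 1) n
  have hφ : Continuous φ := hc.mul (isLocallyConstant_indicator hI (1 : ℂ)).continuous
  have hφ' : HasCompactSupport φ := (hasCompactSupport_indicator hIc (1 : ℂ)).mul_left
  have hint : Integrable φ Measure.addHaar := hφ.integrable_of_hasCompactSupport hφ'
  have h1 : ∫ n, (φ n).re ∂(Measure.addHaar : Measure E) = 0 := by
    have := integral_re hint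
    simp only [RCLike.re_eq_complex_re] at this
    rw [this, h0, Complex.zero_re]
  have h2 : 0 < ∫ n, (φ n).re ∂(Measure.addHaar : Measure E) := by
    refine (Complex.continuous_re.comp hφ).integral_pos_of_hasCompactSupport_nonneg_nonzero
      (hφ'.comp_left Complex.zero_re) (fun n ↦ ?_) (x := 0) ?_
    · by_cases hn : n ∈ (I : Set E)
      · simpa [φ, hn] using (hIs hn).2.le
      · simp [φ, hn]
    · simp [φ, I.zero_mem]
  exact h2.ne' h1

end LocallyConstant

section Whittaker

variable {E : Type*} [Field E] [CharZero E] [ValuativeRel E] [TopologicalSpace E]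
  [IsNonarchimedeanLocalField E]

theorem cocycle_weylGL_diagGL (t : Eˣ) : cocycle (weylGL E) (diagGL t t) =
    cocycle (diagGL t t) (weylGL E) := by
  have hw : ((weylGL E : GL (Fin 2) E) : Matrix (Fin 2) (Fin 2) E) = !![0, 1; -1, 0] := rfl
  have hwd : (!![0, 1; -1, 0] : Matrix (Fin 2) (Fin 2) E).det = 1 := by simp [Matrix.det_fin_two]
  have hwp : slPart (!![0, 1; -1, 0] : Matrix (Fin 2) (Fin 2) E) = !![0, 1; -1, 0] := by
    rw [slPart_eq, hwd]; simp
  have hzd : (!![(t : E), 0; 0, (t : E)] : Matrix (Fin 2) (Fin 2) E).det = (t : E) * t := by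
    simp [Matrix.det_fin_two]
  have hzp : slPart (!![(t : E), 0; 0, (t : E)] : Matrix (Fin 2) (Fin 2) E) =
      !![(t : E), 0; 0, ((t⁻¹ : Eˣ) : E)] := by
    rw [slPart_eq, hzd]; simp
  have hc1 (g : Matrix (Fin 2) (Fin 2) E) : conjBy 1 g = g := by
    rw [conjBy_eq]; ext i j; fin_cases i <;> fin_cases j <;> simp
  have hcw : conjBy ((t : E) * t) (!![0, 1; -1, 0] : Matrix (Fin 2) (Fin 2) E) =
      !![0, (t : E) * t; ((-(t⁻¹ * t⁻¹) : Eˣ) : E), 0] := by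
    rw [conjBy_eq]; simp
  have hx1 : kubotaX (!![0, (t : E) * t; ((-(t⁻¹ * t⁻¹) : Eˣ) : E), 0]) =
      ((-(t⁻¹ * t⁻¹) : Eˣ) : E) := by
    rw [kubotaX_of_ne] <;> simp
  have hx2 : kubotaX !![(t : E), 0; 0, ((t⁻¹ : Eˣ) : E)] = ((t⁻¹ : Eˣ) : E) := kubotaX_of_eq rfl
  have hx3 : kubotaX (!![0, (t : E) * t; ((-(t⁻¹ * t⁻¹) : Eˣ) : E), 0] *
      !![(t : E), 0; 0, ((t⁻¹ : Eˣ) : E)]) = ((-t⁻¹ : Eˣ) : E) := by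
    rw [Matrix.mul_fin_two, kubotaX_of_ne] <;> simp
  have hx4 : kubotaX (!![0, 1; -1, 0] : Matrix (Fin 2) (Fin 2) E) = ((-1 : Eˣ) : E) := by
    rw [kubotaX_of_ne] <;> simp
  have hx5 : kubotaX (!![(t : E), 0; 0, ((t⁻¹ : Eˣ) : E)] *
      (!![0, 1; -1, 0] : Matrix (Fin 2) (Fin 2) E)) = ((-t⁻¹ : Eˣ) : E) := by
    rw [Matrix.mul_fin_two, kubotaX_of_ne] <;> simp
  have hv1 (y : E) : kubotaV y (!![0, 1; -1, 0] : Matrix (Fin 2) (Fin 2) E) = 1 :=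
    kubotaV_of_ne _ (by simp)
  have hv2 : kubotaV 1 !![(t : E), 0; 0, ((t⁻¹ : Eˣ) : E)] = 1 := by
    rw [kubotaV_of_eq _ rfl, hilbertSymbol_one_left]
  apply signToZMod_injective
  rw [cocycle, cocycle, coe_diagGL, hw, hwd, hwp, hzd, hzp, hc1, hcw, hv2, mul_one,
    kubotaV_of_ne _ (by simp), mul_one, signToZMod_cocycleSL hx1 hx2 hx3,
    signToZMod_cocycleSL hx2 hx4 hx5]
  simp only [addCocycle_eq, addSymbol_mul_left, addSymbol_mul_right,
    addSymbol_neg_left (_ * _), addSymbol_neg_right _ t⁻¹, addSymbol_self, addSymbol_inv_left, addSymbol_inv_right]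
  grind [addSymbol_comm]

/-- Although `Z̃` is not central in the cover, it commutes with `w`; hence it acts on the function
`n ↦ f(wn)` pointwise through `τ`. -/
theorem weyl_mul_comm (z : cover (scalars E)) : weyl * (z : Mp E) = (z : Mp E) * weyl := by
  obtain ⟨t, ε, rfl⟩ := exists_eq_scalarLift_mul z
  have hz : ((scalarLift t * muCover (scalars E) ε : cover (scalars E)) : Mp E) =
      ⟨diagGL t t, ε⟩ := by
    change ⟨diagGL t t, 1⟩ * muElt ε = _
    rw [mul_muElt, one_mul]
  rw [hz]
  change (⟨weylGL E * diagGL t t, _⟩ : Mp E) = ⟨diagGL t t * weylGL E, _⟩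
  congr 1
  · ext i j
    fin_cases i <;> fin_cases j <;> simp [weylGL, coe_diagGL]
  · change 1 * ε * cocycle (weylGL E) (diagGL t t) = ε * 1 * cocycle (diagGL t t) (weylGL E)
    rw [cocycle_weylGL_diagGL, one_mul, mul_one]

variable {V : Type*} [AddCommGroup V] [Module ℂ V] {τ : cover (torus E) →* Module.End ℂ V}
  {W : Type*} [AddCommGroup W] [Module ℂ W] {π : Mp E →* Module.End ℂ W}

/-- The restriction to `w N` of the function corresponding to a vector of a principal series. -/
def restrict (e : W ≃ₗ[ℂ] inducedSpace τ) : W →ₗ[ℂ] E → V where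
  toFun w n := (e w : Mp E → V) (weyl * unip n)
  map_add' _ _ := by rw [map_add]; rfl
  map_smul' _ _ := by rw [map_smul]; rfl

/-- The value at `1` of the function corresponding to a vector of a principal series. -/
def valueOne (e : W ≃ₗ[ℂ] inducedSpace τ) : W →ₗ[ℂ] V where
  toFun w := (e w : Mp E → V) 1
  map_add' _ _ := by rw [map_add]; rfl
  map_smul' _ _ := by rw [map_smul]; rfl

variable {e : W ≃ₗ[ℂ] inducedSpace τ}

omit [CharZero E] in
theorem restrict_apply (w : W) (n : E) :
    restrict e w n = (e w : Mp E → V) (weyl * unip n) := rfl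

theorem valueOne_apply (w : W) : valueOne e w = (e w : Mp E → V) 1 := rfl

theorem restrict_unip (he : ∀ g w x, (e (π g w) : Mp E → V) x = (e w : Mp E → V) (x * g))
    (m : E) (w : W) (n : E) : restrict e (π (unip m) w) n = restrict e w (n + m) := by
  rw [restrict_apply, restrict_apply, he, mul_assoc, unip_add]

/-- `N` acts trivially on the value at `1`. In `π_{N,ψ}` the vector `π(m)w - w` represents `(ψ(m) -
1)w`, so for `ψ(m) ≠ 1` every class is represented by a vector with vanishing value at `1`. -/
theorem valueOne_unip_sub (he : ∀ g w x, (e (π g w) : Mp E → V) x = (e w : Mp E → V) (x * g))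
    (m : E) (w : W) : valueOne e (π (unip m) w - w) = 0 := by
  rw [map_sub, valueOne_apply, valueOne_apply, he, one_mul, sub_eq_zero]
  have h := apply_unip_mul (e w).2 m 1 1
  have h1 : deltaHalf (1 : GL (Fin 2) E) = 1 := deltaHalf_of_mem_scalars (one_mem _)
  have h2 : ((1 : cover (torus E)) : Mp E).gl = 1 := rfl
  rw [h2, h1] at h
  simpa using h

theorem restrict_scalars (he : ∀ g w x, (e (π g w) : Mp E → V) x = (e w : Mp E → V) (x * g))
    (z : cover (scalars E)) (w : W) (n : E) :
    restrict e (π z w) n = τ ⟨z, cover_scalars_le z.2⟩ (restrict e w n) := by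
  rw [restrict_apply, restrict_apply, he, mul_assoc, ← cover_scalars_comm z.2, ← mul_assoc, weyl_mul_comm,
    mul_assoc]
  have h := apply_unip_mul (e w).2 0 ⟨z, cover_scalars_le z.2⟩ (weyl * unip n)
  rw [deltaHalf_of_mem_scalars (mem_cover.1 z.2)] at h
  simpa using h

theorem valueOne_scalars (he : ∀ g w x, (e (π g w) : Mp E → V) x = (e w : Mp E → V) (x * g))
    (z : cover (scalars E)) {w : W} (hw : valueOne e w = 0) : valueOne e (π z w) = 0 := by
  rw [valueOne_apply, he, one_mul]
  have h := apply_unip_mul (e w).2 0 ⟨z, cover_scalars_le z.2⟩ 1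
  rw [← valueOne_apply, hw, map_zero, smul_zero] at h
  simpa using h

theorem eq_of_restrict_eq {w w' : W} (hw : valueOne e w = 0) (hw' : valueOne e w' = 0)
    (h : ∀ n, restrict e w n = restrict e w' n) : w = w' := by
  apply e.injective
  apply Subtype.ext
  rw [eq_bigCell (e w).2 hw, eq_bigCell (e w').2 hw']
  congr 1
  exact funext h

variable {σ : GL (Fin 2) E → Mp E}

theorem exists_restrict_eq (e : W ≃ₗ[ℂ] inducedSpace τ) (hσ : IsLocalSection σ)
    (hsm : IsSmoothRep τ) {Φ : E → V} (hΦ : IsLocallyConstant Φ) (hΦ' : HasCompactSupport Φ) :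
    ∃ w : W, valueOne e w = 0 ∧ restrict e w = Φ := by
  refine ⟨e.symm ⟨_, bigCell_mem hσ hsm hΦ hΦ'⟩, ?_, funext fun n ↦ ?_⟩
  · rw [valueOne_apply, LinearEquiv.apply_symm_apply]
    exact bigCell_of_eq Φ rfl
  · rw [restrict_apply, LinearEquiv.apply_symm_apply]
    exact bigCell_weyl Φ n

variable {ψ : AddChar E Circle}

/-- Existence of Whittaker functionals. -/
theorem exists_whittaker [MeasurableSpace E] [BorelSpace E] (hσ : IsLocalSection σ)
    (he : ∀ g w x, (e (π g w) : Mp E → V) x = (e w : Mp E → V) (x * g))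
    (hψ_cont : Continuous ψ) (hψ : ψ ≠ 1) (ξ : V →ₗ[ℂ] ℂ) :
    ∃ l : W →ₗ[ℂ] ℂ, (∀ n w, l (π (unip n) w) = ψ n * l w) ∧ ∀ w, valueOne e w = 0 →
      l w = ∫ n, (ψ (-n) : ℂ) * ξ (restrict e w n) ∂(Measure.addHaar : Measure E) := by
  obtain ⟨n₀, hn₀⟩ : ∃ n₀, ψ n₀ ≠ 1 := by
    by_contra! h
    exact hψ (DFunLike.ext _ _ h)
  have hn₀' : (ψ n₀ : ℂ) - 1 ≠ 0 := sub_ne_zero.2 fun h ↦ hn₀ (Circle.ext h)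
  set μ : Measure E := Measure.addHaar
  let J (w : W) : ℂ := ∫ n, (ψ (-n) : ℂ) * ξ (restrict e w n) ∂μ
  have hint {w : W} (hw : valueOne e w = 0) :
      Integrable (fun n ↦ (ψ (-n) : ℂ) * ξ (restrict e w n)) μ := by
    have h1 : IsLocallyConstant fun n ↦ ξ (restrict e w n) :=
      (isLocallyConstant_restrict hσ (e w).2).comp ξ
    have h2 : HasCompactSupport fun n ↦ ξ (restrict e w n) :=
      (hasCompactSupport_restrict hσ (e w).2 hw).comp_left (map_zero ξ)
    exact (((continuous_subtype_val : Continuous fun z : Circle ↦ (z : ℂ)).comp (hψ_cont.comp continuous_neg)).mul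
      h1.continuous).integrable_of_hasCompactSupport h2.mul_left
  have hJadd {w w' : W} (hw : valueOne e w = 0) (hw' : valueOne e w' = 0) :
      J (w + w') = J w + J w' := by
    simp only [J]
    rw [← integral_add (hint hw) (hint hw')]
    simp only [map_add, Pi.add_apply, mul_add]
  have hJsmul (c : ℂ) (w : W) : J (c • w) = c * J w := by
    simp only [J]
    rw [← integral_const_mul]
    simp only [map_smul, Pi.smul_apply, smul_eq_mul]
    congr 1
    ext n
    ring
  have hJunip (m : E) (w : W) : J (π (unip m) w) = ψ m * J w := by
    simp only [J]
    rw [← integral_const_mul, ← integral_add_right_eq_self (μ := μ)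
      (fun n ↦ (ψ m : ℂ) * ((ψ (-n) : ℂ) * ξ (restrict e w n))) m]
    congr 1
    ext n
    have : m + -(n + m) = -n := by ring
    rw [restrict_unip he, ← mul_assoc, ← Circle.coe_mul, ← AddChar.map_add_eq_mul, this]
  -- The integral `J` need not converge for general `w`, but it does for `π(n₀)w - w`. When `w`
  -- itself vanishes at `1`, that integral is `(ψ(n₀) - 1)J(w)`, so `l` extends `J`.
  let l : W →ₗ[ℂ] ℂ :=
    { toFun := fun w ↦ ((ψ n₀ : ℂ) - 1)⁻¹ * J (π (unip n₀) w - w)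
      map_add' := fun w w' ↦ by
        rw [map_add, add_sub_add_comm, hJadd (valueOne_unip_sub he _ _) (valueOne_unip_sub he _ _),
          mul_add]
      map_smul' := fun c w ↦ by
        rw [map_smul, ← smul_sub, hJsmul, RingHom.id_apply, smul_eq_mul, mul_left_comm] }
  refine ⟨l, fun n w ↦ ?_, fun w hw ↦ ?_⟩
  · change _ * J (π (unip n₀) (π (unip n) w) - π (unip n) w) = _ * (_ * J _)
    rw [← Module.End.mul_apply, ← map_mul, ← unip_add, add_comm, unip_add, map_mul,
      Module.End.mul_apply, ← map_sub, hJunip, mul_left_comm]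
  · change _ * J (π (unip n₀) w - w) = J w
    have hw' : valueOne e (-w) = 0 := by rw [map_neg, hw, neg_zero]
    have hw'' : valueOne e (π (unip n₀) w) = 0 := by
      have := valueOne_unip_sub he n₀ w
      rwa [map_sub, hw, sub_zero] at this
    rw [sub_eq_add_neg (π (unip n₀) w), hJadd hw'' hw', hJunip, ← neg_one_smul ℂ w, hJsmul,
      neg_one_mul, ← sub_eq_add_neg, ← sub_one_mul, inv_mul_cancel_left₀ hn₀']

omit [CharZero E] [ValuativeRel E] [TopologicalSpace E] [IsNonarchimedeanLocalField E] in
theorem mk_unip (n : E) (w : W) : (jacquetKer π ψ).mkQ (π (unip n) w) =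
    (ψ n : ℂ) • (jacquetKer π ψ).mkQ w := by
  rw [← map_smul, ← sub_eq_zero, ← map_sub, Submodule.mkQ_apply, Submodule.Quotient.mk_eq_zero]
  exact Submodule.subset_span ⟨n, w, rfl⟩

/-- Modulo `π(N, ψ)`, every vector supported on the big cell is given by a function
`1_c ⊗ v` with `c` a small compact open subgroup. -/
theorem exists_mkQ_eq [MeasurableSpace E] [BorelSpace E] (hσ : IsLocalSection σ)
    (hsm : IsSmoothRep τ)
    (he : ∀ g w x, (e (π g w) : Mp E → V) x = (e w : Mp E → V) (x * g))
    (hψ_cont : Continuous ψ) {w : W} (hw : valueOne e w = 0) :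
    ∃ (κ : ℂ) (v : V) (w' : W), κ ≠ 0 ∧ valueOne e w' = 0 ∧ (v = 0 → w' = 0) ∧
      (jacquetKer π ψ).mkQ w = (jacquetKer π ψ).mkQ w' ∧
      ∀ ξ : V →ₗ[ℂ] ℂ,
        ∫ n, (ψ (-n) : ℂ) * ξ (restrict e w' n) ∂(Measure.addHaar : Measure E) = κ * ξ v := by
  classical
  have hlc := isLocallyConstant_restrict hσ (e w).2
  have hcs := hasCompactSupport_restrict hσ (e w).2 hw
  obtain ⟨I, hI, hIc, hIs, hκ⟩ := exists_openAddSubgroup_integral_ne_zero hψ_cont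
    (exists_nhds_forall_add_eq hlc hcs)
  have hper (n t : E) (ht : t ∈ I) : restrict e w (n + t) = restrict e w n := hIs ht n
  -- `S v` is the vector with function `1_I ⊗ v` on `wN`.
  choose S hS1 hS2 using fun v : V ↦ exists_restrict_eq e hσ hsm
    (isLocallyConstant_indicator hI v) (hasCompactSupport_indicator hIc v)
  have hfin : {q : E ⧸ I | restrict e w q.out ≠ 0}.Finite := by
    have : DiscreteTopology (E ⧸ I) := QuotientAddGroup.discreteTopology hI
    have hK : IsCompact ((QuotientAddGroup.mk : E → E ⧸ I) '' tsupport (restrict e w)) :=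
      hcs.isCompact.image continuous_quotient_mk'
    refine hK.finite_of_discrete.subset fun q hq ↦ ⟨q.out, subset_tsupport _ hq, q.out_eq'⟩
  set F := hfin.toFinset
  have hval (n : E) (w : W) (hw : valueOne e w = 0) : valueOne e (π (unip n) w) = 0 := by
    have := valueOne_unip_sub he n w
    rwa [map_sub, hw, sub_zero] at this
  -- The `I`-periodic function of `w` is a finite sum of translates of functions `1_I ⊗ v`. In the
  -- quotient the translation by `-q` becomes the scalar `ψ(-q)`, so the sum collapses to a single
  -- `S v`.
  have hdec : w = ∑ q ∈ F, π (unip (-q.out)) (S (restrict e w q.out)) := by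
    refine eq_of_restrict_eq hw ?_ fun n ↦ ?_
    · rw [map_sum]
      exact Finset.sum_eq_zero fun q _ ↦ hval _ _ (hS1 _)
    · rw [map_sum, Finset.sum_apply]
      have hterm (q : E ⧸ I) : restrict e (π (unip (-q.out)) (S (restrict e w q.out))) n =
          if q = QuotientAddGroup.mk n then restrict e w n else 0 := by
        rw [restrict_unip he, hS2]
        have hiff : n + -q.out ∈ (I : Set E) ↔ q = QuotientAddGroup.mk n := by
          conv_rhs => rw [← q.out_eq']
          change _ ↔ (QuotientAddGroup.mk q.out : E ⧸ I) = QuotientAddGroup.mk n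
          rw [QuotientAddGroup.eq, add_comm]
          rfl
        split_ifs with h
        · rw [Set.indicator_of_mem (hiff.2 h)]
          have := hper q.out (n + -q.out) (hiff.2 h)
          rwa [add_comm n, add_neg_cancel_left, eq_comm] at this
        · rw [Set.indicator_of_notMem fun h' ↦ h (hiff.1 h')]
      simp only [hterm]
      rw [Finset.sum_ite_eq']
      split_ifs with h
      · rfl
      · rw [Set.Finite.mem_toFinset, Set.mem_ofPred_eq, not_not] at h
        obtain ⟨t, ht⟩ := QuotientAddGroup.mk_out_eq_add I n
        rw [← h, ht]
        exact (hper _ _ t.2).symm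
  set v : V := ∑ q ∈ F, (ψ (-q.out) : ℂ) • restrict e w q.out
  refine ⟨_, v, S v, hκ, hS1 v, fun hv ↦ ?_, ?_, fun ξ ↦ ?_⟩
  · refine eq_of_restrict_eq (hS1 _) (map_zero _) fun n ↦ ?_
    rw [hS2, hv, map_zero]
    simp
  · have hSv : S v = ∑ q ∈ F, (ψ (-q.out) : ℂ) • S (restrict e w q.out) := by
      refine eq_of_restrict_eq (hS1 _) ?_ fun n ↦ ?_
      · rw [map_sum]
        exact Finset.sum_eq_zero fun q _ ↦ by rw [map_smul, hS1, smul_zero]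
      · rw [map_sum, Finset.sum_apply, hS2]
        simp only [map_smul, Pi.smul_apply, hS2]
        by_cases hn : n ∈ (I : Set E)
        · simp only [Set.indicator_of_mem hn, v]
        · simp only [Set.indicator_of_notMem hn, smul_zero, Finset.sum_const_zero]
    rw [hSv]
    conv_lhs => rw [hdec]
    simp only [map_sum, map_smul, mk_unip]
  · rw [hS2, ← integral_mul_const]
    congr 1
    ext n
    by_cases hn : n ∈ (I : Set E)
    · simp [hn]
    · simp [hn]

end Whittaker

end Metaplectic

end

/-! ### The structure of the twisted Jacquet module. -/

open Metaplectic in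
theorem mainTheorem10
    {E : Type*} [Field E] [CharZero E] [ValuativeRel E] [TopologicalSpace E]
    [IsNonarchimedeanLocalField E]
    {V : Type*} [AddCommGroup V] [Module ℂ V] (τ : cover (torus E) →* Module.End ℂ V)
    (hτ_irr : IsIrred τ) (hτ_smooth : IsSmoothRep τ) (hτ_gen : IsGenuine τ)
    {W : Type*} [AddCommGroup W] [Module ℂ W] (π : Mp E →* Module.End ℂ W)
    (hπ : IsInducedFrom π τ)
    (ω : cover (scalarsSq E) →* ℂˣ) (hω : IsCentralChar π ω)
    (ψ : AddChar E Circle) (hψ_cont : Continuous ψ) (hψ : ψ ≠ 1) :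
    (∀ μ : Omega ω, ∃ l : JacquetModule π ψ →ₗ[ℂ] ℂ, l ≠ 0 ∧
      ∀ (z : cover (scalars E)) (v : JacquetModule π ψ),
        l (jacquetRep π ψ z v) = (μ.1 z : ℂ) * l v) ∧
    (∃ e : JacquetModule π ψ ≃ₗ[ℂ] DirectSum (Omega ω) (fun _ ↦ ℂ),
      ∀ (z : cover (scalars E)) (v : JacquetModule π ψ),
        e (jacquetRep π ψ z v) = omegaRep ω z (e v)) ∧
    Module.Finite ℂ (JacquetModule π ψ) ∧
    Module.finrank ℂ (JacquetModule π ψ) = (powMonoidHom 2 : Eˣ →* Eˣ).range.index := by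
  classical
  obtain ⟨e, he⟩ := hπ
  have hV := hτ_irr.1
  obtain ⟨σ, hσ⟩ := exists_isLocalSection hτ_smooth hτ_gen
  borelize E
  -- Every `v` is the value at `w` of some function in the induced space, so the central character
  -- of `π` is also that of `τ`.
  have hωτ (z : cover (scalarsSq E)) (v : V) :
      τ ⟨z, cover_scalars_le (cover_scalarsSq_le z.2)⟩ v = (ω z : ℂ) • v := by
    obtain ⟨I, hI, hIc, -, -⟩ := exists_openAddSubgroup_subset (Filter.univ_mem : _ ∈ nhds (0 : E))
    obtain ⟨w, -, hw⟩ := exists_restrict_eq e hσ hτ_smooth (isLocallyConstant_indicator hI v)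
      (hasCompactSupport_indicator hIc v)
    have h0 : restrict e w 0 = v := by
      rw [hw]
      exact Set.indicator_of_mem I.zero_mem _
    rw [← h0, ← restrict_scalars he ⟨z, cover_scalarsSq_le z.2⟩ w 0, hω z, map_smul, Pi.smul_apply]
  obtain ⟨hcard, b, hb⟩ := exists_basis_omega hτ_gen hτ_irr hτ_smooth hωτ
  have hfin : Finite (Omega ω) := Nat.finite_of_card_ne_zero (hcard ▸ index_sq_units_ne_zero E)
  have : Fintype (Omega ω) := Fintype.ofFinite _
  choose l hl hl' using exists_whittaker hσ he hψ_cont hψ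
  have hker (ξ : V →ₗ[ℂ] ℂ) : jacquetKer π ψ ≤ LinearMap.ker (l ξ) := by
    refine Submodule.span_le.2 ?_
    rintro _ ⟨n, w, rfl⟩
    rw [SetLike.mem_coe, LinearMap.mem_ker, map_sub, map_smul, hl, smul_eq_mul, sub_self]
  obtain ⟨n₀, hn₀⟩ : ∃ n₀, ψ n₀ ≠ 1 := by
    by_contra! h
    exact hψ (DFunLike.ext _ _ h)
  have hn₀' : (ψ n₀ : ℂ) - 1 ≠ 0 := sub_ne_zero.2 fun h ↦ hn₀ (Circle.ext h)
  have hsub1 (x : JacquetModule π ψ) : (ψ n₀ : ℂ) • x - x = ((ψ n₀ : ℂ) - 1) • x := by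
    rw [sub_smul, one_smul]
  -- every vector is equivalent to one supported on the big cell
  have hsub (w : W) : ∃ w₀ : W, valueOne e w₀ = 0 ∧
      (jacquetKer π ψ).mkQ w₀ = (jacquetKer π ψ).mkQ w ∧
      w₀ = ((ψ n₀ : ℂ) - 1)⁻¹ • (π (unip n₀) w - w) := by
    refine ⟨_, ?_, ?_, rfl⟩
    · rw [map_smul, valueOne_unip_sub he, smul_zero]
    · rw [map_smul, map_sub, mk_unip, hsub1, inv_smul_smul₀ hn₀']
  have hlmk (ξ : V →ₗ[ℂ] ℂ) {w w' : W} (h : (jacquetKer π ψ).mkQ w = (jacquetKer π ψ).mkQ w') :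
      l ξ w = l ξ w' := by
    rw [← sub_eq_zero, ← map_sub, Submodule.mkQ_apply, Submodule.Quotient.mk_eq_zero] at h
    rw [← sub_eq_zero, ← map_sub]
    exact hker ξ h
  -- One Whittaker functional for each coordinate in the eigenbasis of `τ`; together they identify
  -- `π_{N,ψ}` with `V` in coordinates.
  let Λ : W →ₗ[ℂ] (Omega ω → ℂ) := LinearMap.pi fun μ ↦ l (b.coord μ)
  have hΛker : LinearMap.ker Λ = jacquetKer π ψ := by
    refine le_antisymm (fun w hw ↦ ?_) fun w hw ↦ ?_
    · obtain ⟨w₀, hw₀, hmk, -⟩ := hsub w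
      obtain ⟨κ, v, w', hκ, hw', hv, hmk', hint⟩ :=
        exists_mkQ_eq (ψ := ψ) hσ hτ_smooth he hψ_cont hw₀
      -- Modulo the Jacquet kernel `w` is `1_I ⊗ v`, on which the functional of index `μ` is the
      -- nonzero `κ` times the coordinate of `v`.
      have hv0 : v = 0 := b.ext_elem fun μ ↦ by
        have h1 : l (b.coord μ) w = 0 := congrFun (LinearMap.mem_ker.1 hw) μ
        rw [hlmk _ (hmk.symm.trans hmk'), hl' _ _ hw', hint, mul_eq_zero] at h1
        simpa using h1.resolve_left hκ
      rw [← Submodule.Quotient.mk_eq_zero, ← Submodule.mkQ_apply, ← hmk, hmk', hv hv0, map_zero]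
    · exact LinearMap.mem_ker.2 (funext fun μ ↦ hker _ hw)
  have hΛsurj : LinearMap.range Λ = ⊤ := by
    obtain ⟨I, hI, hIc, -, hκ⟩ :=
      exists_openAddSubgroup_integral_ne_zero hψ_cont (Filter.univ_mem : _ ∈ nhds (0 : E))
    refine LinearMap.range_eq_top.2 fun x ↦ ?_
    set v : V := b.equivFun.symm x
    obtain ⟨w, hw, hwv⟩ := exists_restrict_eq e hσ hτ_smooth (isLocallyConstant_indicator hI v)
      (hasCompactSupport_indicator hIc v)
    refine ⟨(∫ n, (ψ (-n) : ℂ) * (I : Set E).indicator (fun _ ↦ 1) n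
      ∂(MeasureTheory.Measure.addHaar : MeasureTheory.Measure E))⁻¹ • w, ?_⟩
    rw [map_smul, inv_smul_eq_iff₀ hκ]
    ext μ
    change l (b.coord μ) w = _ * x μ
    have hx : x μ = b.coord μ v := by
      rw [Module.Basis.coord_apply, ← b.equivFun_apply, LinearEquiv.apply_symm_apply]
    rw [hl' _ _ hw, hwv, hx, ← MeasureTheory.integral_mul_const]
    congr 1
    ext n
    by_cases hn : n ∈ (I : Set E) <;> simp [hn]
  have hcoord (μ : Omega ω) (z : cover (scalars E)) (v : V) :
      b.coord μ (τ ⟨z, cover_scalars_le z.2⟩ v) = (μ.1 z : ℂ) * b.coord μ v := by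
    have h1 : b.coord μ ∘ₗ τ ⟨z, cover_scalars_le z.2⟩ = (μ.1 z : ℂ) • b.coord μ := by
      refine b.ext fun ν ↦ ?_
      rw [LinearMap.comp_apply, hb, map_smul, LinearMap.smul_apply]
      by_cases h : ν = μ
      · rw [h]
      · simp [Module.Basis.coord_apply, h]
    exact LinearMap.congr_fun h1 v
  -- The integral formula holds only for vectors vanishing at `1`, so `w` is first replaced by `w₀`;
  -- applying `z` respects this, as `Z̃` commutes with `N`.
  have hΛz (z : cover (scalars E)) (w : W) (μ : Omega ω) : Λ (π z w) μ = (μ.1 z : ℂ) * Λ w μ := by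
    obtain ⟨w₀, hw₀, hmk, hw₀'⟩ := hsub w
    have hcomm : π z (π (unip n₀) w) = π (unip n₀) (π z w) := by
      rw [← Module.End.mul_apply, ← map_mul, cover_scalars_comm z.2, map_mul, Module.End.mul_apply]
    have hmkz : (jacquetKer π ψ).mkQ (π z w₀) = (jacquetKer π ψ).mkQ (π z w) := by
      rw [hw₀', map_smul, map_sub, hcomm, map_smul, map_sub, mk_unip, hsub1,
        inv_smul_smul₀ hn₀']
    change l (b.coord μ) (π z w) = _ * l (b.coord μ) w
    rw [← hlmk _ hmkz, ← hlmk _ hmk, hl' _ _ hw₀, hl' _ _ (valueOne_scalars he z hw₀),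
      ← MeasureTheory.integral_const_mul]
    congr 1
    ext n
    rw [restrict_scalars he, hcoord, mul_left_comm]
  let e₁ : JacquetModule π ψ ≃ₗ[ℂ] (Omega ω → ℂ) :=
    (Submodule.quotEquivOfEq _ _ hΛker.symm).trans
      (Λ.quotKerEquivOfSurjective (LinearMap.range_eq_top.1 hΛsurj))
  have he₁ (w : W) : e₁ ((jacquetKer π ψ).mkQ w) = Λ w := rfl
  have he₁z (z : cover (scalars E)) (v : JacquetModule π ψ) (μ : Omega ω) :
      e₁ (jacquetRep π ψ z v) μ = (μ.1 z : ℂ) * e₁ v μ := by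
    obtain ⟨w, rfl⟩ := (jacquetKer π ψ).mkQ_surjective v
    exact hΛz z w μ
  refine ⟨fun μ ↦ ⟨LinearMap.proj μ ∘ₗ e₁.toLinearMap, fun h ↦ ?_, fun z v ↦ he₁z z v μ⟩,
    ⟨e₁.trans (DirectSum.linearEquivFunOnFintype ℂ (Omega ω) fun _ ↦ ℂ).symm, fun z v ↦ ?_⟩,
    Module.Finite.equiv e₁.symm, ?_⟩
  · have h1 := LinearMap.congr_fun h (e₁.symm (Pi.single μ 1))
    simp at h1
  · apply (DirectSum.linearEquivFunOnFintype ℂ (Omega ω) fun _ ↦ ℂ).injective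
    ext μ
    rw [LinearEquiv.trans_apply, LinearEquiv.apply_symm_apply, he₁z, LinearEquiv.trans_apply]
    simp only [omegaRep, MonoidHom.coe_mk, OneHom.coe_mk, DirectSum.linearEquivFunOnFintype_apply,
      DirectSum.lmap_apply, LinearMap.smul_apply, LinearMap.id_apply, smul_eq_mul]
    congr 1
  · rw [e₁.finrank_eq, Module.finrank_fintype_fun_eq_card, ← Nat.card_eq_fintype_card, hcard]
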